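/- Let $d\ge 1$, let $V(x)=\sum_{j=1}^{d}v_jx^{2j}$ be an even real polynomial with $v_d>0$, and let $a>0$. Let $\sigma$ be the measure on $i\mathbb R$ with constant density $a/\pi$ with respect to arc length. For a positive measure $\mu$ on $\mathbb C$ write $$U^{\mu}(z)=\int\log\frac{1}{|z-w|}\,d\mu(w)$$ for its logarithmic potential. Consider the energy functional $$E(\mu_1,\mu_2)=\iint\log\frac1{|x-y|}\,d\mu_1(x)d\mu_1(y)+\iint\log\frac1{|x-y|}\,d\mu_2(x)d\mu_2(y)-\iint\log\frac1{|x-y|}\,d\mu_1(x)d\mu_2(y)+\int\bigl(V(x)-a|x|\bigr)\,d\mu_1(x)$$ over all pairs $(\mu_1,\mu_2)$ of positive measures of finite logarithmic energy (the double integral $\iint\log\frac{1}{|x-y|}\,d\mu_j(x)d\mu_j(y)$ converges absolutely, $j=1,2$) such that $\mu_1$ is a measure on $\mathbb R$ of total mass $1$, and $\mu_2$ is a measure on $i\mathbb R$ of total mass $1/2$ with $\mu_2\le\sigma$. Let $(\mu_1,\mu_2)$ be the minimizer of $E$ over this class. Then $U^{\mu_1}$ and $U^{\mu_2}$ are finite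 at every point of $\mathbb R\cup i\mathbb R$, and there is a constant $\ell\in\mathbb R$ such that $$2U^{\mu_1}(x)=U^{\mu_2}(x)-V(x)+a|x|-\ell\qquad\text{for all }x\in\operatorname{supp}(\mu_1),$$ $$2U^{\mu_1}(x)\ge U^{\mu_2}(x)-V(x)+a|x|-\ell\qquad\text{for all }x\in\mathbb R\setminus\operatorname{supp}(\mu_1).$$ Moreover, $$2U^{\mu_2}(z)=U^{\mu_1}(z)\qquad\text{for all }z\in\operatorname{supp}(\sigma-\mu_2),$$ $$2U^{\mu_2}(z)<U^{\mu_1}(z)\qquad\text{for all }z\in i\mathbb R\setminus\operatorname{supp}(\sigma-\mu_2).$$ -/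

import Mathlib

open MeasureTheory Complex

noncomputable section

namespace ExternalSource

/-- The integral of an extended-real-valued function, `∫ f⁺ dμ - ∫ f⁻ dμ`.  Because `⊤ - ⊤ = ⊥`
in `EReal`, the value is a real number exactly when both parts have a finite integral, i.e. exactly
when `f` is integrable, and it is `⊤` exactly when `∫ f⁺ dμ = ∞` and `∫ f⁻ dμ < ∞`. -/
def extIntegral {α : Type*} [MeasurableSpace α] (μ : Measure α) (f : α → EReal) : EReal :=
  ((∫⁻ x, (f x).toENNReal ∂μ : ENNReal) : EReal) -
    ((∫⁻ x, (-f x).toENNReal ∂μ : ENNReal) : EReal)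

/-- The logarithmic kernel `log (1 / |z - w|)`, equal to `+∞` on the diagonal. -/
def logKernel (z w : ℂ) : EReal :=
  if z = w then ⊤ else ((Real.log (1 / ‖z - w‖) : ℝ) : EReal)

/-- The logarithmic potential `U^μ(z) = ∫ log (1 / |z - w|) dμ(w)`. -/
def logPotential (μ : Measure ℂ) (z : ℂ) : EReal :=
  extIntegral μ (fun w => logKernel z w)

/-- The mixed logarithmic energy `I(μ, ν) = ∬ log (1 / |z - w|) dμ(z) dν(w)`. -/
def mixedEnergy (μ ν : Measure ℂ) : EReal :=
  extIntegral (μ.prod ν) (fun p => logKernel p.1 p.2)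

/-- The logarithmic energy `I(μ)`. -/
def logEnergy (μ : Measure ℂ) : EReal := mixedEnergy μ μ

/-- The double integral defining the logarithmic energy converges absolutely. -/
def HasFiniteLogEnergy (μ : Measure ℂ) : Prop := logEnergy μ ≠ ⊥ ∧ logEnergy μ ≠ ⊤

/-- The even polynomial `V(x) = ∑_{j=1}^d v_j x^{2j}`. -/
def evenPoly (d : ℕ) (v : ℕ → ℝ) (x : ℝ) : ℝ := ∑ j ∈ Finset.Icc 1 d, v j * x ^ (2 * j)

/-- The measure on the imaginary axis with constant density `a / π` with respect to arc length. -/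
def sigmaMeasure (a : ℝ) : Measure ℂ :=
  ENNReal.ofReal (a / Real.pi) • (volume : Measure ℝ).map (fun y : ℝ => (y : ℂ) * I)

/-- The pairs of measures over which the energy is minimized. -/
structure Admissible (a : ℝ) (μ₁ μ₂ : Measure ℂ) : Prop where
  finite_energy₁ : HasFiniteLogEnergy μ₁
  finite_energy₂ : HasFiniteLogEnergy μ₂
  on_real : μ₁ {z : ℂ | z.im ≠ 0} = 0
  mass₁ : μ₁ Set.univ = 1
  on_imag : μ₂ {z : ℂ | z.re ≠ 0} = 0
  mass₂ : μ₂ Set.univ = 1 / 2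
  le_sigma : μ₂ ≤ sigmaMeasure a

/-- The energy functional
`E(μ₁, μ₂) = I(μ₁) + I(μ₂) - I(μ₁, μ₂) + ∫ (V(x) - a|x|) dμ₁(x)`, with values in `(-∞, +∞]`
on admissible pairs. -/
def energy (V : ℝ → ℝ) (a : ℝ) (μ₁ μ₂ : Measure ℂ) : EReal :=
  logEnergy μ₁ + logEnergy μ₂ - mixedEnergy μ₁ μ₂ +
    extIntegral μ₁ (fun z => ((V z.re - a * |z.re| : ℝ) : EReal))

/-- `(μ₁, μ₂)` minimizes the energy among all admissible pairs. -/
def IsMinimizer (V : ℝ → ℝ) (a : ℝ) (μ₁ μ₂ : Measure ℂ) : Prop :=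
  Admissible a μ₁ μ₂ ∧
    ∀ ν₁ ν₂ : Measure ℂ, Admissible a ν₁ ν₂ → energy V a μ₁ μ₂ ≤ energy V a ν₁ ν₂

end ExternalSource

end

/-! ### The logarithmic kernel, its positive and negative parts, and real-valued integrals. -/

namespace ExternalSource

open Filter Topology

noncomputable section

/-! Write `W = V - a|x|` and `G = 2 U^{μ₂} - U^{μ₁}`. Finite energy gives both measures a
logarithmic moment, and `μ₂ ≤ σ` makes `U^{μ₂}` continuous, because a bounded density on a line has
uniformly small singular parts. The argument then has three pieces.

On the real axis, vary `μ₁` towards the uniform measure on a short segment starting at `x`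
(`IsMinimizer.first_variation_nonneg`) and shrink the segment. This gives `2 U^{μ₁} - U^{μ₂} + W ≥
L` wherever `U^{μ₁}(x)` is finite, where `L` is the `μ₁`-integral of the left side. Hence equality
holds `μ₁`-almost everywhere, and lower semicontinuity carries `≤`, together with finiteness of
`U^{μ₁}`, to the whole support (`IsMinimizer.le_on_support`).

On the imaginary axis, moving mass of `μ₂` from its support to the support of the slack `σ - μ₂`
cannot lower the energy. So `G` on `supp μ₂` is at most `G` on `supp (σ - μ₂)`
(`IsMinimizer.le_of_mem_support`). Let `c` be the supremum of `G` on `supp μ₂`. Since `2μ₂` and `μ₁`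
have equal mass, the domination principle `pot_le_pot_add_of_le_on` gives `G ≤ c` everywhere. The
slack has infinite mass, so its support is unbounded, and `G → 0` at infinity along the axis;
therefore `c = 0`. Thus `G ≤ 0` everywhere, with equality on `supp (σ - μ₂)`.

For strictness, domination also shows that `U^{μ₂}` and `supp (σ - μ₂)` are invariant under
conjugation. Potentials at `iy` then become integrals of `log |w² + y²|`, so concavity in `y²` can
be used. If `G(iy) = 0` at a point off the support, let `ib` be the next support point and put `c² =
(y² + b²)/2`. The second difference of the `μ₁`-part is strictly negative; that of `σ` vanishes, and
that of the slack has the opposite sign to what could spoil the estimate. This forces `G(ic) > 0`, a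
contradiction (`IsMinimizer.two_mul_pot_lt_of_nonneg`). -/

/-- The function `max (log (1 / s)) 0` of a nonnegative real `s`, with value `∞` at `0`. -/
def negLog (s : ℝ) : ENNReal := (-ENNReal.log (ENNReal.ofReal s)).toENNReal

/-- The positive part of the logarithmic kernel. -/
def posKer (z w : ℂ) : ENNReal := (logKernel z w).toENNReal

/-- The negative part of the logarithmic kernel. -/
def negKer (z w : ℂ) : ENNReal := (-logKernel z w).toENNReal

/-- The real-valued logarithmic potential. -/
def pot (μ : Measure ℂ) (z : ℂ) : ℝ := ∫ w, -Real.log ‖z - w‖ ∂μ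

/-- The real-valued mixed logarithmic energy. -/
def realEnergy (μ ν : Measure ℂ) : ℝ := ∫ p, -Real.log ‖p.1 - p.2‖ ∂(μ.prod ν)

end

lemma logKernel_eq (z w : ℂ) : logKernel z w = -ENNReal.log (ENNReal.ofReal ‖z - w‖) := by
  unfold logKernel
  split_ifs with h
  · simp [h]
  · rw [ENNReal.log_ofReal_of_pos (norm_pos_iff.2 (sub_ne_zero.2 h)), one_div, Real.log_inv]
    simp

lemma continuous_negLog : Continuous negLog :=
  EReal.continuous_toENNReal.comp <| continuous_neg.comp <|
    ENNReal.continuous_log.comp ENNReal.continuous_ofReal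

lemma measurable_negLog : Measurable negLog := continuous_negLog.measurable

lemma negLog_anti {s t : ℝ} (h : s ≤ t) : negLog t ≤ negLog s := by
  unfold negLog
  apply EReal.toENNReal_le_toENNReal
  rw [EReal.neg_le_neg_iff]
  exact ENNReal.log_le_log (ENNReal.ofReal_le_ofReal h)

lemma negLog_zero : negLog 0 = ⊤ := by simp [negLog]

lemma negLog_of_pos {s : ℝ} (h : 0 < s) : negLog s = ENNReal.ofReal (-Real.log s) := by
  unfold negLog
  rw [ENNReal.log_ofReal_of_pos h, ← EReal.coe_neg, EReal.real_coe_toENNReal]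

lemma posKer_eq (z w : ℂ) : posKer z w = negLog ‖z - w‖ := by
  rw [posKer, logKernel_eq, negLog]

lemma posKer_self (z : ℂ) : posKer z z = ⊤ := by simp [posKer_eq, negLog_zero]

lemma posKer_of_ne {z w : ℂ} (h : z ≠ w) :
    posKer z w = ENNReal.ofReal (-Real.log ‖z - w‖) := by
  rw [posKer_eq, negLog_of_pos (norm_pos_iff.2 (sub_ne_zero.2 h))]

lemma posKer_comm (z w : ℂ) : posKer z w = posKer w z := by
  rw [posKer_eq, posKer_eq, norm_sub_rev]

lemma negKer_eq (z w : ℂ) : negKer z w = ENNReal.ofReal (Real.log ‖z - w‖) := by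
  unfold negKer logKernel
  split_ifs with h
  · simp [h]
  · rw [one_div, Real.log_inv, EReal.coe_neg, neg_neg, EReal.real_coe_toENNReal]

lemma continuous_posKer : Continuous fun p : ℂ × ℂ => posKer p.1 p.2 := by
  simp only [posKer_eq]
  exact continuous_negLog.comp (by fun_prop)

lemma measurable_posKer : Measurable fun p : ℂ × ℂ => posKer p.1 p.2 :=
  continuous_posKer.measurable

lemma measurable_posKer_right (z : ℂ) : Measurable (posKer z) :=
  measurable_posKer.comp measurable_prodMk_left

lemma measurable_negKer : Measurable fun p : ℂ × ℂ => negKer p.1 p.2 := by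
  simp only [negKer_eq]
  fun_prop

/-- This is `‖z - w‖ ≤ (1 + ‖z‖)(1 + ‖w‖)`; on the diagonal the value `Real.log 0 = 0` does no harm.
It lets a logarithmic moment control the negative part of the kernel. -/
lemma log_norm_sub_le (z w : ℂ) :
    Real.log ‖z - w‖ ≤ Real.log (1 + ‖z‖) + Real.log (1 + ‖w‖) := by
  rcases eq_or_ne z w with rfl | h
  · simp only [sub_self, norm_zero, Real.log_zero]
    have := Real.log_nonneg (show (1 : ℝ) ≤ 1 + ‖z‖ by linarith [norm_nonneg z])
    linarith
  · rw [← Real.log_mul (by positivity) (by positivity)]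
    apply Real.log_le_log (norm_pos_iff.2 (sub_ne_zero.2 h))
    have := norm_sub_le z w
    nlinarith [norm_nonneg z, norm_nonneg w, mul_nonneg (norm_nonneg z) (norm_nonneg w)]

lemma log_one_add_norm_nonneg (z : ℂ) : 0 ≤ Real.log (1 + ‖z‖) :=
  Real.log_nonneg (by linarith [norm_nonneg z])

lemma negKer_le (z w : ℂ) :
    negKer z w ≤ ENNReal.ofReal (Real.log (1 + ‖z‖)) + ENNReal.ofReal (Real.log (1 + ‖w‖)) := by
  rw [negKer_eq, ← ENNReal.ofReal_add (log_one_add_norm_nonneg z) (log_one_add_norm_nonneg w)]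
  exact ENNReal.ofReal_le_ofReal (log_norm_sub_le z w)

/-- A converse to `log_norm_sub_le`: it recovers a logarithmic moment from finite energy and gives
the decay of potentials at infinity. -/
lemma log_one_add_norm_le (z w : ℂ) :
    Real.log (1 + ‖w‖) ≤
      Real.log (1 + ‖z‖) + Real.log 2 + max (Real.log ‖z - w‖) 0 := by
  have h1 : Real.log (1 + ‖w‖) ≤ Real.log (1 + ‖z‖) + Real.log (1 + ‖z - w‖) := by
    rw [← Real.log_mul (by positivity) (by positivity)]
    apply Real.log_le_log (by positivity)
    have : ‖w‖ ≤ ‖z‖ + ‖z - w‖ := by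
      have := norm_sub_le z (z - w)
      simpa using this
    nlinarith [norm_nonneg z, norm_nonneg w, mul_nonneg (norm_nonneg z) (norm_nonneg (z - w))]
  have h2 : Real.log (1 + ‖z - w‖) ≤ Real.log 2 + max (Real.log ‖z - w‖) 0 := by
    rcases le_total ‖z - w‖ 1 with h | h
    · have : Real.log (1 + ‖z - w‖) ≤ Real.log 2 :=
        Real.log_le_log (by positivity) (by linarith)
      linarith [le_max_right (Real.log ‖z - w‖) 0]
    · have : Real.log (1 + ‖z - w‖) ≤ Real.log (2 * ‖z - w‖) :=
        Real.log_le_log (by positivity) (by linarith)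
      rw [Real.log_mul (by norm_num) (by linarith)] at this
      linarith [le_max_left (Real.log ‖z - w‖) 0]
  linarith

section Parts

variable {α : Type*} [MeasurableSpace α] {m : Measure α} {f g : α → ℂ}

/-- The kernel is `⊤` on the diagonal, while `Real.log 0 = 0`. Integrability of the positive part
makes the diagonal null, which is what allows the extended integrals to be replaced by Bochner
integrals. -/
lemma ae_ne_of_lintegral_posKer_ne_top (hf : Measurable f) (hg : Measurable g)
    (hp : ∫⁻ x, posKer (f x) (g x) ∂m ≠ ⊤) : ∀ᵐ x ∂m, f x ≠ g x := by
  have h1 : Measurable fun x => posKer (f x) (g x) := measurable_posKer.comp (hf.prodMk hg)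
  filter_upwards [ae_lt_top h1 hp] with x hx hfg
  rw [hfg, posKer_self] at hx
  exact lt_irrefl _ hx

lemma lintegral_posKer_eq (hf : Measurable f) (hg : Measurable g)
    (hp : ∫⁻ x, posKer (f x) (g x) ∂m ≠ ⊤) :
    ∫⁻ x, posKer (f x) (g x) ∂m = ∫⁻ x, ENNReal.ofReal (-Real.log ‖f x - g x‖) ∂m := by
  apply lintegral_congr_ae
  filter_upwards [ae_ne_of_lintegral_posKer_ne_top hf hg hp] with x hx
  exact posKer_of_ne hx

lemma integrable_log_of_parts (hf : Measurable f) (hg : Measurable g)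
    (hp : ∫⁻ x, posKer (f x) (g x) ∂m ≠ ⊤) (hn : ∫⁻ x, negKer (f x) (g x) ∂m ≠ ⊤) :
    Integrable (fun x => Real.log ‖f x - g x‖) m := by
  refine ⟨((hf.sub hg).norm.log).aestronglyMeasurable, ?_⟩
  rw [hasFiniteIntegral_iff_norm]
  have h : ∀ r : ℝ, ENNReal.ofReal ‖r‖ ≤ ENNReal.ofReal (-r) + ENNReal.ofReal r := by
    intro r
    rcases le_total 0 r with h | h
    · rw [Real.norm_of_nonneg h]; exact le_add_self
    · rw [Real.norm_of_nonpos h]; exact le_self_add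
  calc ∫⁻ x, ENNReal.ofReal ‖Real.log ‖f x - g x‖‖ ∂m
      ≤ ∫⁻ x, (ENNReal.ofReal (-Real.log ‖f x - g x‖)
          + ENNReal.ofReal (Real.log ‖f x - g x‖)) ∂m := lintegral_mono fun x => h _
    _ = ∫⁻ x, posKer (f x) (g x) ∂m + ∫⁻ x, negKer (f x) (g x) ∂m := by
      rw [lintegral_add_left (by fun_prop), lintegral_posKer_eq hf hg hp]
      simp only [negKer_eq]
    _ < ⊤ := ENNReal.add_lt_top.2 ⟨hp.lt_top, hn.lt_top⟩

lemma integral_neg_log_eq_parts (hf : Measurable f) (hg : Measurable g)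
    (hp : ∫⁻ x, posKer (f x) (g x) ∂m ≠ ⊤) (hn : ∫⁻ x, negKer (f x) (g x) ∂m ≠ ⊤) :
    ∫ x, -Real.log ‖f x - g x‖ ∂m =
      (∫⁻ x, posKer (f x) (g x) ∂m).toReal - (∫⁻ x, negKer (f x) (g x) ∂m).toReal := by
  rw [integral_eq_lintegral_pos_part_sub_lintegral_neg_part
    (f := fun x => -Real.log ‖f x - g x‖) (integrable_log_of_parts hf hg hp hn).neg,
    lintegral_posKer_eq hf hg hp]
  simp only [negKer_eq, neg_neg]

lemma extIntegral_logKernel_eq (hf : Measurable f) (hg : Measurable g)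
    (hp : ∫⁻ x, posKer (f x) (g x) ∂m ≠ ⊤) (hn : ∫⁻ x, negKer (f x) (g x) ∂m ≠ ⊤) :
    extIntegral m (fun x => logKernel (f x) (g x)) =
      ((∫ x, -Real.log ‖f x - g x‖ ∂m : ℝ) : EReal) := by
  rw [integral_neg_log_eq_parts hf hg hp hn, EReal.coe_sub, EReal.coe_ennreal_toReal hp,
    EReal.coe_ennreal_toReal hn]
  rfl

end Parts

end ExternalSource

/-! ### Logarithmic moments, uniformly small singularities, continuity of potentials, mixed
energies. -/

namespace ExternalSource

open Filter Topology

/-- A finite measure with finite logarithmic moment. -/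
structure LogMoment (μ : Measure ℂ) : Prop where
  finite : IsFiniteMeasure μ
  moment : ∫⁻ w, ENNReal.ofReal (Real.log (1 + ‖w‖)) ∂μ ≠ ⊤

/-- The singular parts of the logarithmic potentials of the measure are uniformly small. -/
def UnifPos (ν : Measure ℂ) : Prop :=
  ∃ b : ℕ → ENNReal, (∀ n, b n ≠ ⊤) ∧ Tendsto b atTop (𝓝 0) ∧
    ∀ z : ℂ, ∀ n : ℕ, ∫⁻ w, (posKer z w - n) ∂ν ≤ b n

/-- The double integral of the logarithmic kernel against `μ` and `ν` converges absolutely. -/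
structure FiniteMixed (μ ν : Measure ℂ) : Prop where
  pos : ∫⁻ p, posKer p.1 p.2 ∂(μ.prod ν) ≠ ⊤
  neg : ∫⁻ p, negKer p.1 p.2 ∂(μ.prod ν) ≠ ⊤

variable {μ ν : Measure ℂ} {c : ENNReal}

namespace LogMoment

lemma mono (hμ : LogMoment μ) (h : ν ≤ μ) : LogMoment ν := by
  have := hμ.finite
  exact ⟨isFiniteMeasure_of_le μ h, ne_top_of_le_ne_top hμ.moment (lintegral_mono' h le_rfl)⟩

lemma add (hμ : LogMoment μ) (hν : LogMoment ν) : LogMoment (μ + ν) := by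
  have := hμ.finite
  have := hν.finite
  refine ⟨inferInstance, ?_⟩
  rw [lintegral_add_measure]
  exact ENNReal.add_ne_top.2 ⟨hμ.moment, hν.moment⟩

lemma smul (hμ : LogMoment μ) (hc : c ≠ ⊤) : LogMoment (c • μ) := by
  have := hμ.finite
  refine ⟨Measure.smul_finite μ hc, ?_⟩
  rw [lintegral_smul_measure]
  exact ENNReal.mul_ne_top hc hμ.moment

lemma integrable (hμ : LogMoment μ) : Integrable (fun w => Real.log (1 + ‖w‖)) μ := by
  refine ⟨(Measurable.log (by fun_prop)).aestronglyMeasurable, ?_⟩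
  rw [hasFiniteIntegral_iff_ofReal (ae_of_all _ log_one_add_norm_nonneg)]
  exact hμ.moment.lt_top

lemma lintegral_negKer_ne_top (hμ : LogMoment μ) (z : ℂ) : ∫⁻ w, negKer z w ∂μ ≠ ⊤ := by
  have := hμ.finite
  refine ne_top_of_le_ne_top ?_ (lintegral_mono (negKer_le z))
  rw [lintegral_add_left (by fun_prop), lintegral_const]
  exact ENNReal.add_ne_top.2
    ⟨ENNReal.mul_ne_top ENNReal.ofReal_ne_top (measure_ne_top _ _), hμ.moment⟩

lemma integrable_log (hμ : LogMoment μ) {z : ℂ} (h : ∫⁻ w, posKer z w ∂μ ≠ ⊤) :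
    Integrable (fun w => Real.log ‖z - w‖) μ :=
  integrable_log_of_parts (f := fun _ => z) measurable_const measurable_id h
    (hμ.lintegral_negKer_ne_top z)

lemma logPotential_eq (hμ : LogMoment μ) {z : ℂ} (h : ∫⁻ w, posKer z w ∂μ ≠ ⊤) :
    logPotential μ z = (pot μ z : EReal) :=
  extIntegral_logKernel_eq (f := fun _ => z) measurable_const measurable_id h
    (hμ.lintegral_negKer_ne_top z)

lemma pot_eq (hμ : LogMoment μ) {z : ℂ} (h : ∫⁻ w, posKer z w ∂μ ≠ ⊤) :
    pot μ z = (∫⁻ w, posKer z w ∂μ).toReal - (∫⁻ w, negKer z w ∂μ).toReal :=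
  integral_neg_log_eq_parts (f := fun _ => z) measurable_const measurable_id h
    (hμ.lintegral_negKer_ne_top z)

end LogMoment

namespace UnifPos

lemma mono (hμ : UnifPos μ) (h : ν ≤ μ) : UnifPos ν := by
  obtain ⟨b, h1, h2, h3⟩ := hμ
  exact ⟨b, h1, h2, fun z n => (lintegral_mono' h le_rfl).trans (h3 z n)⟩

lemma smul (hμ : UnifPos μ) (hc : c ≠ ⊤) : UnifPos (c • μ) := by
  obtain ⟨b, h1, h2, h3⟩ := hμ
  refine ⟨fun n => c * b n, fun n => ENNReal.mul_ne_top hc (h1 n), ?_, fun z n => ?_⟩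
  · simpa using ENNReal.Tendsto.const_mul h2 (Or.inr hc)
  · rw [lintegral_smul_measure, smul_eq_mul]
    exact mul_le_mul_right (h3 z n) c

lemma exists_bound (hμ : UnifPos μ) : ∃ C : NNReal, ∀ z, ∫⁻ w, posKer z w ∂μ ≤ C := by
  obtain ⟨b, h1, -, h3⟩ := hμ
  refine ⟨(b 0).toNNReal, fun z => ?_⟩
  rw [ENNReal.coe_toNNReal (h1 0)]
  simpa using h3 z 0

lemma lintegral_posKer_ne_top (hμ : UnifPos μ) (z : ℂ) : ∫⁻ w, posKer z w ∂μ ≠ ⊤ := by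
  obtain ⟨C, hC⟩ := hμ.exists_bound
  exact ne_top_of_le_ne_top ENNReal.coe_ne_top (hC z)

end UnifPos

lemma lintegral_negLog_abs_ne_top : ∫⁻ t : ℝ, negLog |t| ≠ ⊤ := by
  have h1 : ∫⁻ t : ℝ, negLog |t| = ∫⁻ t in Set.Ioc (-1 : ℝ) 1, ENNReal.ofReal (-Real.log t) := by
    rw [← lintegral_indicator measurableSet_Ioc]
    apply lintegral_congr_ae
    filter_upwards [measure_eq_zero_iff_ae_notMem.1 (Real.volume_singleton (a := 0)),
      measure_eq_zero_iff_ae_notMem.1 (Real.volume_singleton (a := -1))] with t ht ht'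
    simp only [Set.mem_singleton_iff] at ht ht'
    rw [negLog_of_pos (abs_pos.2 ht), Real.log_abs]
    by_cases hm : t ∈ Set.Ioc (-1 : ℝ) 1
    · rw [Set.indicator_of_mem hm]
    · rw [Set.indicator_of_notMem hm, ENNReal.ofReal_eq_zero, neg_nonpos, ← Real.log_abs]
      apply Real.log_nonneg
      by_contra hlt
      push Not at hlt
      exact hm ⟨(abs_lt.1 hlt).1, (abs_lt.1 hlt).2.le⟩
  rw [h1]
  have h2 : IntegrableOn (fun t : ℝ => -Real.log t) (Set.Ioc (-1) 1) :=
    ((intervalIntegrable_iff_integrableOn_Ioc_of_le (by norm_num)).1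
      intervalIntegral.intervalIntegrable_log').neg
  refine ne_top_of_le_ne_top h2.2.ne (lintegral_mono fun t => ?_)
  rw [← ofReal_norm]
  exact ENNReal.ofReal_le_ofReal (Real.le_norm_self _)

lemma ae_negLog_abs_lt_top : ∀ᵐ t : ℝ, negLog |t| < ⊤ :=
  ae_lt_top (measurable_negLog.comp measurable_norm) lintegral_negLog_abs_ne_top

lemma tendsto_lintegral_negLog_sub :
    Tendsto (fun n : ℕ => ∫⁻ t : ℝ, (negLog |t| - n)) atTop (𝓝 0) := by
  have : Tendsto (fun n : ℕ => ∫⁻ t : ℝ, (negLog |t| - n)) atTop (𝓝 (∫⁻ _ : ℝ, 0)) := by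
    apply tendsto_lintegral_of_dominated_convergence (fun t => negLog |t|)
    · intro n
      exact (measurable_negLog.comp measurable_norm).sub measurable_const
    · exact fun n => ae_of_all _ fun t => tsub_le_self
    · exact lintegral_negLog_abs_ne_top
    · filter_upwards [ae_negLog_abs_lt_top] with t ht
      apply tendsto_const_nhds.congr'
      obtain ⟨N, hN⟩ := ENNReal.exists_nat_gt ht.ne
      filter_upwards [eventually_ge_atTop N] with n hn
      rw [tsub_eq_zero_of_le]
      exact hN.le.trans (by exact_mod_cast hn)
  simpa using this

/-- The map `p` projects the plane to the coordinate of the line, so the singular part at `z` is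
dominated by that of `log (1 / |t|)` centred at `p z`. Translation invariance removes the dependence
on `z`. -/
lemma unifPos_map {f : ℝ → ℂ} (hf : Measurable f) (p : ℂ → ℝ)
    (h : ∀ z t, |p z - t| ≤ ‖z - f t‖) : UnifPos (Measure.map f volume) := by
  refine ⟨fun n : ℕ => ∫⁻ t : ℝ, (negLog |t| - n), fun n => ?_, tendsto_lintegral_negLog_sub,
    fun z n => ?_⟩
  · exact ne_top_of_le_ne_top lintegral_negLog_abs_ne_top (lintegral_mono fun t => tsub_le_self)
  · change _ ≤ ∫⁻ t : ℝ, (negLog |t| - n)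
    rw [lintegral_map (f := fun w => posKer z w - n)
      ((measurable_posKer_right z).sub measurable_const) hf,
      ← lintegral_sub_left_eq_self (fun t : ℝ => negLog |t| - n) (p z)]
    refine lintegral_mono fun t => ?_
    rw [posKer_eq]
    exact tsub_le_tsub_right (negLog_anti (h z t)) _

lemma unifPos_sigma (a : ℝ) : UnifPos (sigmaMeasure a) := by
  refine UnifPos.smul (unifPos_map (by fun_prop) (fun z => z.im) fun z t => ?_)
    ENNReal.ofReal_ne_top
  simpa using abs_im_le_norm (z - t * I)

lemma unifPos_real : UnifPos (Measure.map (fun t : ℝ => (t : ℂ)) volume) := by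
  refine unifPos_map (by fun_prop) (fun z => z.re) fun z t => ?_
  simpa using abs_re_le_norm (z - t)

section Continuity

/-- The truncated kernel `max (log ‖z - w‖) (-n)`. -/
noncomputable def truncKer (n : ℕ) (z w : ℂ) : ℝ := Real.log (max ‖z - w‖ (Real.exp (-n)))

lemma continuous_truncKer (n : ℕ) : Continuous fun p : ℂ × ℂ => truncKer n p.1 p.2 := by
  unfold truncKer
  exact Continuous.log (by fun_prop) fun p =>
    (lt_of_lt_of_le (Real.exp_pos _) (le_max_right _ _)).ne'

lemma abs_truncKer_le (n : ℕ) (z w : ℂ) :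
    |truncKer n z w| ≤ n + Real.log (1 + ‖z‖) + Real.log (1 + ‖w‖) := by
  have h0 : (0 : ℝ) ≤ n := n.cast_nonneg
  have h1 := log_one_add_norm_nonneg z
  have h2 := log_one_add_norm_nonneg w
  have h3 : -(n : ℝ) ≤ truncKer n z w := by
    rw [truncKer, Real.le_log_iff_exp_le (lt_of_lt_of_le (Real.exp_pos _) (le_max_right _ _))]
    exact le_max_right _ _
  have h4 : truncKer n z w ≤ Real.log (1 + ‖z‖) + Real.log (1 + ‖w‖) := by
    rcases max_cases ‖z - w‖ (Real.exp (-n)) with ⟨h, -⟩ | ⟨h, -⟩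
    · rw [truncKer, h]; exact log_norm_sub_le z w
    · rw [truncKer, h, Real.log_exp]; linarith
  rw [abs_le]
  constructor <;> linarith

lemma truncKer_sub_log {n : ℕ} {z w : ℂ} (h : z ≠ w) :
    truncKer n z w - Real.log ‖z - w‖ = (posKer z w - n).toReal := by
  have hp : 0 < ‖z - w‖ := norm_pos_iff.2 (sub_ne_zero.2 h)
  rw [posKer_of_ne h, ← ENNReal.ofReal_natCast, ← ENNReal.ofReal_sub _ n.cast_nonneg]
  rcases le_total ‖z - w‖ (Real.exp (-n)) with hle | hle
  · have : Real.log ‖z - w‖ ≤ -n := (Real.log_le_iff_le_exp hp).2 hle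
    rw [truncKer, max_eq_right hle, Real.log_exp, ENNReal.toReal_ofReal (by linarith)]
    ring
  · have : -(n : ℝ) ≤ Real.log ‖z - w‖ := (Real.le_log_iff_exp_le hp).2 hle
    rw [truncKer, max_eq_left hle, ENNReal.ofReal_of_nonpos (by linarith)]
    simp

lemma LogMoment.integrable_truncKer (hμ : LogMoment μ) (n : ℕ) (z : ℂ) :
    Integrable (truncKer n z) μ := by
  have := hμ.finite
  refine Integrable.mono' ((integrable_const ((n : ℝ) + Real.log (1 + ‖z‖))).add hμ.integrable)
    ((continuous_truncKer n).comp (Continuous.prodMk_right z)).aestronglyMeasurable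
    (ae_of_all _ fun w => abs_truncKer_le n z w)

lemma LogMoment.continuous_integral_truncKer (hμ : LogMoment μ) (n : ℕ) :
    Continuous fun z => ∫ w, truncKer n z w ∂μ := by
  have := hμ.finite
  rw [continuous_iff_continuousAt]
  intro z₀
  apply continuousAt_of_dominated
    (bound := fun w => (n + Real.log (1 + (‖z₀‖ + 1))) + Real.log (1 + ‖w‖))
  · exact Eventually.of_forall fun z =>
      ((continuous_truncKer n).comp (Continuous.prodMk_right z)).aestronglyMeasurable
  · filter_upwards [Metric.ball_mem_nhds z₀ one_pos] with z hz
    refine ae_of_all _ fun w => (abs_truncKer_le n z w).trans ?_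
    have : ‖z‖ ≤ ‖z₀‖ + 1 := by
      have h1 := norm_sub_norm_le z z₀
      rw [Metric.mem_ball, dist_eq_norm] at hz
      linarith
    have := Real.log_le_log (by positivity : 0 < 1 + ‖z‖) (by linarith : 1 + ‖z‖ ≤ 1 + (‖z₀‖ + 1))
    linarith
  · exact (integrable_const _).add hμ.integrable
  · exact ae_of_all _ fun w => ((continuous_truncKer n).comp
      (Continuous.prodMk_left w)).continuousAt

/-- Potentials of measures with uniformly small singular parts are continuous. -/
lemma LogMoment.continuous_pot (hμ : LogMoment μ) (hu : UnifPos μ) : Continuous (pot μ) := by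
  have hfin := hu.lintegral_posKer_ne_top
  obtain ⟨b, h1, h2, h3⟩ := hu
  refine continuous_of_uniform_approx_of_continuous fun u hu => ?_
  obtain ⟨ε, hε, hεu⟩ := Metric.mem_uniformity_dist.1 hu
  obtain ⟨n, hn⟩ := (h2.eventually (gt_mem_nhds (ENNReal.ofReal_pos.2 hε))).exists
  -- The truncated potentials are continuous, and their distance to `pot μ` is the integral of
  -- `(posKer - n)⁺`, which is small uniformly in `z`.
  refine ⟨fun z => -∫ w, truncKer n z w ∂μ, (hμ.continuous_integral_truncKer n).neg,
    fun z => hεu ?_⟩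
  have hi := hμ.integrable_log (hfin z)
  have e1 : pot μ z - -∫ w, truncKer n z w ∂μ = ∫ w, (posKer z w - n).toReal ∂μ := by
    rw [pot, integral_neg, sub_neg_eq_add, neg_add_eq_sub,
      ← integral_sub (hμ.integrable_truncKer n z) hi]
    apply integral_congr_ae
    filter_upwards [ae_ne_of_lintegral_posKer_ne_top (f := fun _ => z) measurable_const
      measurable_id (hfin z)] with w hw
    exact truncKer_sub_log hw
  have hm : Measurable fun w => posKer z w - (n : ENNReal) :=
    (measurable_posKer_right z).sub measurable_const
  have hlt : ∫⁻ w, (posKer z w - n) ∂μ < ENNReal.ofReal ε := (h3 z n).trans_lt hn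
  rw [Real.dist_eq, e1, integral_toReal hm.aemeasurable (ae_lt_top hm hlt.ne_top),
    abs_of_nonneg ENNReal.toReal_nonneg]
  exact (ENNReal.lt_ofReal_iff_toReal_lt hlt.ne_top).1 hlt

lemma LogMoment.exists_pot_le (hμ : LogMoment μ) (hu : UnifPos μ) : ∃ C, ∀ z, pot μ z ≤ C := by
  obtain ⟨C, hC⟩ := hu.exists_bound
  refine ⟨C, fun z => ?_⟩
  rw [hμ.pot_eq (hu.lintegral_posKer_ne_top z)]
  have h1 := ENNReal.toReal_mono ENNReal.coe_ne_top (hC z)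
  have h2 := ENNReal.toReal_nonneg (a := ∫⁻ w, negKer z w ∂μ)
  rw [ENNReal.coe_toReal] at h1
  linarith

end Continuity

lemma realEnergy_smul_left [SFinite ν] (c : ENNReal) :
    realEnergy (c • μ) ν = c.toReal * realEnergy μ ν := by
  rw [realEnergy, Measure.prod_smul_left, integral_smul_measure]
  rfl

lemma realEnergy_comm [SFinite μ] [SFinite ν] :
    realEnergy μ ν = realEnergy ν μ := by
  rw [realEnergy, realEnergy, ← integral_prod_swap]
  simp [norm_sub_rev]

namespace FiniteMixed

variable {μ' ν' : Measure ℂ}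

lemma symm [SFinite μ] [SFinite ν] (h : FiniteMixed μ ν) : FiniteMixed ν μ := by
  constructor
  · rw [← lintegral_prod_swap (fun p => posKer p.1 p.2)]
    simpa [posKer_comm] using h.pos
  · rw [← lintegral_prod_swap (fun p => negKer p.1 p.2)]
    simpa [negKer_eq, norm_sub_rev] using h.neg

lemma add_left [SFinite μ] [SFinite μ'] [SFinite ν] (h : FiniteMixed μ ν)
    (h' : FiniteMixed μ' ν) : FiniteMixed (μ + μ') ν := by
  constructor <;> rw [Measure.add_prod, lintegral_add_measure]
  · exact ENNReal.add_ne_top.2 ⟨h.pos, h'.pos⟩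
  · exact ENNReal.add_ne_top.2 ⟨h.neg, h'.neg⟩

lemma smul_left [SFinite ν] (h : FiniteMixed μ ν) (hc : c ≠ ⊤) : FiniteMixed (c • μ) ν := by
  constructor <;> rw [Measure.prod_smul_left, lintegral_smul_measure]
  · exact ENNReal.mul_ne_top hc h.pos
  · exact ENNReal.mul_ne_top hc h.neg

lemma integrable (h : FiniteMixed μ ν) :
    Integrable (fun p : ℂ × ℂ => Real.log ‖p.1 - p.2‖) (μ.prod ν) :=
  integrable_log_of_parts measurable_fst measurable_snd h.pos h.neg

lemma mixedEnergy_eq (h : FiniteMixed μ ν) : mixedEnergy μ ν = (realEnergy μ ν : EReal) :=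
  extIntegral_logKernel_eq measurable_fst measurable_snd h.pos h.neg

lemma realEnergy_add_left [SFinite μ] [SFinite μ'] [SFinite ν] (h : FiniteMixed μ ν)
    (h' : FiniteMixed μ' ν) : realEnergy (μ + μ') ν = realEnergy μ ν + realEnergy μ' ν := by
  rw [realEnergy, Measure.add_prod, integral_add_measure (f := fun p : ℂ × ℂ => -Real.log ‖p.1 - p.2‖)
    h.integrable.neg h'.integrable.neg]
  rfl

lemma realEnergy_eq_integral [SFinite μ] [SFinite ν] (h : FiniteMixed μ ν) :
    realEnergy μ ν = ∫ z, pot ν z ∂μ :=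
  integral_prod _ h.integrable.neg

lemma integrable_pot [SFinite μ] [SFinite ν] (h : FiniteMixed μ ν) : Integrable (pot ν) μ :=
  h.integrable.neg.integral_prod_left

lemma ae_lintegral_posKer_ne_top [SFinite μ] [SFinite ν] (h : FiniteMixed μ ν) :
    ∀ᵐ z ∂μ, ∫⁻ w, posKer z w ∂ν ≠ ⊤ := by
  have h1 := h.pos
  rw [lintegral_prod _ measurable_posKer.aemeasurable] at h1
  filter_upwards [ae_lt_top measurable_posKer.lintegral_prod_right' h1] with z hz
  exact hz.ne

end FiniteMixed

/-- The inner integral of the positive part is bounded in `z` by `UnifPos ν`, so `μ` needs no finite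
energy of its own. -/
lemma LogMoment.finiteMixed (hμ : LogMoment μ) (hν : LogMoment ν) (hu : UnifPos ν) :
    FiniteMixed μ ν := by
  have := hμ.finite
  have := hν.finite
  constructor
  · obtain ⟨C, hC⟩ := hu.exists_bound
    rw [lintegral_prod _ measurable_posKer.aemeasurable]
    refine ne_top_of_le_ne_top ?_ (lintegral_mono hC)
    rw [lintegral_const]
    exact ENNReal.mul_ne_top ENNReal.coe_ne_top (measure_ne_top _ _)
  · rw [lintegral_prod _ measurable_negKer.aemeasurable]
    refine ne_top_of_le_ne_top ?_ (lintegral_mono fun z => lintegral_mono (negKer_le z))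
    simp_rw [lintegral_add_left measurable_const, lintegral_const]
    rw [lintegral_add_right _ measurable_const, lintegral_mul_const _ (by fun_prop), lintegral_const]
    exact ENNReal.add_ne_top.2 ⟨ENNReal.mul_ne_top hμ.moment (measure_ne_top _ _),
      ENNReal.mul_ne_top hν.moment (measure_ne_top _ _)⟩

lemma HasFiniteLogEnergy.finiteMixed (h : HasFiniteLogEnergy μ) : FiniteMixed μ μ := by
  have key : ∀ x y : ENNReal, ((x : EReal) - (y : EReal) ≠ ⊥) → ((x : EReal) - (y : EReal) ≠ ⊤) →
      x ≠ ⊤ ∧ y ≠ ⊤ := by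
    intro x y h1 h2
    have hy : y ≠ ⊤ := by
      rintro rfl
      exact h1 (by simp)
    refine ⟨?_, hy⟩
    rintro rfl
    lift y to NNReal using hy
    exact h2 (by simp)
  obtain ⟨h1, h2⟩ := key _ _ h.1 h.2
  exact ⟨h1, h2⟩

lemma FiniteMixed.hasFiniteLogEnergy (h : FiniteMixed μ μ) : HasFiniteLogEnergy μ := by
  rw [HasFiniteLogEnergy, logEnergy, h.mixedEnergy_eq]
  exact ⟨EReal.coe_ne_bot _, EReal.coe_ne_top _⟩

/-- By Fubini some `z` has a finite integral of `negKer z`, and `log (1 + ‖w‖)` exceeds `negKer z w`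
by at most a constant depending on `z`. -/
lemma FiniteMixed.logMoment [IsFiniteMeasure μ] (h : FiniteMixed μ μ) : LogMoment μ := by
  refine ⟨inferInstance, ?_⟩
  rcases eq_or_ne μ 0 with rfl | h0
  · simp
  have h1 := h.neg
  rw [lintegral_prod _ measurable_negKer.aemeasurable] at h1
  have h2 := ae_lt_top measurable_negKer.lintegral_prod_right' h1
  have : (ae μ).NeBot := ae_neBot.2 h0
  obtain ⟨z, hz⟩ := h2.exists
  have : ∀ w, ENNReal.ofReal (Real.log (1 + ‖w‖)) ≤
      ENNReal.ofReal (Real.log (1 + ‖z‖) + Real.log 2) + negKer z w := by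
    intro w
    refine (ENNReal.ofReal_le_ofReal (log_one_add_norm_le z w)).trans ?_
    refine ENNReal.ofReal_add_le.trans ?_
    gcongr
    rw [negKer_eq, ENNReal.ofReal_max]
    simp
  refine ne_top_of_le_ne_top ?_ (lintegral_mono this)
  rw [lintegral_add_left measurable_const, lintegral_const]
  exact ENNReal.add_ne_top.2
    ⟨ENNReal.mul_ne_top ENNReal.ofReal_ne_top (measure_ne_top _ _), hz.ne⟩

end ExternalSource

/-! ### Circle averages, semicontinuity, growth at infinity and the domination principle. -/

namespace ExternalSource

open Filter Topology Real

variable {μ ν : Measure ℂ}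

lemma ae_ne_of_lintegral_posKer {z : ℂ} (h : ∫⁻ w, posKer z w ∂μ ≠ ⊤) : ∀ᵐ w ∂μ, z ≠ w :=
  ae_ne_of_lintegral_posKer_ne_top (f := fun _ => z) measurable_const measurable_id h

section CircleAverage

/-- If `log ‖·‖ ≤ B` with `B ≥ 0` up to a term in `log r`-free quantities, then `|log| ≤ 2B - log`.
The circle mean of the logarithm is known in closed form and is at least `log r`, so the inner
integrals are bounded by a logarithmic moment. -/
lemma LogMoment.integrable_log_circleMap (hμ : LogMoment μ) (z : ℂ) {r : ℝ} (hr : 0 < r) :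
    Integrable (fun p : ℝ × ℂ => Real.log ‖circleMap z r p.1 - p.2‖)
      ((volume.restrict (Set.Ioc 0 (2 * π))).prod μ) := by
  have := hμ.finite
  have hc (w : ℂ) : IntegrableOn (fun θ => Real.log ‖circleMap z r θ - w‖)
      (Set.Ioc 0 (2 * π)) := by
    have := circleIntegrable_log_norm_sub_const (a := w) (c := z) r
    exact (intervalIntegrable_iff_integrableOn_Ioc_of_le Real.two_pi_pos.le).1 this
  have hm : Measurable (fun p : ℝ × ℂ => Real.log ‖circleMap z r p.1 - p.2‖) :=
    (((continuous_circleMap z r).measurable.comp measurable_fst).sub measurable_snd).norm.log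
  rw [integrable_prod_iff' hm.aestronglyMeasurable]
  refine ⟨ae_of_all _ hc, ?_⟩
  have hB (w : ℂ) (θ : ℝ) : Real.log ‖circleMap z r θ - w‖ ≤
      Real.log (1 + (‖z‖ + r)) + Real.log (1 + ‖w‖) := by
    refine (log_norm_sub_le _ _).trans ?_
    gcongr
    refine (norm_add_le _ _).trans ?_
    simp [abs_of_pos hr]
  have h0 : 0 ≤ Real.log (1 + (‖z‖ + r)) :=
    Real.log_nonneg (by linarith [norm_nonneg z])
  have hbound (w : ℂ) : ∫ θ in Set.Ioc 0 (2 * π), ‖Real.log ‖circleMap z r θ - w‖‖ ≤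
      2 * π * (2 * (Real.log (1 + (‖z‖ + r)) + Real.log (1 + ‖w‖)) - Real.log r) := by
    have e1 := circleAverage_log_norm_sub_const_eq_log_radius_add_posLog (a := w) (c := z) hr.ne'
    rw [Real.circleAverage, intervalIntegral.integral_of_le Real.two_pi_pos.le, smul_eq_mul,
      inv_mul_eq_iff_eq_mul₀ Real.two_pi_pos.ne'] at e1
    calc ∫ θ in Set.Ioc 0 (2 * π), ‖Real.log ‖circleMap z r θ - w‖‖
        ≤ ∫ θ in Set.Ioc 0 (2 * π), (2 * (Real.log (1 + (‖z‖ + r)) + Real.log (1 + ‖w‖))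
            - Real.log ‖circleMap z r θ - w‖) := by
          apply integral_mono (hc w).norm ((integrable_const _).sub (hc w))
          intro θ
          have h1 := hB w θ
          have h2 := log_one_add_norm_nonneg w
          simp only [Pi.sub_apply, Real.norm_eq_abs, abs_le']
          constructor <;> linarith
      _ = 2 * π * (2 * (Real.log (1 + (‖z‖ + r)) + Real.log (1 + ‖w‖)))
            - 2 * π * (Real.log r + log⁺ (r⁻¹ * ‖z - w‖)) := by
          rw [integral_sub (integrable_const _) (hc w), e1]
          simp [Real.pi_pos.le]
      _ ≤ _ := by
          have := posLog_nonneg (x := r⁻¹ * ‖z - w‖)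
          nlinarith [Real.two_pi_pos]
  refine Integrable.mono' (g := fun w => 2 * π * (2 * (Real.log (1 + (‖z‖ + r))
      + Real.log (1 + ‖w‖)) - Real.log r)) ?_
    (hm.norm.stronglyMeasurable.integral_prod_left').aestronglyMeasurable
    (ae_of_all _ fun w => ?_)
  · exact ((((integrable_const _).add hμ.integrable).const_mul 2).sub
      (integrable_const _)).const_mul _
  · rw [Real.norm_of_nonneg (integral_nonneg fun _ => norm_nonneg _)]
    exact hbound w

lemma LogMoment.circleIntegrable_pot (hμ : LogMoment μ) (z : ℂ) {r : ℝ} (hr : 0 < r) :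
    CircleIntegrable (pot μ) z r := by
  have := hμ.finite
  refine (intervalIntegrable_iff_integrableOn_Ioc_of_le Real.two_pi_pos.le).2 ?_
  exact (hμ.integrable_log_circleMap z hr).neg.integral_prod_left

lemma LogMoment.integrable_log_add_posLog (hμ : LogMoment μ) (z : ℂ) {r : ℝ} (hr : 0 < r) :
    Integrable (fun w => Real.log r + log⁺ (r⁻¹ * ‖z - w‖)) μ := by
  have := hμ.finite
  have := (hμ.integrable_log_circleMap z hr).integral_prod_right.const_mul (2 * π)⁻¹
  refine this.congr (ae_of_all _ fun w => ?_)
  have e1 := circleAverage_log_norm_sub_const_eq_log_radius_add_posLog (a := w) (c := z) hr.ne'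
  rw [Real.circleAverage, intervalIntegral.integral_of_le Real.two_pi_pos.le] at e1
  exact e1

lemma LogMoment.circleAverage_pot (hμ : LogMoment μ) (z : ℂ) {r : ℝ} (hr : 0 < r) :
    circleAverage (pot μ) z r = -∫ w, (Real.log r + log⁺ (r⁻¹ * ‖z - w‖)) ∂μ := by
  have := hμ.finite
  rw [Real.circleAverage, intervalIntegral.integral_of_le Real.two_pi_pos.le]
  simp only [pot, integral_neg]
  rw [integral_integral_swap (hμ.integrable_log_circleMap z hr), smul_neg, smul_eq_mul,
    ← integral_const_mul]
  congr 2
  ext w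
  have e1 := circleAverage_log_norm_sub_const_eq_log_radius_add_posLog (a := w) (c := z) hr.ne'
  rw [Real.circleAverage, intervalIntegral.integral_of_le Real.two_pi_pos.le] at e1
  exact e1

lemma log_add_posLog_sub_log {z w : ℂ} (h : z ≠ w) {r : ℝ} (hr : 0 < r) :
    Real.log r + log⁺ (r⁻¹ * ‖z - w‖) - Real.log ‖z - w‖ = log⁺ (r⁻¹ * ‖z - w‖)⁻¹ := by
  have h1 := posLog_sub_posLog_inv (x := r⁻¹ * ‖z - w‖)
  rw [Real.log_mul (inv_pos.2 hr).ne' (norm_pos_iff.2 (sub_ne_zero.2 h)).ne', Real.log_inv] at h1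
  linarith

lemma posLog_inv_eq_zero {z w : ℂ} {r : ℝ} (hr : 0 < r) (h : r ≤ ‖z - w‖) :
    log⁺ (r⁻¹ * ‖z - w‖)⁻¹ = 0 := by
  rw [posLog_eq_zero_iff, abs_of_nonneg (by positivity)]
  apply inv_le_one_of_one_le₀
  rw [inv_mul_eq_div, one_le_div hr]
  exact h

lemma LogMoment.integrable_posLog_inv (hμ : LogMoment μ) {z : ℂ}
    (hz : ∫⁻ w, posKer z w ∂μ ≠ ⊤) {r : ℝ} (hr : 0 < r) :
    Integrable (fun w => log⁺ (r⁻¹ * ‖z - w‖)⁻¹) μ := by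
  refine ((hμ.integrable_log_add_posLog z hr).sub (hμ.integrable_log hz)).congr ?_
  filter_upwards [ae_ne_of_lintegral_posKer hz] with w hw
  exact log_add_posLog_sub_log hw hr

/-- The excess of a potential over its circle mean only sees mass inside the disc, with a
nonnegative weight. An inequality of measures on the disc thus becomes an inequality of excesses. -/
lemma LogMoment.pot_sub_circleAverage (hμ : LogMoment μ) {z : ℂ}
    (hz : ∫⁻ w, posKer z w ∂μ ≠ ⊤) {r : ℝ} (hr : 0 < r) :
    pot μ z - circleAverage (pot μ) z r = ∫ w, log⁺ (r⁻¹ * ‖z - w‖)⁻¹ ∂μ := by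
  rw [hμ.circleAverage_pot z hr, pot, integral_neg, sub_neg_eq_add, neg_add_eq_sub,
    ← integral_sub (hμ.integrable_log_add_posLog z hr) (hμ.integrable_log hz)]
  apply integral_congr_ae
  filter_upwards [ae_ne_of_lintegral_posKer hz] with w hw
  exact log_add_posLog_sub_log hw hr

end CircleAverage

section Semicontinuity

lemma LogMoment.pot_add_integral_truncKer (hμ : LogMoment μ) {z : ℂ}
    (hz : ∫⁻ w, posKer z w ∂μ ≠ ⊤) (n : ℕ) :
    pot μ z + ∫ w, truncKer n z w ∂μ = (∫⁻ w, (posKer z w - n) ∂μ).toReal := by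
  have hm : Measurable fun w => posKer z w - (n : ENNReal) :=
    (measurable_posKer_right z).sub measurable_const
  have hlt : ∫⁻ w, (posKer z w - n) ∂μ ≠ ⊤ :=
    ne_top_of_le_ne_top hz (lintegral_mono fun w => tsub_le_self)
  rw [pot, integral_neg, neg_add_eq_sub,
    ← integral_sub (hμ.integrable_truncKer n z) (hμ.integrable_log hz),
    ← integral_toReal hm.aemeasurable (ae_lt_top hm hlt)]
  apply integral_congr_ae
  filter_upwards [ae_ne_of_lintegral_posKer hz] with w hw
  exact truncKer_sub_log hw

lemma LogMoment.neg_integral_truncKer_le_pot (hμ : LogMoment μ) {z : ℂ}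
    (hz : ∫⁻ w, posKer z w ∂μ ≠ ⊤) (n : ℕ) : -∫ w, truncKer n z w ∂μ ≤ pot μ z := by
  have h1 := hμ.pot_add_integral_truncKer hz n
  have h2 := ENNReal.toReal_nonneg (a := ∫⁻ w, (posKer z w - n) ∂μ)
  linarith

lemma LogMoment.tendsto_integral_truncKer (hμ : LogMoment μ) {z : ℂ}
    (hz : ∫⁻ w, posKer z w ∂μ ≠ ⊤) :
    Tendsto (fun n : ℕ => -∫ w, truncKer n z w ∂μ) atTop (𝓝 (pot μ z)) := by
  have h0 : Tendsto (fun n : ℕ => ∫⁻ w, (posKer z w - n) ∂μ) atTop (𝓝 (∫⁻ _, 0 ∂μ)) := by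
    apply tendsto_lintegral_of_dominated_convergence (posKer z)
    · exact fun n => (measurable_posKer_right z).sub measurable_const
    · exact fun n => ae_of_all _ fun t => tsub_le_self
    · exact hz
    · filter_upwards [ae_lt_top (measurable_posKer_right z) hz] with t ht
      apply tendsto_const_nhds.congr'
      obtain ⟨N, hN⟩ := ENNReal.exists_nat_gt ht.ne
      filter_upwards [eventually_ge_atTop N] with n hn
      rw [tsub_eq_zero_of_le]
      exact hN.le.trans (by exact_mod_cast hn)
  simp only [lintegral_const, zero_mul] at h0
  have h1 := (ENNReal.tendsto_toReal ENNReal.zero_ne_top).comp h0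
  have h2 : Tendsto (fun n : ℕ => pot μ z - (∫⁻ w, (posKer z w - n) ∂μ).toReal) atTop
      (𝓝 (pot μ z - 0)) := tendsto_const_nhds.sub h1
  rw [sub_zero] at h2
  refine h2.congr fun n => ?_
  have := hμ.pot_add_integral_truncKer hz n
  linarith

/-- The potential is the limit from below of continuous truncated potentials. -/
lemma LogMoment.lowerSemicontinuous_pot (hμ : LogMoment μ)
    (hfin : ∀ z, ∫⁻ w, posKer z w ∂μ ≠ ⊤) : LowerSemicontinuous (pot μ) := by
  intro z y hy
  obtain ⟨n, hn⟩ := ((hμ.tendsto_integral_truncKer (hfin z)).eventually (lt_mem_nhds hy)).exists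
  filter_upwards [(hμ.continuous_integral_truncKer n).neg.continuousAt.eventually
    (lt_mem_nhds hn)] with x hx
  exact hx.trans_le (hμ.neg_integral_truncKer_le_pot (hfin x) n)

end Semicontinuity

section Growth

/-- The coefficient of `log (1 + ‖z‖)` is the exact mass, matching the lower bound
`LogMoment.neg_pot_le`. For measures of equal mass the logarithms cancel. -/
lemma LogMoment.exists_pot_le_sub_log (hμ : LogMoment μ) (hu : UnifPos μ) :
    ∃ C, ∀ z, pot μ z ≤ C - μ.real Set.univ * Real.log (1 + ‖z‖) := by
  have := hμ.finite
  obtain ⟨C, hC⟩ := hu.exists_bound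
  refine ⟨C + ∫ w, (Real.log 2 + Real.log (1 + ‖w‖)) ∂μ, fun z => ?_⟩
  have hfin := hu.lintegral_posKer_ne_top z
  have hae := ae_lt_top (measurable_posKer_right z) hfin
  have hi : Integrable (fun w => (posKer z w).toReal) μ :=
    integrable_toReal_of_lintegral_ne_top (measurable_posKer_right z).aemeasurable hfin
  have hi2 : Integrable (fun w => Real.log 2 + Real.log (1 + ‖w‖)) μ :=
    (integrable_const _).add hμ.integrable
  have h1 : ∫ w, (posKer z w).toReal ∂μ ≤ C := by
    rw [integral_toReal (measurable_posKer_right z).aemeasurable hae]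
    have := ENNReal.toReal_mono ENNReal.coe_ne_top (hC z)
    rwa [ENNReal.coe_toReal] at this
  calc pot μ z ≤ ∫ w, ((posKer z w).toReal + (Real.log 2 + Real.log (1 + ‖w‖))
        - Real.log (1 + ‖z‖)) ∂μ := by
        refine integral_mono_ae (hμ.integrable_log hfin).neg
          ((hi.add hi2).sub (integrable_const _)) ?_
        filter_upwards [ae_ne_of_lintegral_posKer hfin] with w hw
        have h2 := log_one_add_norm_le w z
        rw [posKer_of_ne hw, ENNReal.toReal_ofReal', norm_sub_rev]
        have h3 : max (Real.log ‖w - z‖) 0 - max (-Real.log ‖w - z‖) 0 = Real.log ‖w - z‖ := by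
          rcases le_total 0 (Real.log ‖w - z‖) with h | h
          · rw [max_eq_left h, max_eq_right (by linarith)]; ring
          · rw [max_eq_right h, max_eq_left (by linarith)]; ring
        change -Real.log ‖w - z‖ ≤ _
        linarith
    _ = ∫ w, (posKer z w).toReal ∂μ + ∫ w, (Real.log 2 + Real.log (1 + ‖w‖)) ∂μ
        - μ.real Set.univ * Real.log (1 + ‖z‖) := by
        rw [integral_sub (f := fun w => (posKer z w).toReal + (Real.log 2 + Real.log (1 + ‖w‖)))
          (hi.add hi2) (integrable_const _), integral_add hi hi2, integral_const, smul_eq_mul]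
    _ ≤ _ := by linarith

lemma LogMoment.neg_pot_le (hμ : LogMoment μ) {z : ℂ} (hz : ∫⁻ w, posKer z w ∂μ ≠ ⊤) :
    -pot μ z ≤ μ.real Set.univ * Real.log (1 + ‖z‖) + ∫ w, Real.log (1 + ‖w‖) ∂μ := by
  have := hμ.finite
  rw [pot, integral_neg, neg_neg]
  calc ∫ w, Real.log ‖z - w‖ ∂μ ≤ ∫ w, (Real.log (1 + ‖z‖) + Real.log (1 + ‖w‖)) ∂μ :=
        integral_mono (hμ.integrable_log hz) ((integrable_const _).add hμ.integrable)
          (log_norm_sub_le z)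
    _ = _ := by
        rw [integral_add (integrable_const _) hμ.integrable, integral_const, smul_eq_mul]

end Growth

/-- A principle of domination for logarithmic potentials. -/
theorem pot_le_pot_add_of_le_on {ρ₁ ρ₂ ρ₃ : Measure ℂ} (h₁ : LogMoment ρ₁) (u₁ : UnifPos ρ₁)
    (h₂ : LogMoment ρ₂) (f₂ : ∀ z, ∫⁻ w, posKer z w ∂ρ₂ ≠ ⊤)
    (hmass : ρ₁ Set.univ = ρ₂ Set.univ) {A : Set ℂ} (hA : IsClosed A)
    (hle : ρ₁.restrict Aᶜ ≤ ρ₂.restrict Aᶜ) (h₃ : LogMoment ρ₃) (u₃ : UnifPos ρ₃)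
    (hA₃ : ρ₃ Aᶜ = 0) (hne : ρ₃ ≠ 0) {c : ℝ} (hc : ∀ z ∈ A, pot ρ₁ z ≤ pot ρ₂ z + c) (z : ℂ) :
    pot ρ₁ z ≤ pot ρ₂ z + c := by
  have := h₁.finite
  have := h₂.finite
  have := h₃.finite
  by_contra! hlt
  obtain ⟨C₃, hC₃⟩ := h₃.exists_pot_le u₃
  obtain ⟨B₁, hB₁⟩ := h₁.exists_pot_le_sub_log u₁
  obtain ⟨B₃, hB₃⟩ := h₃.exists_pot_le_sub_log u₃
  have hm₃ : 0 < ρ₃.real Set.univ := by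
    exact ENNReal.toReal_pos (by simpa using hne) (measure_ne_top _ _)
  have hmr : ρ₁.real Set.univ = ρ₂.real Set.univ := by simp [measureReal_def, hmass]
  -- The supposed excess at `z` survives a small multiple of the perturbation by `ρ₃`.
  obtain ⟨ε, hε, hεz⟩ : ∃ ε > 0, ε * (C₃ - pot ρ₃ z) < pot ρ₁ z - pot ρ₂ z - c := by
    have h0 : 0 ≤ C₃ - pot ρ₃ z := sub_nonneg.2 (hC₃ z)
    have hδ : 0 < pot ρ₁ z - pot ρ₂ z - c := by linarith
    refine ⟨(pot ρ₁ z - pot ρ₂ z - c) / (C₃ - pot ρ₃ z + 1), by positivity, ?_⟩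
    rw [div_mul_eq_mul_div, div_lt_iff₀ (by positivity)]
    nlinarith
  -- The added term is nonpositive, so `v ≤ c` persists on `A`. Since `ρ₁` and `ρ₂` have equal mass,
  -- this term also drives `v` to `-∞` at infinity, which makes superlevel sets bounded.
  set v : ℂ → ℝ := fun x => pot ρ₁ x - pot ρ₂ x + ε * (pot ρ₃ x - C₃) with hv
  have hvz : c < v z := by simp only [hv]; nlinarith
  have hvA : ∀ x ∈ A, v x ≤ c := by
    intro x hx
    have := hc x hx
    have := hC₃ x
    simp only [hv]
    nlinarith
  have husc : UpperSemicontinuous v := by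
    have hl := h₂.lowerSemicontinuous_pot f₂
    have hcont : Continuous fun x => pot ρ₁ x + ε * (pot ρ₃ x - C₃) :=
      (h₁.continuous_pot u₁).add (continuous_const.mul ((h₃.continuous_pot u₃).sub
        continuous_const))
    intro x y hy
    have h1 : (pot ρ₁ x + ε * (pot ρ₃ x - C₃) - y) < pot ρ₂ x := by simp only [hv] at hy; linarith
    obtain ⟨m, hm1, hm2⟩ := exists_between h1
    filter_upwards [hl x m hm2, hcont.continuousAt.eventually
      (gt_mem_nhds (by linarith : pot ρ₁ x + ε * (pot ρ₃ x - C₃) < m + y))] with t ht1 ht2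
    simp only [hv]
    linarith
  have hbd : ∀ y : ℝ, c < y → IsCompact {x | y ≤ v x} := by
    intro y _
    refine Metric.isCompact_of_isClosed_isBounded ?_ ?_
    · exact husc.isClosed_preimage y
    · set K : ℝ := (B₁ + (∫ w, Real.log (1 + ‖w‖) ∂ρ₂) + ε * (B₃ - C₃) - y)
        / (ε * ρ₃.real Set.univ)
      refine Bornology.IsBounded.subset Metric.isBounded_closedBall
        (t := Metric.closedBall 0 (Real.exp K)) fun x hx => ?_
      rw [mem_closedBall_zero_iff]
      have h1 := hB₁ x
      have h2 := h₂.neg_pot_le (f₂ x)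
      have h3 := mul_le_mul_of_nonneg_left (hB₃ x) hε.le
      have h4 : y ≤ v x := hx
      have h5 : Real.log (1 + ‖x‖) ≤ K := by
        rw [le_div_iff₀ (by positivity)]
        simp only [hv] at h4
        rw [hmr] at h1
        nlinarith
      rw [Real.log_le_iff_le_exp (by positivity)] at h5
      linarith
  obtain ⟨p, hp, hpmax⟩ := UpperSemicontinuousOn.exists_isMaxOn ⟨z, le_refl (v z)⟩ (hbd _ hvz)
    (husc.upperSemicontinuousOn _)
  have hpz : v z ≤ v p := hp
  have hpM : ∀ x, v x ≤ v p := by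
    intro x
    rcases le_total (v z) (v x) with h | h
    · exact hpmax h
    · exact h.trans hp
  -- Among the maximum points choose one of largest imaginary part. On the upper half of any circle
  -- about `q` the value is then strictly smaller, so no connectedness argument is needed.
  obtain ⟨q, hq, hqmax⟩ := (hbd (v p) (hvz.trans_le hpz)).exists_isMaxOn ⟨p, le_refl (v p)⟩
    continuous_im.continuousOn
  have hqM : ∀ x, v x ≤ v q := fun x => (hpM x).trans hq
  have hqim : ∀ x, q.im < x.im → v x < v q := by
    intro x hx
    by_contra! hcon
    have h1 : v p ≤ v x := le_trans hq hcon
    exact absurd (hqmax h1) (not_le.2 hx)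
  have hqA : q ∈ Aᶜ := fun hmem => absurd (hvA q hmem)
    (not_le.2 (lt_of_lt_of_le hvz (hqM z)))
  obtain ⟨r, hr, hball⟩ := Metric.isOpen_iff.1 hA.isOpen_compl q hqA
  have hsub (w : ℂ) (hw : w ∉ Aᶜ) : log⁺ (r⁻¹ * ‖q - w‖)⁻¹ = 0 := by
    apply posLog_inv_eq_zero hr
    by_contra! hcon
    exact hw (hball (by rwa [Metric.mem_ball, dist_comm, dist_eq_norm]))
  -- The disc lies off `A`, where `ρ₁ ≤ ρ₂` and `ρ₃` vanishes. Comparing excesses gives the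
  -- sub-mean-value inequality for `v` at `q`.
  have e₁ := h₁.pot_sub_circleAverage (u₁.lintegral_posKer_ne_top q) hr
  have e₂ := h₂.pot_sub_circleAverage (f₂ q) hr
  have e₃ := h₃.pot_sub_circleAverage (u₃.lintegral_posKer_ne_top q) hr
  rw [← setIntegral_eq_integral_of_forall_compl_eq_zero hsub] at e₁ e₂ e₃
  rw [Measure.restrict_eq_zero.2 hA₃, integral_zero_measure] at e₃
  have hint := integral_mono_measure hle (f := fun w => log⁺ (r⁻¹ * ‖q - w‖)⁻¹)
    (ae_of_all _ fun w => posLog_nonneg) (h₂.integrable_posLog_inv (f₂ q) hr).restrict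
  have i₁ := h₁.circleIntegrable_pot q hr
  have i₂ := h₂.circleIntegrable_pot q hr
  have i₃ := h₃.circleIntegrable_pot q hr
  have i₃' : CircleIntegrable (fun x => ε * (pot ρ₃ x - C₃)) q r :=
    (IntervalIntegrable.sub i₃ (circleIntegrable_const C₃ q r)).const_mul ε
  have iv : CircleIntegrable v q r := (i₁.sub i₂).add i₃'
  have eavg : circleAverage v q r = circleAverage (pot ρ₁) q r - circleAverage (pot ρ₂) q r
      + ε * (circleAverage (pot ρ₃) q r - C₃) := by
    rw [hv, circleAverage_fun_add (f₁ := fun x => pot ρ₁ x - pot ρ₂ x) (i₁.sub i₂) i₃',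
      circleAverage_fun_sub i₁ i₂]
    congr 1
    have e := circleAverage_fun_smul (a := ε) (f := fun x => pot ρ₃ x - C₃) (c := q) (R := r)
    simp only [smul_eq_mul] at e
    rw [e, circleAverage_fun_sub i₃ (circleIntegrable_const C₃ q r), circleAverage_const]
  have hvq : v q ≤ circleAverage v q r := by
    rw [eavg]
    simp only [hv]
    have : pot ρ₃ q = circleAverage (pot ρ₃) q r := by linarith
    rw [← this]
    linarith
  have hw : IntervalIntegrable (fun θ => v q - v (circleMap q r θ)) volume 0 (2 * π) :=
    intervalIntegrable_const.sub iv
  have hle1 : ∫ θ in (0 : ℝ)..2 * π, (v q - v (circleMap q r θ)) ≤ 0 := by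
    rw [intervalIntegral.integral_sub intervalIntegrable_const iv, intervalIntegral.integral_const]
    rw [Real.circleAverage, smul_eq_mul, ← div_eq_inv_mul, le_div_iff₀ Real.two_pi_pos] at hvq
    simp only [sub_zero, smul_eq_mul]
    linarith
  have hs1 : Set.uIcc 0 π ⊆ Set.uIcc 0 (2 * π) := by
    rw [Set.uIcc_of_le Real.pi_pos.le, Set.uIcc_of_le Real.two_pi_pos.le]
    exact Set.Icc_subset_Icc_right (by linarith [Real.pi_pos])
  have hs2 : Set.uIcc π (2 * π) ⊆ Set.uIcc 0 (2 * π) := by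
    rw [Set.uIcc_of_le (by linarith [Real.pi_pos]), Set.uIcc_of_le Real.two_pi_pos.le]
    exact Set.Icc_subset_Icc_left Real.pi_pos.le
  have hpos : 0 < ∫ θ in (0 : ℝ)..2 * π, (v q - v (circleMap q r θ)) := by
    rw [← intervalIntegral.integral_add_adjacent_intervals (hw.mono_set hs1) (hw.mono_set hs2)]
    refine add_pos_of_pos_of_nonneg (intervalIntegral.intervalIntegral_pos_of_pos_on
      (hw.mono_set hs1) (fun θ hθ => sub_pos.2 (hqim _ ?_)) Real.pi_pos)
      (intervalIntegral.integral_nonneg (by linarith [Real.pi_pos])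
        fun θ _ => sub_nonneg.2 (hqM _))
    have := mul_pos hr (Real.sin_pos_of_pos_of_lt_pi hθ.1 hθ.2)
    simpa [circleMap, Complex.exp_ofReal_mul_I_im] using this
  linarith

end ExternalSource

/-! ### Supports, admissible pairs, segment measures and the first variation in `μ₁`. -/

namespace ExternalSource

open Filter Topology

variable {μ ν μ₁ μ₂ : Measure ℂ} {V : ℝ → ℝ} {a : ℝ}

section Support

lemma lintegral_posKer_ne_top_of_notMem_support [IsFiniteMeasure μ] {z : ℂ}
    (hz : z ∉ μ.support) : ∫⁻ w, posKer z w ∂μ ≠ ⊤ := by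
  obtain ⟨U, hU, hU0⟩ := Measure.notMem_support_iff_exists.1 hz
  obtain ⟨δ, hδ, hball⟩ := Metric.mem_nhds_iff.1 hU
  have h1 : ∀ᵐ w ∂μ, posKer z w ≤ negLog δ := by
    filter_upwards [measure_eq_zero_iff_ae_notMem.1 hU0] with w hw
    rw [posKer_eq]
    apply negLog_anti
    by_contra! hlt
    exact hw (hball (by rwa [Metric.mem_ball, dist_comm, dist_eq_norm]))
  refine ne_top_of_le_ne_top ?_ (lintegral_mono_ae h1)
  rw [lintegral_const, negLog_of_pos hδ]
  exact ENNReal.mul_ne_top ENNReal.ofReal_ne_top (measure_ne_top _ _)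

lemma exists_mem_ball_of_mem_support {p : ℂ → Prop} {z : ℂ} (hz : z ∈ μ.support)
    (hp : ∀ᵐ w ∂μ, p w) {δ : ℝ} (hδ : 0 < δ) : ∃ w ∈ Metric.ball z δ, p w := by
  have h1 := (Measure.mem_support_iff_forall z).1 hz _ (Metric.ball_mem_nhds z hδ)
  by_contra! hcon
  refine h1.ne' (measure_mono_null (fun w hw => ?_) (ae_iff.1 hp))
  exact hcon w hw

lemma exists_seq_tendsto_of_mem_support {p : ℂ → Prop} {z : ℂ} (hz : z ∈ μ.support)
    (hp : ∀ᵐ w ∂μ, p w) : ∃ u : ℕ → ℂ, Tendsto u atTop (𝓝 z) ∧ ∀ n, p (u n) := by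
  choose u hu using fun n : ℕ =>
    exists_mem_ball_of_mem_support hz hp (δ := 1 / ((n : ℝ) + 1)) (by positivity)
  refine ⟨u, ?_, fun n => (hu n).2⟩
  rw [tendsto_iff_dist_tendsto_zero]
  exact squeeze_zero (fun _ => dist_nonneg) (fun n => (Metric.mem_ball.1 (hu n).1).le)
    tendsto_one_div_add_atTop_nhds_zero_nat

end Support

section ExtIntegral

variable {α : Type*} [MeasurableSpace α] {m : Measure α} {f : α → ℝ}

lemma extIntegral_coe_of_integrable (hf : Integrable f m) :
    extIntegral m (fun x => (f x : EReal)) = ((∫ x, f x ∂m : ℝ) : EReal) := by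
  have h1 := hf.lintegral_lt_top
  have h2 : ∫⁻ x, ENNReal.ofReal (-f x) ∂m < ⊤ := hf.neg.lintegral_lt_top
  rw [integral_eq_lintegral_pos_part_sub_lintegral_neg_part hf, EReal.coe_sub,
    EReal.coe_ennreal_toReal h1.ne, EReal.coe_ennreal_toReal h2.ne]
  rfl

lemma lintegral_ofReal_neg_ne_top [IsFiniteMeasure m] {B : ℝ} (hB : ∀ x, B ≤ f x) :
    ∫⁻ x, ENNReal.ofReal (-f x) ∂m ≠ ⊤ := by
  refine ne_top_of_le_ne_top ?_
    (lintegral_mono fun x => ENNReal.ofReal_le_ofReal (neg_le_neg (hB x)))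
  rw [lintegral_const]
  exact ENNReal.mul_ne_top ENNReal.ofReal_ne_top (measure_ne_top _ _)

lemma integrable_of_extIntegral_ne_top [IsFiniteMeasure m] (hm : Measurable f) {B : ℝ}
    (hB : ∀ x, B ≤ f x) (h : extIntegral m (fun x => (f x : EReal)) ≠ ⊤) : Integrable f m := by
  have h1 : ∫⁻ x, ENNReal.ofReal (-f x) ∂m ≠ ⊤ := lintegral_ofReal_neg_ne_top hB
  have h2 : ∫⁻ x, ENNReal.ofReal (f x) ∂m ≠ ⊤ := by
    intro htop
    apply h
    have e : extIntegral m (fun x => (f x : EReal)) =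
      ((∫⁻ x, ENNReal.ofReal (f x) ∂m : ENNReal) : EReal) -
        ((∫⁻ x, ENNReal.ofReal (-f x) ∂m : ENNReal) : EReal) := rfl
    rw [e, htop]
    lift ∫⁻ x, ENNReal.ofReal (-f x) ∂m to NNReal using h1 with y
    simp
  refine ⟨hm.aestronglyMeasurable, ?_⟩
  rw [hasFiniteIntegral_iff_norm]
  have h : ∀ r : ℝ, ENNReal.ofReal ‖r‖ ≤ ENNReal.ofReal (-r) + ENNReal.ofReal r := by
    intro r
    rcases le_total 0 r with h | h
    · rw [Real.norm_of_nonneg h]; exact le_add_self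
    · rw [Real.norm_of_nonpos h]; exact le_self_add
  refine (lintegral_mono fun x => h (f x)).trans_lt ?_
  rw [lintegral_add_left (by fun_prop)]
  exact ENNReal.add_lt_top.2 ⟨h1.lt_top, h2.lt_top⟩

end ExtIntegral

namespace Admissible

lemma isProbabilityMeasure (h : Admissible a μ₁ μ₂) : IsProbabilityMeasure μ₁ := ⟨h.mass₁⟩

lemma isFiniteMeasure (h : Admissible a μ₁ μ₂) : IsFiniteMeasure μ₂ :=
  ⟨by rw [h.mass₂]; exact ENNReal.div_lt_top ENNReal.one_ne_top two_ne_zero⟩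

lemma logMoment₁ (h : Admissible a μ₁ μ₂) : LogMoment μ₁ :=
  have := h.isProbabilityMeasure
  h.finite_energy₁.finiteMixed.logMoment

lemma logMoment₂ (h : Admissible a μ₁ μ₂) : LogMoment μ₂ :=
  have := h.isFiniteMeasure
  h.finite_energy₂.finiteMixed.logMoment

lemma unifPos (h : Admissible a μ₁ μ₂) : UnifPos μ₂ := (unifPos_sigma a).mono h.le_sigma

lemma finiteMixed (h : Admissible a μ₁ μ₂) : FiniteMixed μ₁ μ₂ :=
  h.logMoment₁.finiteMixed h.logMoment₂ h.unifPos

lemma energy_eq (h : Admissible a μ₁ μ₂) : energy V a μ₁ μ₂ =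
    ((realEnergy μ₁ μ₁ + realEnergy μ₂ μ₂ - realEnergy μ₁ μ₂ : ℝ) : EReal) +
      extIntegral μ₁ (fun z => ((V z.re - a * |z.re| : ℝ) : EReal)) := by
  rw [energy, logEnergy, logEnergy, h.finite_energy₁.finiteMixed.mixedEnergy_eq,
    h.finite_energy₂.finiteMixed.mixedEnergy_eq, h.finiteMixed.mixedEnergy_eq]
  norm_cast

lemma energy_eq_coe (h : Admissible a μ₁ μ₂)
    (hi : Integrable (fun z : ℂ => V z.re - a * |z.re|) μ₁) : energy V a μ₁ μ₂ =
    ((realEnergy μ₁ μ₁ + realEnergy μ₂ μ₂ - realEnergy μ₁ μ₂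
      + ∫ z, (V z.re - a * |z.re|) ∂μ₁ : ℝ) : EReal) := by
  rw [h.energy_eq, extIntegral_coe_of_integrable hi]
  norm_cast

lemma of_logMoment (h : Admissible a μ₁ μ₂) (hν : FiniteMixed ν ν)
    (him : ν {z : ℂ | z.im ≠ 0} = 0) (h1 : ν Set.univ = 1) : Admissible a ν μ₂ :=
  ⟨hν.hasFiniteLogEnergy, h.finite_energy₂, him, h1, h.on_imag, h.mass₂, h.le_sigma⟩

end Admissible

/-- The uniform probability measure on the segment from `x` to `x + ε`. -/
noncomputable def segmentMeasure (x ε : ℝ) : Measure ℂ :=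
  Measure.map (fun t : ℝ => ((x + ε * t : ℝ) : ℂ)) (volume.restrict (Set.Icc 0 1))

section Segment

lemma measurable_segmentMap (x ε : ℝ) : Measurable fun t : ℝ => ((x + ε * t : ℝ) : ℂ) := by
  fun_prop

lemma segmentMeasure_univ (x ε : ℝ) : segmentMeasure x ε Set.univ = 1 := by
  rw [segmentMeasure, Measure.map_apply (measurable_segmentMap x ε) MeasurableSet.univ]
  simp

lemma segmentMeasure_im (x ε : ℝ) : segmentMeasure x ε {z : ℂ | z.im ≠ 0} = 0 := by
  have hm : MeasurableSet {z : ℂ | z.im ≠ 0} :=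
    (measurableSet_eq_fun measurable_im measurable_const).compl
  rw [segmentMeasure, Measure.map_apply (measurable_segmentMap x ε) hm]
  simp

lemma logMoment_segmentMeasure (x ε : ℝ) : LogMoment (segmentMeasure x ε) := by
  refine ⟨⟨by rw [segmentMeasure_univ]; exact ENNReal.one_lt_top⟩, ?_⟩
  rw [segmentMeasure, lintegral_map (by fun_prop) (measurable_segmentMap x ε)]
  have h : ∀ t ∈ Set.Icc (0 : ℝ) 1, ENNReal.ofReal (Real.log (1 + ‖((x + ε * t : ℝ) : ℂ)‖)) ≤
      ENNReal.ofReal (Real.log (1 + (|x| + |ε|))) := by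
    intro t ht
    apply ENNReal.ofReal_le_ofReal
    apply Real.log_le_log (by positivity)
    rw [Complex.norm_real, Real.norm_eq_abs]
    have h1 := abs_add_le x (ε * t)
    rw [abs_mul, abs_of_nonneg ht.1] at h1
    nlinarith [abs_nonneg ε, ht.2]
  refine ne_top_of_le_ne_top ?_ (setLIntegral_mono' measurableSet_Icc h)
  simp

lemma unifPos_segmentMeasure (x : ℝ) {ε : ℝ} (hε : ε ≠ 0) : UnifPos (segmentMeasure x ε) := by
  refine UnifPos.mono (unifPos_real.smul (c := ENNReal.ofReal |ε⁻¹|) ENNReal.ofReal_ne_top) ?_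
  have e : Measure.map (fun t : ℝ => ((x + ε * t : ℝ) : ℂ)) volume =
      ENNReal.ofReal |ε⁻¹| • Measure.map (fun t : ℝ => (t : ℂ)) volume := by
    calc Measure.map (fun t : ℝ => ((x + ε * t : ℝ) : ℂ)) volume
        = Measure.map (fun t : ℝ => (t : ℂ))
            (Measure.map (fun t => x + t) (Measure.map (fun t => ε * t) volume)) := by
          rw [Measure.map_map (by fun_prop) (by fun_prop),
            Measure.map_map (by fun_prop) (by fun_prop)]
          rfl
      _ = _ := by
          rw [Real.map_volume_mul_left hε, Measure.map_smul, map_add_left_eq_self,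
            Measure.map_smul]
  rw [← e]
  exact Measure.map_mono Measure.restrict_le_self (measurable_segmentMap x ε)

lemma finiteMixed_segmentMeasure (hμ : LogMoment μ) (x : ℝ) {ε : ℝ} (hε : ε ≠ 0) :
    FiniteMixed μ (segmentMeasure x ε) :=
  hμ.finiteMixed (logMoment_segmentMeasure x ε) (unifPos_segmentMeasure x hε)

end Segment

/-- Divide by `t` and let `t → 0`. Minimality enters both variations in this form, since the energy
is quadratic along a segment of measures. -/
lemma nonneg_of_forall_quadratic {D Q : ℝ} (h : ∀ t : ℝ, 0 < t → t < 1 → 0 ≤ t * D + t ^ 2 * Q) :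
    0 ≤ D := by
  have h1 : Tendsto (fun t : ℝ => D + t * Q) (𝓝[>] 0) (𝓝 (D + 0 * Q)) :=
    ((continuous_const.add (continuous_id.mul continuous_const)).tendsto 0).mono_left
      nhdsWithin_le_nhds
  rw [zero_mul, add_zero] at h1
  refine ge_of_tendsto h1 ?_
  filter_upwards [Ioo_mem_nhdsGT one_pos] with t ht
  have h2 := h t ht.1 ht.2
  have h3 : 0 ≤ t * (D + t * Q) := by linarith [h2, show t * (D + t * Q) = t * D + t ^ 2 * Q by ring]
  exact nonneg_of_mul_nonneg_right h3 ht.1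

section FirstVariation

/-- Convex combinations with the first measure give the first-order condition in `μ₁`. -/
lemma IsMinimizer.first_variation_nonneg (hmin : IsMinimizer V a μ₁ μ₂)
    (hi : Integrable (fun z : ℂ => V z.re - a * |z.re|) μ₁)
    (hν : LogMoment ν) (uν : UnifPos ν) (him : ν {z : ℂ | z.im ≠ 0} = 0) (h1 : ν Set.univ = 1)
    (hiν : Integrable (fun z : ℂ => V z.re - a * |z.re|) ν) :
    2 * realEnergy μ₁ μ₁ - realEnergy μ₁ μ₂ + ∫ z, (V z.re - a * |z.re|) ∂μ₁ ≤
      2 * realEnergy μ₁ ν - realEnergy μ₂ ν + ∫ z, (V z.re - a * |z.re|) ∂ν := by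
  have hA := hmin.1
  have := hA.isProbabilityMeasure
  have := hA.isFiniteMeasure
  have := hν.finite
  have m11 := hA.finite_energy₁.finiteMixed
  have m1ν := hA.logMoment₁.finiteMixed hν uν
  have m2ν := hA.logMoment₂.finiteMixed hν uν
  have mνν := hν.finiteMixed hν uν
  have m12 := hA.finiteMixed
  set W : ℂ → ℝ := fun z => V z.re - a * |z.re| with hW
  suffices h : 0 ≤ 2 * realEnergy μ₁ ν - realEnergy μ₂ ν + ∫ z, W z ∂ν
      - (2 * realEnergy μ₁ μ₁ - realEnergy μ₁ μ₂ + ∫ z, W z ∂μ₁) by linarith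
  -- Along `(1 - t)μ₁ + tν` the energy increment is `tD + t²Q`, where `Q` is the logarithmic energy
  -- of the signed measure `ν - μ₁`.
  refine nonneg_of_forall_quadratic
    (Q := realEnergy μ₁ μ₁ - 2 * realEnergy μ₁ ν + realEnergy ν ν) fun t ht0 ht1 => ?_
  set c : ENNReal := ENNReal.ofReal (1 - t)
  set s : ENNReal := ENNReal.ofReal t
  have hc : c ≠ ⊤ := ENNReal.ofReal_ne_top
  have hs : s ≠ ⊤ := ENNReal.ofReal_ne_top
  have hcr : c.toReal = 1 - t := ENNReal.toReal_ofReal (by linarith)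
  have hsr : s.toReal = t := ENNReal.toReal_ofReal ht0.le
  have fc : IsFiniteMeasure (c • μ₁) := Measure.smul_finite μ₁ hc
  have fs : IsFiniteMeasure (s • ν) := Measure.smul_finite ν hs
  have key : ∀ X : Measure ℂ, SFinite X → FiniteMixed μ₁ X → FiniteMixed ν X →
      FiniteMixed (c • μ₁ + s • ν) X ∧ realEnergy (c • μ₁ + s • ν) X =
        (1 - t) * realEnergy μ₁ X + t * realEnergy ν X := by
    intro X _ k1 k2
    refine ⟨(k1.smul_left hc).add_left (k2.smul_left hs), ?_⟩
    rw [(k1.smul_left hc).realEnergy_add_left (k2.smul_left hs), realEnergy_smul_left,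
      realEnergy_smul_left, hcr, hsr]
  have k1 := key μ₁ inferInstance m11 m1ν.symm
  have kν := key ν inferInstance m1ν mνν
  have k2 := key μ₂ inferInstance m12 m2ν.symm
  have kk := key (c • μ₁ + s • ν) inferInstance k1.1.symm kν.1.symm
  have hadm : Admissible a (c • μ₁ + s • ν) μ₂ := by
    refine hA.of_logMoment kk.1 ?_ ?_
    · simp [hA.on_real, him]
    · simp only [Measure.add_apply, Measure.smul_apply, hA.mass₁, h1, smul_eq_mul, mul_one]
      rw [← ENNReal.ofReal_add (by linarith) ht0.le]
      simp
  have hit : Integrable W (c • μ₁ + s • ν) := (hi.smul_measure hc).add_measure (hiν.smul_measure hs)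
  have hle := hmin.2 _ _ hadm
  rw [hA.energy_eq_coe hi, hadm.energy_eq_coe hit, EReal.coe_le_coe_iff, kk.2,
    realEnergy_comm (μ := μ₁) (ν := c • μ₁ + s • ν),
    realEnergy_comm (μ := ν) (ν := c • μ₁ + s • ν), k1.2, kν.2, k2.2,
    integral_add_measure (hi.smul_measure hc) (hiν.smul_measure hs), integral_smul_measure,
    integral_smul_measure, hcr, hsr, realEnergy_comm (μ := ν) (ν := μ₁),
    realEnergy_comm (μ := ν) (ν := μ₂)] at hle
  simp only [smul_eq_mul] at hle
  linarith

end FirstVariation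

end ExternalSource

/-! ### Shrinking segments and the Euler-Lagrange conditions on the real axis. -/

namespace ExternalSource

open Filter Topology

variable {μ ν μ₁ μ₂ : Measure ℂ} {V : ℝ → ℝ} {a : ℝ}

section SegmentLimit

lemma ae_segmentMeasure (x ε : ℝ) :
    ∀ᵐ z ∂segmentMeasure x ε, ∃ t ∈ Set.Icc (0 : ℝ) 1, z = ((x + ε * t : ℝ) : ℂ) := by
  have hK : IsCompact ((fun t : ℝ => ((x + ε * t : ℝ) : ℂ)) '' Set.Icc (0 : ℝ) 1) :=
    isCompact_Icc.image (by fun_prop)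
  have : ∀ᵐ z ∂segmentMeasure x ε, z ∈ (fun t : ℝ => ((x + ε * t : ℝ) : ℂ)) '' Set.Icc (0 : ℝ) 1 := by
    rw [segmentMeasure]
    refine (ae_map_iff (p := fun z => z ∈ (fun t : ℝ => ((x + ε * t : ℝ) : ℂ)) '' Set.Icc (0 : ℝ) 1)
      (measurable_segmentMap x ε).aemeasurable hK.measurableSet).2 ?_
    filter_upwards [ae_restrict_mem measurableSet_Icc] with t ht
    exact Set.mem_image_of_mem _ ht
  filter_upwards [this] with z hz
  obtain ⟨t, ht, rfl⟩ := hz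
  exact ⟨t, ht, rfl⟩

lemma ae_norm_sub_segmentMeasure_le (x : ℝ) {ε : ℝ} (hε : 0 ≤ ε) :
    ∀ᵐ z ∂segmentMeasure x ε, ‖z - (x : ℂ)‖ ≤ ε := by
  filter_upwards [ae_segmentMeasure x ε] with z hz
  obtain ⟨t, ht, rfl⟩ := hz
  rw [← Complex.ofReal_sub, Complex.norm_real, add_sub_cancel_left, Real.norm_eq_abs, abs_mul,
    abs_of_nonneg hε, abs_of_nonneg ht.1]
  exact mul_le_of_le_one_right hε ht.2

instance (x ε : ℝ) : IsProbabilityMeasure (segmentMeasure x ε) := ⟨segmentMeasure_univ x ε⟩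

lemma integrable_log_segmentMeasure (x : ℝ) {ε : ℝ} (hε : ε ≠ 0) (w : ℂ) :
    Integrable (fun z => Real.log ‖w - z‖) (segmentMeasure x ε) :=
  (logMoment_segmentMeasure x ε).integrable_log
    ((unifPos_segmentMeasure x hε).lintegral_posKer_ne_top w)

lemma log_add_one_div_le {s : ℝ} (hs : 0 < s) :
    Real.log ((s + 1) / s) ≤ Real.log 2 + max (-Real.log s) 0 := by
  rcases le_total 1 s with h | h
  · refine (Real.log_le_log (by positivity) ?_).trans
      (le_add_of_nonneg_right (le_max_right _ _))
    rw [div_le_iff₀ hs]; linarith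
  · calc Real.log ((s + 1) / s) ≤ Real.log (2 / s) := by
          apply Real.log_le_log (by positivity)
          gcongr
          linarith
      _ = Real.log 2 + -Real.log s := by rw [Real.log_div two_ne_zero hs.ne', sub_eq_add_neg]
      _ ≤ _ := by gcongr; exact le_max_left _ _

/-- From `‖w - x‖ ≤ ‖w - z‖ + ε`, the excess of `-log ‖w - z‖` over `-log ‖w - x‖` is at most `log 2
+ log⁺ (ε / ‖w - z‖)`. Rescaling by `ε` bounds the mean of the last term by a potential of Lebesgue
measure on the line. Since `C` depends on neither `x`, `ε` nor `w`, this supplies domination as `ε →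
0`. -/
lemma exists_pot_segmentMeasure_le : ∃ C : ℝ, 0 ≤ C ∧ ∀ (x : ℝ) {ε : ℝ}, 0 < ε → ∀ w : ℂ, w ≠ x →
    pot (segmentMeasure x ε) w ≤ -Real.log ‖w - x‖ + C := by
  obtain ⟨C, hC⟩ := unifPos_real.exists_bound
  refine ⟨Real.log 2 + C, by positivity, fun x ε hε w hw => ?_⟩
  have hε' : (ε : ℂ) ≠ 0 := by exact_mod_cast hε.ne'
  set r : ℂ := (w - x) / ε with hr
  set k : ℂ → ENNReal := fun z => posKer r ((z - x) / ε) with hk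
  have hkm : Measurable k := (measurable_posKer_right r).comp (by fun_prop)
  have hkC : ∫⁻ z, k z ∂segmentMeasure x ε ≤ C := by
    rw [segmentMeasure, lintegral_map hkm (measurable_segmentMap x ε)]
    refine (setLIntegral_le_lintegral _ _).trans ?_
    refine le_trans (le_of_eq ?_) (hC r)
    rw [lintegral_map (measurable_posKer_right r) (by fun_prop)]
    refine lintegral_congr fun t => ?_
    simp only [hk]
    congr 1
    push_cast
    field_simp
    ring
  have hkfin : ∫⁻ z, k z ∂segmentMeasure x ε ≠ ⊤ := ne_top_of_le_ne_top ENNReal.coe_ne_top hkC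
  have hki : Integrable (fun z => (k z).toReal) (segmentMeasure x ε) :=
    integrable_toReal_of_lintegral_ne_top hkm.aemeasurable hkfin
  have hkr : ∫ z, (k z).toReal ∂segmentMeasure x ε ≤ C := by
    rw [integral_toReal hkm.aemeasurable (ae_lt_top hkm hkfin)]
    have := ENNReal.toReal_mono ENNReal.coe_ne_top hkC
    rwa [ENNReal.coe_toReal] at this
  have hne := ae_ne_of_lintegral_posKer
    ((unifPos_segmentMeasure x hε.ne').lintegral_posKer_ne_top w)
  calc pot (segmentMeasure x ε) w
      ≤ ∫ z, ((-Real.log ‖w - x‖ + Real.log 2) + (k z).toReal) ∂segmentMeasure x ε := by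
        refine integral_mono_ae (integrable_log_segmentMeasure x hε.ne' w).neg
          ((integrable_const _).add hki) ?_
        filter_upwards [hne, ae_norm_sub_segmentMeasure_le x hε.le] with z hz hzε
        have hs : r - (z - x) / ε = (w - z) / ε := by rw [hr, ← sub_div]; congr 1; ring
        have hpos : 0 < ‖w - z‖ := norm_pos_iff.2 (sub_ne_zero.2 hz)
        have hpos' : 0 < ‖w - x‖ := norm_pos_iff.2 (sub_ne_zero.2 hw)
        have hne' : r ≠ (z - x) / ε := by
          rw [← sub_ne_zero, hs]
          exact div_ne_zero (sub_ne_zero.2 hz) hε'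
        have hn : ‖r - (z - x) / ε‖ = ‖w - z‖ / ε := by
          rw [hs, norm_div, Complex.norm_real, Real.norm_of_nonneg hε.le]
        have h1 := log_add_one_div_le (div_pos hpos hε)
        have h2 : Real.log (‖w - x‖ / ‖w - z‖) ≤ Real.log ((‖w - z‖ / ε + 1) / (‖w - z‖ / ε)) := by
          apply Real.log_le_log (by positivity)
          have h3 : ‖w - x‖ ≤ ‖w - z‖ + ε := by
            calc ‖w - x‖ = ‖(w - z) + (z - x)‖ := by congr 1; ring
              _ ≤ ‖w - z‖ + ‖z - x‖ := norm_add_le _ _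
              _ ≤ _ := by linarith
          rw [show (‖w - z‖ / ε + 1) / (‖w - z‖ / ε) = (‖w - z‖ + ε) / ‖w - z‖ by field_simp]
          gcongr
        rw [Real.log_div hpos'.ne' hpos.ne'] at h2
        change -Real.log ‖w - z‖ ≤ -Real.log ‖w - x‖ + Real.log 2 + (k z).toReal
        simp only [hk]
        rw [posKer_of_ne hne', ENNReal.toReal_ofReal', hn]
        linarith
    _ = -Real.log ‖w - x‖ + Real.log 2 + ∫ z, (k z).toReal ∂segmentMeasure x ε := by
        rw [integral_add (integrable_const _) hki]
        simp
    _ ≤ _ := by linarith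

lemma neg_le_pot_segmentMeasure (x : ℝ) {ε : ℝ} (hε : 0 < ε) (hε1 : ε ≤ 1) (w : ℂ) :
    -(Real.log (1 + ‖w‖) + Real.log (1 + (|x| + 1))) ≤ pot (segmentMeasure x ε) w := by
  calc -(Real.log (1 + ‖w‖) + Real.log (1 + (|x| + 1)))
      = ∫ _, -(Real.log (1 + ‖w‖) + Real.log (1 + (|x| + 1))) ∂segmentMeasure x ε := by simp
    _ ≤ _ := by
      refine integral_mono_ae (integrable_const _) (integrable_log_segmentMeasure x hε.ne' w).neg ?_
      filter_upwards [ae_norm_sub_segmentMeasure_le x hε.le] with z hz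
      have h1 := log_norm_sub_le w z
      have h2 : ‖z‖ ≤ |x| + 1 := by
        have := norm_sub_norm_le z x
        rw [Complex.norm_real, Real.norm_eq_abs] at this
        linarith
      have h3 : Real.log (1 + ‖z‖) ≤ Real.log (1 + (|x| + 1)) :=
        Real.log_le_log (by positivity) (by linarith)
      change _ ≤ -Real.log ‖w - z‖
      linarith

lemma tendsto_pot_segmentMeasure (x : ℝ) {w : ℂ} (hw : w ≠ x) :
    Tendsto (fun ε => pot (segmentMeasure x ε) w) (𝓝[>] 0) (𝓝 (-Real.log ‖w - x‖)) := by
  have hδ : 0 < ‖w - x‖ := norm_pos_iff.2 (sub_ne_zero.2 hw)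
  have hc (s : ℝ) : Tendsto (fun ε : ℝ => -Real.log (‖w - x‖ + s * ε)) (𝓝[>] 0)
      (𝓝 (-Real.log ‖w - x‖)) := by
    have : ContinuousAt (fun ε : ℝ => -Real.log (‖w - x‖ + s * ε)) 0 := by
      refine (ContinuousAt.log (by fun_prop) ?_).neg
      simpa using hδ.ne'
    have h := this.tendsto
    simp only [mul_zero, add_zero] at h
    exact h.mono_left nhdsWithin_le_nhds
  have hI : Set.Ioo 0 ‖w - x‖ ∈ 𝓝[>] (0 : ℝ) := Ioo_mem_nhdsGT hδ
  refine tendsto_of_tendsto_of_tendsto_of_le_of_le' (hc 1) (hc (-1)) ?_ ?_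
  · filter_upwards [hI] with ε hε
    calc -Real.log (‖w - x‖ + 1 * ε)
        = ∫ _, -Real.log (‖w - x‖ + 1 * ε) ∂segmentMeasure x ε := by simp
      _ ≤ _ := by
        refine integral_mono_ae (integrable_const _)
          (integrable_log_segmentMeasure x hε.1.ne' w).neg ?_
        filter_upwards [ae_norm_sub_segmentMeasure_le x hε.1.le] with z hz
        have h1 : ‖w - z‖ ≤ ‖w - x‖ + ε := by
          calc ‖w - z‖ = ‖(w - x) - (z - x)‖ := by congr 1; ring
            _ ≤ ‖w - x‖ + ‖z - x‖ := norm_sub_le _ _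
            _ ≤ _ := by linarith
        have h2 : ‖w - x‖ ≤ ‖w - z‖ + ε := by
          calc ‖w - x‖ = ‖(w - z) + (z - x)‖ := by congr 1; ring
            _ ≤ ‖w - z‖ + ‖z - x‖ := norm_add_le _ _
            _ ≤ _ := by linarith
        exact neg_le_neg (Real.log_le_log (by linarith [hε.2]) (by linarith))
  · filter_upwards [hI] with ε hε
    calc pot (segmentMeasure x ε) w
        ≤ ∫ _, -Real.log (‖w - x‖ + -1 * ε) ∂segmentMeasure x ε := by
          refine integral_mono_ae (integrable_log_segmentMeasure x hε.1.ne' w).neg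
            (integrable_const _) ?_
          filter_upwards [ae_norm_sub_segmentMeasure_le x hε.1.le] with z hz
          have h2 : ‖w - x‖ ≤ ‖w - z‖ + ε := by
            calc ‖w - x‖ = ‖(w - z) + (z - x)‖ := by congr 1; ring
              _ ≤ ‖w - z‖ + ‖z - x‖ := norm_add_le _ _
              _ ≤ _ := by linarith
          exact neg_le_neg (Real.log_le_log (by linarith [hε.2]) (by linarith))
      _ = _ := by simp

/-- Dominated convergence for the segment potentials, which converge at every `w ≠ x`. Finiteness of
the potential at `x` makes the exceptional point null and the bound integrable. -/
lemma LogMoment.tendsto_realEnergy_segmentMeasure (hμ : LogMoment μ) {x : ℝ}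
    (hx : ∫⁻ w, posKer x w ∂μ ≠ ⊤) :
    Tendsto (fun ε => realEnergy μ (segmentMeasure x ε)) (𝓝[>] 0) (𝓝 (pot μ x)) := by
  have := hμ.finite
  obtain ⟨C, hC0, hC⟩ := exists_pot_segmentMeasure_le
  have hne := ae_ne_of_lintegral_posKer hx
  have h1 : Tendsto (fun ε => ∫ w, pot (segmentMeasure x ε) w ∂μ) (𝓝[>] 0)
      (𝓝 (∫ w, -Real.log ‖(x : ℂ) - w‖ ∂μ)) := by
    refine tendsto_integral_filter_of_dominated_convergence
      (fun w => |Real.log ‖(x : ℂ) - w‖| + C + (Real.log (1 + ‖w‖) + Real.log (1 + (|x| + 1))))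
      ?_ ?_ ?_ ?_
    · filter_upwards [self_mem_nhdsWithin] with ε (hε : 0 < ε)
      exact ((logMoment_segmentMeasure x ε).continuous_pot
        (unifPos_segmentMeasure x hε.ne')).aestronglyMeasurable
    · filter_upwards [Ioc_mem_nhdsGT one_pos] with ε hε
      filter_upwards [hne] with w hw
      have h1 := hC x hε.1 w hw.symm
      have h2 := neg_le_pot_segmentMeasure x hε.1 hε.2 w
      rw [norm_sub_rev] at h1
      have h3 := neg_abs_le (Real.log ‖(x : ℂ) - w‖)
      have h4 := abs_nonneg (Real.log ‖(x : ℂ) - w‖)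
      have h5 := log_one_add_norm_nonneg w
      have h6 : 0 ≤ Real.log (1 + (|x| + 1)) := Real.log_nonneg (by linarith [abs_nonneg x])
      rw [Real.norm_eq_abs, abs_le]
      constructor <;> linarith
    · exact ((hμ.integrable_log hx).abs.add (integrable_const _)).add
        (hμ.integrable.add (integrable_const _))
    · filter_upwards [hne] with w hw
      rw [norm_sub_rev]
      exact tendsto_pot_segmentMeasure x hw.symm
  refine h1.congr' ?_
  filter_upwards [self_mem_nhdsWithin] with ε (hε : 0 < ε)
  exact (finiteMixed_segmentMeasure hμ x hε.ne').realEnergy_eq_integral.symm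

lemma integrable_segmentMeasure {f : ℂ → ℝ} (hf : Continuous f) (x ε : ℝ) :
    Integrable f (segmentMeasure x ε) := by
  rw [segmentMeasure, integrable_map_measure hf.aestronglyMeasurable
    (measurable_segmentMap x ε).aemeasurable]
  exact (Continuous.comp hf (by fun_prop)).continuousOn.integrableOn_Icc

lemma tendsto_integral_segmentMeasure {f : ℂ → ℝ} (hf : Continuous f) (x : ℝ) :
    Tendsto (fun ε => ∫ z, f z ∂segmentMeasure x ε) (𝓝[>] 0) (𝓝 (f x)) := by
  rw [Metric.tendsto_nhds]
  intro η hη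
  obtain ⟨δ, hδ, hball⟩ := Metric.continuousAt_iff.1 (hf.continuousAt (x := (x : ℂ))) (η / 2)
    (half_pos hη)
  filter_upwards [Ioo_mem_nhdsGT hδ] with ε hε
  have e : ∫ z, f z ∂segmentMeasure x ε - f x = ∫ z, (f z - f x) ∂segmentMeasure x ε := by
    rw [integral_sub (integrable_segmentMeasure hf x ε) (integrable_const _)]
    simp
  rw [Real.dist_eq, e, ← Real.norm_eq_abs]
  have h := norm_integral_le_of_norm_le_const (μ := segmentMeasure x ε) (f := fun z => f z - f x)
    (C := η / 2) ?_
  · simp only [probReal_univ, mul_one] at h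
    linarith
  · filter_upwards [ae_norm_sub_segmentMeasure_le x hε.1.le] with z hz
    rw [Real.norm_eq_abs, ← Real.dist_eq]
    exact (hball (by rw [dist_eq_norm]; linarith [hε.2])).le

end SegmentLimit

section RealAxis

lemma continuous_field (hV : Continuous V) (a : ℝ) : Continuous fun z : ℂ => V z.re - a * |z.re| := by fun_prop

/-- A segment measure with the same `μ₂` is an admissible competitor of finite energy. So the
minimal energy is not `⊤`, and a field bounded below is integrable. -/
lemma IsMinimizer.integrable_field (hmin : IsMinimizer V a μ₁ μ₂) (hV : Continuous V)
    {B : ℝ} (hB : ∀ x, B ≤ V x - a * |x|) :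
    Integrable (fun z : ℂ => V z.re - a * |z.re|) μ₁ := by
  have hA := hmin.1
  have := hA.isProbabilityMeasure
  have hm := finiteMixed_segmentMeasure (logMoment_segmentMeasure 0 1) 0 one_ne_zero
  have hν : Admissible a (segmentMeasure 0 1) μ₂ :=
    hA.of_logMoment hm (segmentMeasure_im 0 1) (segmentMeasure_univ 0 1)
  have hle := hmin.2 _ _ hν
  rw [hν.energy_eq_coe (integrable_segmentMeasure (continuous_field hV a) 0 1), hA.energy_eq]
    at hle
  refine integrable_of_extIntegral_ne_top (continuous_field hV a).measurable
    (fun z => hB z.re) fun htop => ?_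
  rw [htop, EReal.coe_add_top, top_le_iff] at hle
  exact EReal.coe_ne_top _ hle

/-- The constant in the Euler-Lagrange conditions on the real axis. -/
lemma IsMinimizer.le_field_add_pot (hmin : IsMinimizer V a μ₁ μ₂) (hV : Continuous V)
    {B : ℝ} (hB : ∀ x, B ≤ V x - a * |x|) {x : ℝ}
    (hx : ∫⁻ w, posKer x w ∂μ₁ ≠ ⊤) :
    2 * realEnergy μ₁ μ₁ - realEnergy μ₁ μ₂ + ∫ z, (V z.re - a * |z.re|) ∂μ₁ ≤
      2 * pot μ₁ x - pot μ₂ x + (V x - a * |x|) := by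
  have hA := hmin.1
  have h1 := hA.logMoment₁.tendsto_realEnergy_segmentMeasure hx
  have h2 := hA.logMoment₂.tendsto_realEnergy_segmentMeasure (hA.unifPos.lintegral_posKer_ne_top x)
  have h3 := tendsto_integral_segmentMeasure (continuous_field hV a) x
  -- The first-order inequality is tested on segments shrinking to `x`.
  refine ge_of_tendsto (((h1.const_mul 2).sub h2).add h3) ?_
  filter_upwards [self_mem_nhdsWithin] with ε (hε : 0 < ε)
  exact hmin.first_variation_nonneg (hmin.integrable_field hV hB) (logMoment_segmentMeasure x ε)
    (unifPos_segmentMeasure x hε.ne') (segmentMeasure_im x ε) (segmentMeasure_univ x ε)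
    (integrable_segmentMeasure (continuous_field hV a) x ε)

/-- The difference `F` is nonnegative almost everywhere, and its `μ₁`-integral is zero because `L`
is itself the integral of the expression it bounds. -/
lemma IsMinimizer.ae_eq_field_add_pot (hmin : IsMinimizer V a μ₁ μ₂) (hV : Continuous V)
    {B : ℝ} (hB : ∀ x, B ≤ V x - a * |x|) :
    ∀ᵐ z ∂μ₁, ∫⁻ w, posKer z w ∂μ₁ ≠ ⊤ ∧
      2 * pot μ₁ z = pot μ₂ z - (V z.re - a * |z.re|) +
        (2 * realEnergy μ₁ μ₁ - realEnergy μ₁ μ₂ + ∫ z, (V z.re - a * |z.re|) ∂μ₁) := by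
  have hA := hmin.1
  have := hA.isProbabilityMeasure
  have := hA.isFiniteMeasure
  have m11 := hA.finite_energy₁.finiteMixed
  have m12 := hA.finiteMixed
  set L := 2 * realEnergy μ₁ μ₁ - realEnergy μ₁ μ₂ + ∫ z, (V z.re - a * |z.re|) ∂μ₁ with hL
  set F : ℂ → ℝ := fun z => 2 * pot μ₁ z - pot μ₂ z + (V z.re - a * |z.re|) - L with hF
  have hfin := m11.ae_lintegral_posKer_ne_top
  have him : ∀ᵐ z ∂μ₁, z.im = 0 := by
    rw [ae_iff]; exact hA.on_real
  have hW := hmin.integrable_field hV hB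
  have i1 := m11.integrable_pot.const_mul 2
  have i2 := m12.integrable_pot
  have hFi : Integrable F μ₁ := ((i1.sub i2).add hW).sub (integrable_const _)
  have hF0 : ∫ z, F z ∂μ₁ = 0 := by
    have e : ∫ z, F z ∂μ₁ = 2 * ∫ z, pot μ₁ z ∂μ₁ - ∫ z, pot μ₂ z ∂μ₁
        + ∫ z, (V z.re - a * |z.re|) ∂μ₁ - L := by
      rw [hF, integral_sub (f := fun z => 2 * pot μ₁ z - pot μ₂ z + (V z.re - a * |z.re|))
        ((i1.sub i2).add hW) (integrable_const _),
        integral_add (f := fun z => 2 * pot μ₁ z - pot μ₂ z) (i1.sub i2) hW,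
        integral_sub i1 i2, integral_const_mul]
      simp
    rw [e, ← m11.realEnergy_eq_integral, ← m12.realEnergy_eq_integral, hL]
    ring
  have hnn : 0 ≤ᵐ[μ₁] F := by
    filter_upwards [hfin, him] with z hz hzi
    obtain ⟨x, rfl⟩ : ∃ x : ℝ, z = x := ⟨z.re, by apply Complex.ext <;> simp [hzi]⟩
    have := hmin.le_field_add_pot hV hB hz
    simp only [Pi.zero_apply, hF, Complex.ofReal_re]
    linarith
  have h0 := (integral_eq_zero_iff_of_nonneg_ae hnn hFi).1 hF0
  filter_upwards [h0, hfin] with z hz hzf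
  refine ⟨hzf, ?_⟩
  simp only [hF, Pi.zero_apply] at hz
  linarith

/-- A support point is a limit of points where the equality holds, and there the right side is
continuous. Semicontinuity gives only `≤`, but this is the missing direction. -/
lemma IsMinimizer.le_on_support (hmin : IsMinimizer V a μ₁ μ₂) (hV : Continuous V)
    {B : ℝ} (hB : ∀ x, B ≤ V x - a * |x|) {z : ℂ} (hz : z ∈ μ₁.support) :
    ∫⁻ w, posKer z w ∂μ₁ ≠ ⊤ ∧
      2 * pot μ₁ z ≤ pot μ₂ z - (V z.re - a * |z.re|) +
        (2 * realEnergy μ₁ μ₁ - realEnergy μ₁ μ₂ + ∫ z, (V z.re - a * |z.re|) ∂μ₁) := by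
  have hA := hmin.1
  have := hA.isProbabilityMeasure
  have hm := hA.logMoment₁
  obtain ⟨u, hu, hup⟩ := exists_seq_tendsto_of_mem_support hz (hmin.ae_eq_field_add_pot hV hB)
  set L := 2 * realEnergy μ₁ μ₁ - realEnergy μ₁ μ₂ + ∫ z, (V z.re - a * |z.re|) ∂μ₁ with hL
  have hcont : Continuous fun z => (pot μ₂ z - (V z.re - a * |z.re|) + L) / 2 :=
    (((hA.logMoment₂.continuous_pot hA.unifPos).sub (continuous_field hV a)).add
      continuous_const).div_const 2
  have hlim := (hcont.tendsto z).comp hu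
  have hpot : ∀ n, pot μ₁ (u n) = (pot μ₂ (u n) - (V (u n).re - a * |(u n).re|) + L) / 2 := by
    intro n
    have := (hup n).2
    linarith
  -- Along the sequence the equality bounds the potentials and hence their positive parts; Fatou
  -- carries the bound to `z`.
  have hfin : ∫⁻ w, posKer z w ∂μ₁ ≠ ⊤ := by
    have hlog : Continuous fun z : ℂ => Real.log (1 + ‖z‖) :=
      Continuous.log (by fun_prop) fun z => by positivity
    have hKlim : Tendsto (fun n => pot μ₁ (u n) + (Real.log (1 + ‖u n‖)
        + ∫ w, Real.log (1 + ‖w‖) ∂μ₁)) atTop (𝓝 ((pot μ₂ z - (V z.re - a * |z.re|) + L) / 2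
        + (Real.log (1 + ‖z‖) + ∫ w, Real.log (1 + ‖w‖) ∂μ₁))) := by
      refine Tendsto.add (hlim.congr fun n => (hpot n).symm) ?_
      exact ((hlog.tendsto z).comp hu).add_const _
    have hK : ∀ n, ∫⁻ w, posKer (u n) w ∂μ₁ ≤ ENNReal.ofReal (pot μ₁ (u n) +
        (Real.log (1 + ‖u n‖) + ∫ w, Real.log (1 + ‖w‖) ∂μ₁)) := by
      intro n
      have h1 := hm.pot_eq (hup n).1
      have h2 : (∫⁻ w, negKer (u n) w ∂μ₁).toReal ≤
          Real.log (1 + ‖u n‖) + ∫ w, Real.log (1 + ‖w‖) ∂μ₁ := by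
        rw [← ENNReal.toReal_ofReal (r := Real.log (1 + ‖u n‖) + ∫ w, Real.log (1 + ‖w‖) ∂μ₁)
          (add_nonneg (log_one_add_norm_nonneg _) (integral_nonneg log_one_add_norm_nonneg))]
        refine ENNReal.toReal_mono ENNReal.ofReal_ne_top ?_
        refine (lintegral_mono (negKer_le (u n))).trans ?_
        rw [lintegral_add_left measurable_const, lintegral_const, measure_univ, mul_one,
          ENNReal.ofReal_add (log_one_add_norm_nonneg _) (integral_nonneg log_one_add_norm_nonneg),
          ofReal_integral_eq_lintegral_ofReal hm.integrable (ae_of_all _ log_one_add_norm_nonneg)]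
      rw [← ENNReal.ofReal_toReal (hup n).1]
      apply ENNReal.ofReal_le_ofReal
      linarith
    have hfatou : ∫⁻ w, posKer z w ∂μ₁ ≤ liminf (fun n => ∫⁻ w, posKer (u n) w ∂μ₁) atTop := by
      have e : ∀ w, posKer z w = liminf (fun n => posKer (u n) w) atTop := fun w =>
        (((continuous_posKer.comp (Continuous.prodMk_left w)).tendsto z).comp hu).liminf_eq.symm
      simp_rw [e]
      exact lintegral_liminf_le fun n => measurable_posKer_right (u n)
    have hlim2 := (ENNReal.continuous_ofReal.tendsto _).comp hKlim
    have hle := hfatou.trans (liminf_le_liminf (Eventually.of_forall hK))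
    rw [show liminf (fun n => ENNReal.ofReal (pot μ₁ (u n) + (Real.log (1 + ‖u n‖)
      + ∫ w, Real.log (1 + ‖w‖) ∂μ₁))) atTop = _ from hlim2.liminf_eq] at hle
    exact ne_top_of_le_ne_top ENNReal.ofReal_ne_top hle
  refine ⟨hfin, ?_⟩
  -- For fixed `n` the truncated potential is continuous, so the bound passes to the limit along the
  -- sequence; the truncation is removed afterwards.
  have h1 : ∀ n, -∫ w, truncKer n z w ∂μ₁ ≤ (pot μ₂ z - (V z.re - a * |z.re|) + L) / 2 := by
    intro n
    refine le_of_tendsto_of_tendsto'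
      (((hm.continuous_integral_truncKer n).neg.tendsto z).comp hu) hlim fun k => ?_
    exact (hm.neg_integral_truncKer_le_pot (hup k).1 n).trans (hpot k).le
  have h2 := le_of_tendsto' (hm.tendsto_integral_truncKer hfin) h1
  linarith

/-- The potential of the first component of the minimizer is finite everywhere. -/
lemma IsMinimizer.lintegral_posKer_ne_top (hmin : IsMinimizer V a μ₁ μ₂) (hV : Continuous V)
    {B : ℝ} (hB : ∀ x, B ≤ V x - a * |x|) (z : ℂ) :
    ∫⁻ w, posKer z w ∂μ₁ ≠ ⊤ := by
  have := hmin.1.isProbabilityMeasure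
  by_cases hz : z ∈ μ₁.support
  · exact (hmin.le_on_support hV hB hz).1
  · exact lintegral_posKer_ne_top_of_notMem_support hz

end RealAxis

end ExternalSource

/-! ### The external field, and potentials along the imaginary axis and at infinity. -/

namespace ExternalSource

open Filter Topology

variable {μ ν μ₁ μ₂ : Measure ℂ} {V : ℝ → ℝ} {a : ℝ}

section Field

lemma continuous_evenPoly (d : ℕ) (v : ℕ → ℝ) : Continuous (evenPoly d v) := by
  unfold evenPoly
  fun_prop

/-- The field is a polynomial in `|x|` of degree `2d ≥ 2` with leading coefficient `v d`, so the
linear term cannot affect its growth. -/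
lemma exists_le_evenPoly_sub {d : ℕ} (hd : 1 ≤ d) {v : ℕ → ℝ} (hv : 0 < v d) (a : ℝ) :
    ∃ B, ∀ x, B ≤ evenPoly d v x - a * |x| := by
  set p : Polynomial ℝ := ∑ j ∈ Finset.Icc 1 d, Polynomial.C (v j) * Polynomial.X ^ (2 * j)
    - Polynomial.C a * Polynomial.X with hp
  have heval (x : ℝ) : p.eval |x| = evenPoly d v x - a * |x| := by
    simp [hp, Polynomial.eval_finsetSum, evenPoly, pow_mul]
  have hcoeff : p.coeff (2 * d) = v d := by
    have h1 : ∀ j ∈ Finset.Icc 1 d, (Polynomial.C (v j) * Polynomial.X ^ (2 * j)).coeff (2 * d) =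
        if j = d then v d else 0 := by
      intro j _
      rw [Polynomial.coeff_C_mul_X_pow]
      by_cases h : j = d
      · simp [h]
      · rw [if_neg (by omega), if_neg h]
    rw [hp, Polynomial.coeff_sub, Polynomial.finsetSum_coeff, Finset.sum_congr rfl h1,
      Polynomial.coeff_C_mul, Polynomial.coeff_X_of_ne_one (by omega)]
    simp [hd]
  have hdeg : p.natDegree ≤ 2 * d := by
    refine (Polynomial.natDegree_sub_le _ _).trans (max_le ?_ ?_)
    · refine Polynomial.natDegree_sum_le_of_forall_le _ _ fun j hj => ?_
      refine (Polynomial.natDegree_C_mul_X_pow_le _ _).trans ?_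
      have := (Finset.mem_Icc.1 hj).2
      omega
    · refine ((Polynomial.natDegree_C_mul_le _ _).trans Polynomial.natDegree_X_le).trans ?_
      omega
  have hnat : p.natDegree = 2 * d :=
    le_antisymm hdeg (Polynomial.le_natDegree_of_ne_zero (by rw [hcoeff]; exact hv.ne'))
  have hlim := p.tendsto_atTop_of_leadingCoeff_nonneg
    (Polynomial.natDegree_pos_iff_degree_pos.1 (by omega))
    (by rw [Polynomial.leadingCoeff, hnat, hcoeff]; exact hv.le)
  obtain ⟨M, hM⟩ := eventually_atTop.1 (hlim.eventually (eventually_ge_atTop 0))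
  obtain ⟨B, hB⟩ := (isCompact_Icc (a := (0 : ℝ)) (b := M)).bddBelow_image
    p.continuous.continuousOn
  refine ⟨min 0 B, fun x => ?_⟩
  rw [← heval]
  rcases le_total M |x| with h | h
  · exact (min_le_left _ _).trans (hM _ h)
  · exact (min_le_right _ _).trans (hB ⟨_, ⟨abs_nonneg x, h⟩, rfl⟩)

end Field

section Imaginary

lemma norm_real_le_norm_sub {z w : ℂ} (hz : z.re = 0) (hw : w.im = 0) : ‖w‖ ≤ ‖z - w‖ := by
  have h1 : ‖w‖ = |w.re| := by
    rw [← Complex.abs_re_eq_norm.2 hw]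
  have h2 := abs_re_le_norm (z - w)
  rw [Complex.sub_re, hz, zero_sub, abs_neg] at h2
  rw [h1]; exact h2

lemma norm_imag_le_norm_sub {z w : ℂ} (hz : z.re = 0) (hw : w.im = 0) : ‖z‖ ≤ ‖z - w‖ := by
  have h1 : ‖z‖ = |z.im| := by
    rw [← Complex.abs_im_eq_norm.2 hz]
  have h2 := abs_im_le_norm (z - w)
  rw [Complex.sub_im, hw, sub_zero] at h2
  rw [h1]; exact h2

/-- The potential of a measure on the real line is continuous along the imaginary axis. -/
lemma LogMoment.continuousOn_pot (hμ : LogMoment μ) (him : μ {z : ℂ | z.im ≠ 0} = 0)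
    (h0 : ∫⁻ w, posKer 0 w ∂μ ≠ ⊤) : ContinuousOn (pot μ) {z | z.re = 0} := by
  have := hμ.finite
  have him' : ∀ᵐ w ∂μ, w.im = 0 := by rw [ae_iff]; exact him
  have hne := ae_ne_of_lintegral_posKer h0
  intro z₀ hz₀
  refine continuousWithinAt_of_dominated
    -- For `z` imaginary and `w` real, `‖z - w‖ ≥ ‖w‖`. The singularity is therefore no worse than
    -- at `z = 0`, where the potential is finite.
    (bound := fun w => |Real.log ‖0 - w‖| + (Real.log (1 + (‖z₀‖ + 1)) + Real.log (1 + ‖w‖)))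
    ?_ ?_ ?_ ?_
  · exact Eventually.of_forall fun z =>
      ((measurable_const.sub measurable_id).norm.log).neg.aestronglyMeasurable
  · filter_upwards [self_mem_nhdsWithin,
      mem_nhdsWithin_of_mem_nhds (Metric.ball_mem_nhds z₀ one_pos)] with z hz hball
    filter_upwards [him', hne] with w hw hw0
    have h1 : ‖z‖ ≤ ‖z₀‖ + 1 := by
      have h1 := norm_sub_norm_le z z₀
      rw [Metric.mem_ball, dist_eq_norm] at hball
      linarith
    have h2 := Real.log_le_log (by positivity : 0 < 1 + ‖z‖)
      (by linarith : 1 + ‖z‖ ≤ 1 + (‖z₀‖ + 1))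
    have h3 := log_norm_sub_le z w
    have hw1 : 0 < ‖0 - w‖ := norm_pos_iff.2 (sub_ne_zero.2 hw0)
    have h4 : Real.log ‖0 - w‖ ≤ Real.log ‖z - w‖ := by
      apply Real.log_le_log hw1
      rw [zero_sub, norm_neg]
      exact norm_real_le_norm_sub hz hw
    have h5 := neg_abs_le (Real.log ‖0 - w‖)
    have h6 := abs_nonneg (Real.log ‖0 - w‖)
    have h7 := log_one_add_norm_nonneg w
    have h8 := log_one_add_norm_nonneg z
    rw [Real.norm_eq_abs, abs_le]
    constructor <;> linarith
  · exact (hμ.integrable_log h0).abs.add ((integrable_const _).add hμ.integrable)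
  · filter_upwards [him', hne] with w hw hw0
    have hw1 : 0 < ‖z₀ - w‖ := lt_of_lt_of_le (norm_pos_iff.2 hw0.symm)
      (norm_real_le_norm_sub hz₀ hw)
    have hc : ContinuousAt (fun z => ‖z - w‖) z₀ := by fun_prop
    exact (hc.log hw1.ne').neg.continuousWithinAt

end Imaginary

section Infinity

lemma abs_log_sub_truncKer_le (n : ℕ) {z : ℂ} (hz : 1 ≤ ‖z‖) (w : ℂ) :
    |Real.log ‖z‖ - truncKer n z w| ≤ n + Real.log 2 + Real.log (1 + ‖w‖) := by
  have h0 : (0 : ℝ) ≤ n := n.cast_nonneg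
  have h2 := log_one_add_norm_nonneg w
  have hl2 : 0 ≤ Real.log 2 := Real.log_nonneg one_le_two
  have hlz : 0 ≤ Real.log ‖z‖ := Real.log_nonneg hz
  have hpos : 0 < max ‖z - w‖ (Real.exp (-n)) := lt_of_lt_of_le (Real.exp_pos _) (le_max_right _ _)
  have h3 : -(n : ℝ) ≤ truncKer n z w := by
    rw [truncKer, Real.le_log_iff_exp_le hpos]
    exact le_max_right _ _
  have h4 : truncKer n z w ≤ Real.log ‖z‖ + Real.log 2 + Real.log (1 + ‖w‖) := by
    rcases max_cases ‖z - w‖ (Real.exp (-n)) with ⟨h, -⟩ | ⟨h, -⟩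
    · rw [truncKer, h]
      have h5 := log_norm_sub_le z w
      have h6 : Real.log (1 + ‖z‖) ≤ Real.log (2 * ‖z‖) :=
        Real.log_le_log (by positivity) (by linarith)
      rw [Real.log_mul two_ne_zero (by linarith)] at h6
      linarith
    · rw [truncKer, h, Real.log_exp]; linarith
  have h5 : Real.log ‖z‖ ≤ truncKer n z w + n + Real.log 2 + Real.log (1 + ‖w‖) := by
    have h6 := log_one_add_norm_le w z
    have h7 : Real.log ‖z‖ ≤ Real.log (1 + ‖z‖) := Real.log_le_log (by linarith) (by linarith)
    have h8 : max (Real.log ‖w - z‖) 0 ≤ truncKer n z w + n := by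
      apply max_le
      · rcases eq_or_ne w z with rfl | hne
        · simp only [sub_self, norm_zero, Real.log_zero]; linarith
        · have : Real.log ‖w - z‖ ≤ truncKer n z w := by
            apply Real.log_le_log (norm_pos_iff.2 (sub_ne_zero.2 hne))
            rw [norm_sub_rev]
            exact le_max_left _ _
          linarith
      · linarith
    linarith
  rw [abs_le]
  constructor <;> linarith

lemma LogMoment.tendsto_integral_log_sub_truncKer (hμ : LogMoment μ) (n : ℕ) {u : ℕ → ℂ}
    (hu : Tendsto (fun k => ‖u k‖) atTop atTop) :
    Tendsto (fun k => ∫ w, (Real.log ‖u k‖ - truncKer n (u k) w) ∂μ) atTop (𝓝 0) := by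
  have := hμ.finite
  have h : Tendsto (fun k => ∫ w, (Real.log ‖u k‖ - truncKer n (u k) w) ∂μ) atTop
      (𝓝 (∫ _, (0 : ℝ) ∂μ)) := by
    refine tendsto_integral_filter_of_dominated_convergence
      (fun w => n + Real.log 2 + Real.log (1 + ‖w‖)) ?_ ?_ ?_ ?_
    · exact Eventually.of_forall fun k => (continuous_const.sub
        ((continuous_truncKer n).comp (Continuous.prodMk_right (u k)))).aestronglyMeasurable
    · filter_upwards [hu.eventually_ge_atTop 1] with k hk
      exact ae_of_all _ fun w => abs_log_sub_truncKer_le n hk w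
    · exact (integrable_const _).add hμ.integrable
    · refine ae_of_all _ fun w => ?_
      have h1 : Tendsto (fun k => ‖u k - w‖ / ‖u k‖) atTop (𝓝 1) := by
        have hw : Tendsto (fun k => ‖w‖ / ‖u k‖) atTop (𝓝 0) := hu.const_div_atTop _
        have hlo : Tendsto (fun k => 1 - ‖w‖ / ‖u k‖) atTop (𝓝 1) := by
          simpa using tendsto_const_nhds.sub hw
        have hhi : Tendsto (fun k => 1 + ‖w‖ / ‖u k‖) atTop (𝓝 1) := by
          simpa using tendsto_const_nhds.add hw
        refine tendsto_of_tendsto_of_tendsto_of_le_of_le' hlo hhi ?_ ?_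
        · filter_upwards [hu.eventually_gt_atTop 0] with k hk
          rw [one_sub_div hk.ne']
          gcongr
          exact norm_sub_norm_le _ _
        · filter_upwards [hu.eventually_gt_atTop 0] with k hk
          rw [one_add_div hk.ne']
          gcongr
          exact norm_sub_le _ _
      have h2 := ((Real.continuousAt_log one_ne_zero).tendsto.comp h1).neg
      rw [Real.log_one, neg_zero] at h2
      refine h2.congr' ?_
      filter_upwards [hu.eventually_ge_atTop (1 + ‖w‖)] with k hk
      have h3 : 1 ≤ ‖u k - w‖ := by
        have := norm_sub_norm_le (u k) w
        linarith
      have h4 : 0 < ‖u k‖ := by linarith [norm_nonneg w]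
      have h5 : max ‖u k - w‖ (Real.exp (-n)) = ‖u k - w‖ := by
        apply max_eq_left
        refine le_trans ?_ h3
        rw [Real.exp_le_one_iff]
        simp
      simp only [Function.comp_apply]
      rw [truncKer, h5, Real.log_div (by linarith) h4.ne']
      ring
  simpa using h

lemma LogMoment.tendsto_pot_add_log (hμ : LogMoment μ) (hu : UnifPos μ) {u : ℕ → ℂ}
    (hk : Tendsto (fun k => ‖u k‖) atTop atTop) :
    Tendsto (fun k => pot μ (u k) + μ.real Set.univ * Real.log ‖u k‖) atTop (𝓝 0) := by
  have := hμ.finite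
  have hfin := hu.lintegral_posKer_ne_top
  obtain ⟨b, h1, h2, h3⟩ := hu
  rw [Metric.tendsto_nhds]
  intro ε hε
  obtain ⟨n, hn⟩ := (h2.eventually (gt_mem_nhds (ENNReal.ofReal_pos.2 (half_pos hε)))).exists
  have h4 := hμ.tendsto_integral_log_sub_truncKer n hk
  filter_upwards [Metric.tendsto_nhds.1 h4 (ε / 2) (half_pos hε)] with k hk'
  have h5 := hμ.pot_add_integral_truncKer (hfin (u k)) n
  rw [integral_sub (integrable_const _) (hμ.integrable_truncKer n _), integral_const,
    smul_eq_mul] at hk'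
  have h6 : (∫⁻ w, (posKer (u k) w - n) ∂μ).toReal < ε / 2 := by
    have := (h3 (u k) n).trans_lt hn
    exact (ENNReal.lt_ofReal_iff_toReal_lt this.ne_top).1 this
  have h7 := ENNReal.toReal_nonneg (a := ∫⁻ w, (posKer (u k) w - n) ∂μ)
  rw [Real.dist_eq, sub_zero, abs_lt] at hk' ⊢
  constructor <;> linarith [hk'.1, hk'.2]

/-- For `w` real and `z` imaginary with `‖z‖ ≥ 1`, also `‖z - w‖ ≥ 1`, so truncation at level `0`
changes nothing. This replaces `UnifPos`, which is not available for `μ₁`. -/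
lemma LogMoment.tendsto_pot_add_log_of_real (hμ : LogMoment μ) (him : μ {z : ℂ | z.im ≠ 0} = 0)
    {u : ℕ → ℂ} (hre : ∀ k, (u k).re = 0) (hk : Tendsto (fun k => ‖u k‖) atTop atTop) :
    Tendsto (fun k => pot μ (u k) + μ.real Set.univ * Real.log ‖u k‖) atTop (𝓝 0) := by
  have := hμ.finite
  have him' : ∀ᵐ w ∂μ, w.im = 0 := by rw [ae_iff]; exact him
  refine (hμ.tendsto_integral_log_sub_truncKer 0 hk).congr' ?_
  filter_upwards [hk.eventually_ge_atTop 1] with k hk1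
  rw [integral_sub (integrable_const _) (hμ.integrable_truncKer 0 _), integral_const, smul_eq_mul,
    pot, integral_neg, add_comm, ← sub_eq_add_neg]
  congr 1
  apply integral_congr_ae
  filter_upwards [him'] with w hw
  have := norm_imag_le_norm_sub (hre k) hw
  rw [truncKer, max_eq_left]
  simpa using hk1.trans this

end Infinity

end ExternalSource

/-! ### The constraint measure and the variation of `μ₂` under the constraint. -/

namespace ExternalSource

open Filter Topology

variable {μ ν μ₁ μ₂ : Measure ℂ} {V : ℝ → ℝ} {a : ℝ}

section Sigma

lemma sigmaMeasure_apply (a : ℝ) {s : Set ℂ} (hs : MeasurableSet s) :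
    sigmaMeasure a s = ENNReal.ofReal (a / Real.pi) * volume {y : ℝ | (y : ℂ) * I ∈ s} := by
  rw [sigmaMeasure, Measure.smul_apply, Measure.map_apply (by fun_prop) hs]
  rfl

lemma sigmaMeasure_re (a : ℝ) : sigmaMeasure a {z : ℂ | z.re ≠ 0} = 0 := by
  have hm : MeasurableSet {z : ℂ | z.re ≠ 0} :=
    (measurableSet_eq_fun measurable_re measurable_const).compl
  rw [sigmaMeasure_apply a hm]
  simp

lemma sigmaMeasure_ball_lt_top (a : ℝ) (z : ℂ) (r : ℝ) :
    sigmaMeasure a (Metric.ball z r) < ⊤ := by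
  rw [sigmaMeasure_apply a Metric.isOpen_ball.measurableSet]
  refine ENNReal.mul_lt_top ENNReal.ofReal_lt_top ?_
  refine (measure_mono (t := Set.Icc (z.im - r) (z.im + r)) fun y hy => ?_).trans_lt
    (by rw [Real.volume_Icc]; exact ENNReal.ofReal_lt_top)
  have h1 : ‖(y : ℂ) * I - z‖ < r := by rwa [← dist_eq_norm]
  have h2 := (abs_im_le_norm ((y : ℂ) * I - z)).trans_lt h1
  have h3 : |y - z.im| < r := by simpa using h2
  rw [abs_lt] at h3
  constructor <;> linarith

lemma sigmaMeasure_im_gt {a : ℝ} (ha : 0 < a) (R : ℝ) : sigmaMeasure a {z : ℂ | R < z.im} = ⊤ := by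
  rw [sigmaMeasure_apply a (measurableSet_lt measurable_const measurable_im)]
  have : {y : ℝ | (y : ℂ) * I ∈ {z : ℂ | R < z.im}} = Set.Ioi R := by
    ext y; simp
  rw [this, Real.volume_Ioi, ENNReal.mul_top]
  exact (ENNReal.ofReal_pos.2 (div_pos ha Real.pi_pos)).ne'

lemma logMoment_restrict_ball (h : ν ≤ sigmaMeasure a) (z : ℂ) (r : ℝ) :
    LogMoment (ν.restrict (Metric.ball z r)) := by
  have hfin : ν (Metric.ball z r) < ⊤ := (h _).trans_lt (sigmaMeasure_ball_lt_top a z r)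
  refine ⟨⟨by rwa [Measure.restrict_apply_univ]⟩, ?_⟩
  have hb : ∀ w ∈ Metric.ball z r, ENNReal.ofReal (Real.log (1 + ‖w‖)) ≤
      ENNReal.ofReal (Real.log (1 + (‖z‖ + r))) := by
    intro w hw
    apply ENNReal.ofReal_le_ofReal
    apply Real.log_le_log (by positivity)
    rw [Metric.mem_ball, dist_eq_norm] at hw
    have := norm_sub_norm_le w z
    linarith
  refine ne_top_of_le_ne_top ?_ (setLIntegral_mono' Metric.isOpen_ball.measurableSet hb)
  rw [setLIntegral_const]
  exact ENNReal.mul_ne_top ENNReal.ofReal_ne_top hfin.ne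

end Sigma

namespace Admissible

lemma sub_add_cancel (h : Admissible a μ₁ μ₂) : sigmaMeasure a - μ₂ + μ₂ = sigmaMeasure a :=
  have := h.isFiniteMeasure
  Measure.sub_add_cancel_of_le h.le_sigma

lemma support_sub_subset (a : ℝ) (μ₂ : Measure ℂ) :
    (sigmaMeasure a - μ₂).support ⊆ {z | z.re = 0} := by
  refine (Measure.support_mono Measure.sub_le).trans (Measure.support_subset_of_isClosed ?_ ?_)
  · exact isClosed_eq continuous_re continuous_const
  · rw [mem_ae_iff]
    exact sigmaMeasure_re a

lemma support_subset (h : Admissible a μ₁ μ₂) : μ₂.support ⊆ {z | z.re = 0} := by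
  refine Measure.support_subset_of_isClosed (isClosed_eq continuous_re continuous_const) ?_
  rw [mem_ae_iff]
  exact h.on_imag

/-- The constraint is not active far away on the imaginary axis. -/
lemma exists_mem_support_im_gt (h : Admissible a μ₁ μ₂) (ha : 0 < a) (R : ℝ) :
    ∃ z ∈ (sigmaMeasure a - μ₂).support, R < z.im := by
  have := h.isFiniteMeasure
  have h1 : 0 < (sigmaMeasure a - μ₂) {z : ℂ | R < z.im} := by
    rw [pos_iff_ne_zero]
    intro h0
    have h2 := sigmaMeasure_im_gt ha R
    rw [← h.sub_add_cancel, Measure.add_apply, h0, zero_add] at h2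
    exact measure_ne_top _ _ h2
  obtain ⟨z, hz, hzs⟩ := Measure.nonempty_inter_support_of_pos h1
  exact ⟨z, hzs, hz⟩

end Admissible

lemma exists_ball_lt_of_continuousOn {G : ℂ → ℝ} (hG : ContinuousOn G {z | z.re = 0}) {p : ℂ}
    (hp : p.re = 0) {m : ℝ} (hm : G p < m) :
    ∃ δ > 0, ∀ w ∈ Metric.ball p δ, w.re = 0 → G w ≤ m := by
  have h := (hG p hp).eventually (gt_mem_nhds hm)
  obtain ⟨δ, hδ, hb⟩ := Metric.mem_nhdsWithin_iff.1 h
  exact ⟨δ, hδ, fun w hw hre => (hb ⟨hw, hre⟩ : G w < m).le⟩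

/-- Moving mass of `μ₂` from a point of its support to a point where the constraint is not
active does not decrease the energy. -/
lemma IsMinimizer.le_of_mem_support (hmin : IsMinimizer V a μ₁ μ₂)
    (hi : Integrable (fun z : ℂ => V z.re - a * |z.re|) μ₁)
    (hc : ContinuousOn (pot μ₁) {z | z.re = 0}) {p q : ℂ} (hp : p ∈ μ₂.support)
    (hq : q ∈ (sigmaMeasure a - μ₂).support) :
    2 * pot μ₂ p - pot μ₁ p ≤ 2 * pot μ₂ q - pot μ₁ q := by
  have hA := hmin.1
  have := hA.isProbabilityMeasure
  have := hA.isFiniteMeasure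
  set η := sigmaMeasure a - μ₂ with hη
  set G : ℂ → ℝ := fun z => 2 * pot μ₂ z - pot μ₁ z with hGdef
  have l1 := hA.logMoment₁
  have l2 := hA.logMoment₂
  have u2 := hA.unifPos
  have hG : ContinuousOn G {z | z.re = 0} :=
    ((l2.continuous_pot u2).const_mul 2 |>.continuousOn).sub hc
  by_contra! hlt
  -- Two separated levels `m < m'`: by continuity, `G ≥ m'` on the axis near `p` and `G ≤ m` near
  -- `q`.
  obtain ⟨m, hm1, hm2⟩ := exists_between hlt
  obtain ⟨m', hm1', hm2'⟩ := exists_between hm2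
  obtain ⟨δp, hδp, hGp⟩ := exists_ball_lt_of_continuousOn hG.neg (hA.support_subset hp)
    (neg_lt_neg hm2')
  obtain ⟨δq, hδq, hGq⟩ := exists_ball_lt_of_continuousOn hG
    (Admissible.support_sub_subset a μ₂ hq) hm1
  set Bp := Metric.ball p δp
  set Bq := Metric.ball q δq
  have hBp : MeasurableSet Bp := Metric.isOpen_ball.measurableSet
  have hBq : MeasurableSet Bq := Metric.isOpen_ball.measurableSet
  have hησ : η ≤ sigmaMeasure a := Measure.sub_le
  set α := μ₂.restrict Bp with hα
  set α' := μ₂.restrict Bpᶜ with hα'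
  set β := η.restrict Bq with hβ
  have hαμ : α' + α = μ₂ := by rw [add_comm, hα, hα', Measure.restrict_add_restrict_compl hBp]
  have lα : LogMoment α := l2.mono Measure.restrict_le_self
  have lα' : LogMoment α' := l2.mono Measure.restrict_le_self
  have lβ : LogMoment β := logMoment_restrict_ball hησ q δq
  have uα : UnifPos α := u2.mono Measure.restrict_le_self
  have uα' : UnifPos α' := u2.mono Measure.restrict_le_self
  have uβ : UnifPos β := (unifPos_sigma a).mono (Measure.restrict_le_self.trans hησ)
  have := lα.finite
  have := lα'.finite
  have := lβ.finite
  have hposα : 0 < α.real Set.univ := by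
    refine ENNReal.toReal_pos ?_ (measure_ne_top _ _)
    rw [Measure.restrict_apply_univ]
    exact ((Measure.mem_support_iff_forall p).1 hp _ (Metric.ball_mem_nhds p hδp)).ne'
  have hposβ : 0 < β.real Set.univ := by
    refine ENNReal.toReal_pos ?_ (measure_ne_top _ _)
    rw [Measure.restrict_apply_univ]
    exact ((Measure.mem_support_iff_forall q).1 hq _ (Metric.ball_mem_nhds q hδq)).ne'
  set mα := α.real Set.univ with hmα
  set mβ := β.real Set.univ with hmβ
  -- The weights satisfy `x * mα = y * mβ`, so mass removed equals mass added. The `1` in the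
  -- denominator keeps both at most `1`.
  set x := mβ / (1 + mα + mβ) with hx
  set y := mα / (1 + mα + mβ) with hy
  have hx0 : 0 < x := by positivity
  have hy0 : 0 < y := by positivity
  have hx1 : x ≤ 1 := by rw [hx, div_le_one (by positivity)]; linarith
  have hy1 : y ≤ 1 := by rw [hy, div_le_one (by positivity)]; linarith
  have hxy : x * mα = y * mβ := by rw [hx, hy]; ring
  have fm : ∀ {X Y : Measure ℂ}, LogMoment X → LogMoment Y → UnifPos Y → FiniteMixed Y X := by
    intro X Y hX hY uY
    have := hX.finite
    have := hY.finite
    exact (hX.finiteMixed hY uY).symm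
  -- the first-order term is negative
  have hDα : m' * mα ≤ 2 * realEnergy α μ₂ - realEnergy α μ₁ := by
    have f1 := fm l2 lα uα
    have f2 := fm l1 lα uα
    rw [f1.realEnergy_eq_integral, f2.realEnergy_eq_integral, ← integral_const_mul,
      ← integral_sub (f1.integrable_pot.const_mul 2) f2.integrable_pot]
    have e : ∫ _, m' ∂α = m' * mα := by rw [integral_const, smul_eq_mul, mul_comm]
    rw [← e]
    refine integral_mono_ae (integrable_const _)
      ((f1.integrable_pot.const_mul 2).sub f2.integrable_pot) ?_
    have h1 : ∀ᵐ w ∂α, w.re = 0 := ae_mono Measure.restrict_le_self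
      (ae_iff.2 hA.on_imag)
    filter_upwards [h1, ae_restrict_mem hBp] with w hw hwB
    have := hGp w hwB hw
    simp only [Pi.neg_apply, neg_le_neg_iff] at this
    exact this
  have hDβ : 2 * realEnergy β μ₂ - realEnergy β μ₁ ≤ m * mβ := by
    have f1 := fm l2 lβ uβ
    have f2 := fm l1 lβ uβ
    rw [f1.realEnergy_eq_integral, f2.realEnergy_eq_integral, ← integral_const_mul,
      ← integral_sub (f1.integrable_pot.const_mul 2) f2.integrable_pot]
    have e : ∫ _, m ∂β = m * mβ := by rw [integral_const, smul_eq_mul, mul_comm]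
    rw [← e]
    refine integral_mono_ae ((f1.integrable_pot.const_mul 2).sub f2.integrable_pot)
      (integrable_const _) ?_
    have h1 : ∀ᵐ w ∂β, w.re = 0 := ae_mono (Measure.restrict_le_self.trans hησ)
      (ae_iff.2 (sigmaMeasure_re a))
    filter_upwards [h1, ae_restrict_mem hBq] with w hw hwB
    exact hGq w hwB hw
  have hneg : y * (2 * realEnergy β μ₂ - realEnergy β μ₁)
      - x * (2 * realEnergy α μ₂ - realEnergy α μ₁) < 0 := by
    have h1 := mul_le_mul_of_nonneg_left hDα hx0.le
    have h2 := mul_le_mul_of_nonneg_left hDβ hy0.le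
    have h3 : 0 < x * mα := by positivity
    have h4 : y * (m * mβ) - x * (m' * mα) = (x * mα) * (m - m') := by
      rw [mul_sub, hxy]
      linear_combination m' * hxy
    nlinarith
  refine absurd (nonneg_of_forall_quadratic (D := y * (2 * realEnergy β μ₂ - realEnergy β μ₁)
      - x * (2 * realEnergy α μ₂ - realEnergy α μ₁))
    (Q := y * (y * realEnergy β β - x * realEnergy α β)
      - x * (y * realEnergy β α - x * realEnergy α α)) fun t ht0 ht1 => ?_) (not_le.2 hneg)
  have htx : t * x ≤ 1 := by nlinarith
  have hty : t * y ≤ 1 := by nlinarith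
  set c : ENNReal := ENNReal.ofReal (1 - t * x)
  set s : ENNReal := ENNReal.ofReal (t * y)
  have hc : c ≠ ⊤ := ENNReal.ofReal_ne_top
  have hs : s ≠ ⊤ := ENNReal.ofReal_ne_top
  have hcr : c.toReal = 1 - t * x := ENNReal.toReal_ofReal (by linarith)
  have hsr : s.toReal = t * y := ENNReal.toReal_ofReal (by positivity)
  have fc : IsFiniteMeasure (c • α) := Measure.smul_finite α hc
  have fs : IsFiniteMeasure (s • β) := Measure.smul_finite β hs
  -- This is `μ₂ - t x α + t y β`. What is added comes from the slack near `q`, so the constraint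
  -- still holds.
  set ν := α' + c • α + s • β with hν
  have lν : LogMoment ν := (lα'.add (lα.smul hc)).add (lβ.smul hs)
  have key : ∀ X : Measure ℂ, LogMoment X → FiniteMixed ν X ∧ realEnergy ν X =
      realEnergy μ₂ X + t * (y * realEnergy β X - x * realEnergy α X) := by
    intro X hX
    have := hX.finite
    have k1 := fm hX lα' uα'
    have k2 := fm hX lα uα
    have k3 := fm hX lβ uβ
    refine ⟨(k1.add_left (k2.smul_left hc)).add_left (k3.smul_left hs), ?_⟩
    rw [hν, (k1.add_left (k2.smul_left hc)).realEnergy_add_left (k3.smul_left hs),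
      k1.realEnergy_add_left (k2.smul_left hc), realEnergy_smul_left,
      realEnergy_smul_left, hcr, hsr, ← hαμ, k1.realEnergy_add_left k2]
    ring
  have kν := key ν lν
  have hνσ : ν ≤ sigmaMeasure a := by
    have h1 : c • α ≤ α := by
      intro w
      rw [Measure.smul_apply, smul_eq_mul]
      refine mul_le_of_le_one_left' ?_
      rw [ENNReal.ofReal_le_one]
      nlinarith
    have h2 : s • β ≤ η := by
      refine le_trans (fun w => ?_) (Measure.restrict_le_self (s := Bq))
      rw [Measure.smul_apply, smul_eq_mul]
      refine mul_le_of_le_one_left' ?_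
      rwa [ENNReal.ofReal_le_one]
    calc ν ≤ α' + α + η := add_le_add (add_le_add le_rfl h1) h2
      _ = sigmaMeasure a := by rw [hαμ, add_comm, hη, hA.sub_add_cancel]
  have hadm : Admissible a μ₁ ν := by
    refine ⟨hA.finite_energy₁, kν.1.hasFiniteLogEnergy, hA.on_real, hA.mass₁, ?_, ?_, hνσ⟩
    · exact le_antisymm ((hνσ _).trans (sigmaMeasure_re a).le) zero_le
    · have e1 : α Set.univ = ENNReal.ofReal mα := by simp [hmα]
      have e2 : β Set.univ = ENNReal.ofReal mβ := by simp [hmβ]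
      rw [← hA.mass₂, ← hαμ]
      simp only [hν, Measure.add_apply, Measure.smul_apply, smul_eq_mul]
      rw [add_assoc]
      congr 1
      rw [e1, e2, ← ENNReal.ofReal_mul (by linarith), ← ENNReal.ofReal_mul (by positivity),
        ← ENNReal.ofReal_add (mul_nonneg (by linarith) hposα.le) (by positivity)]
      congr 1
      linear_combination -t * hxy
  have hle := hmin.2 _ _ hadm
  have k2 := key μ₂ l2
  have k1 := key μ₁ l1
  have kα := key α lα
  have kβ := key β lβ
  have := lν.finite
  rw [hA.energy_eq_coe hi, hadm.energy_eq_coe hi, EReal.coe_le_coe_iff, kν.2,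
    realEnergy_comm (μ := μ₁) (ν := ν), realEnergy_comm (μ := μ₂) (ν := ν),
    realEnergy_comm (μ := β) (ν := ν), realEnergy_comm (μ := α) (ν := ν), k1.2, k2.2, kα.2, kβ.2,
    realEnergy_comm (μ := μ₁) (ν := μ₂), realEnergy_comm (μ := μ₂) (ν := α),
    realEnergy_comm (μ := μ₂) (ν := β)] at hle
  linarith

end ExternalSource

/-! ### Sign of the effective potential and conjugation symmetry. -/

namespace ExternalSource

open Filter Topology Real

variable {μ ν μ₁ μ₂ : Measure ℂ} {V : ℝ → ℝ} {a : ℝ}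

section Sign

lemma pot_smul (c : ENNReal) (μ : Measure ℂ) (z : ℂ) : pot (c • μ) z = c.toReal * pot μ z := by
  rw [pot, integral_smul_measure]
  rfl

/-- Along the imaginary axis the effective potential on the second measure vanishes at infinity. -/
lemma Admissible.tendsto_two_mul_pot_sub (hA : Admissible a μ₁ μ₂) {u : ℕ → ℂ}
    (hre : ∀ k, (u k).re = 0) (hk : Tendsto (fun k => ‖u k‖) atTop atTop) :
    Tendsto (fun k => 2 * pot μ₂ (u k) - pot μ₁ (u k)) atTop (𝓝 0) := by
  have := hA.isProbabilityMeasure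
  have h1 := hA.logMoment₁.tendsto_pot_add_log_of_real hA.on_real hre hk
  have h2 := (hA.logMoment₂.tendsto_pot_add_log hA.unifPos hk).const_mul 2
  have e : μ₂.real Set.univ = 1 / 2 := by simp [measureReal_def, hA.mass₂]
  have h3 := h2.sub h1
  rw [mul_zero, sub_zero] at h3
  refine h3.congr fun k => ?_
  rw [e, probReal_univ]
  ring

/-- The effective potential on the second measure is nonpositive, and it vanishes where the
constraint is not active. -/
lemma IsMinimizer.two_mul_pot_le (hmin : IsMinimizer V a μ₁ μ₂) (ha : 0 < a)
    (hi : Integrable (fun z : ℂ => V z.re - a * |z.re|) μ₁)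
    (hfin : ∀ z, ∫⁻ w, posKer z w ∂μ₁ ≠ ⊤) :
    (∀ z, 2 * pot μ₂ z ≤ pot μ₁ z) ∧
      ∀ z ∈ (sigmaMeasure a - μ₂).support, 2 * pot μ₂ z = pot μ₁ z := by
  have hA := hmin.1
  have := hA.isProbabilityMeasure
  have := hA.isFiniteMeasure
  have l1 := hA.logMoment₁
  have l2 := hA.logMoment₂
  have hc := l1.continuousOn_pot hA.on_real (hfin 0)
  have h2 := fun {p q} => hmin.le_of_mem_support (p := p) (q := q) hi hc
  have hne : μ₂ ≠ 0 := by
    rintro rfl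
    have := hA.mass₂
    rw [Measure.coe_zero, Pi.zero_apply, eq_comm, ENNReal.div_eq_zero_iff] at this
    simp at this
  obtain ⟨p₀, hp₀⟩ := Measure.nonempty_support hne
  choose q hqS hq using fun k : ℕ => hA.exists_mem_support_im_gt ha k
  set G : ℂ → ℝ := fun z => 2 * pot μ₂ z - pot μ₁ z with hG
  set c : ℝ := sSup (G '' μ₂.support) with hcdef
  have hbdd : BddAbove (G '' μ₂.support) := by
    refine ⟨G (q 0), ?_⟩
    rintro _ ⟨p, hp, rfl⟩
    -- Any one slack point bounds `G` on the whole support of `μ₂`.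
    exact h2 hp (hqS 0)
  have hcp : ∀ p ∈ μ₂.support, G p ≤ c := fun p hp => le_csSup hbdd ⟨p, hp, rfl⟩
  have hcS : ∀ z ∈ (sigmaMeasure a - μ₂).support, c ≤ G z := by
    intro z hz
    refine csSup_le ⟨_, p₀, hp₀, rfl⟩ ?_
    rintro _ ⟨p, hp, rfl⟩
    exact h2 hp hz
  have hall : ∀ z, pot ((2 : ENNReal) • μ₂) z ≤ pot μ₁ z + c := by
    -- Domination on `supp μ₂`: the measure `2μ₂` vanishes off this set and has the same mass as
    -- `μ₁`.
    refine pot_le_pot_add_of_le_on (ρ₃ := μ₂) (A := μ₂.support) (l2.smul ENNReal.ofNat_ne_top)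
      (hA.unifPos.smul ENNReal.ofNat_ne_top) l1 hfin ?_ Measure.isClosed_support ?_ l2 hA.unifPos
      Measure.measure_compl_support hne ?_
    · rw [Measure.smul_apply, hA.mass₁, hA.mass₂, smul_eq_mul]
      exact ENNReal.mul_div_cancel two_ne_zero ENNReal.ofNat_ne_top
    · rw [Measure.restrict_smul, Measure.restrict_eq_zero.2 Measure.measure_compl_support,
        smul_zero]
      exact Measure.zero_le _
    · intro z hz
      have := hcp z hz
      rw [pot_smul]
      simp only [hG] at this
      simp only [ENNReal.toReal_ofNat]
      linarith
  have hall' : ∀ z, G z ≤ c := by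
    intro z
    have := hall z
    rw [pot_smul, ENNReal.toReal_ofNat] at this
    simp only [hG]
    linarith
  have hqn : Tendsto (fun k => ‖q k‖) atTop atTop :=
    tendsto_atTop_mono (fun k => ((hq k).le.trans (im_le_norm (q k)))) tendsto_natCast_atTop_atTop
  have hlim := hA.tendsto_two_mul_pot_sub
    (fun k => Admissible.support_sub_subset a μ₂ (hqS k)) hqn
  -- At slack points tending to infinity `G = c`, whereas `G → 0` there.
  have hc0 : c = 0 := le_antisymm (ge_of_tendsto' hlim fun k => hcS _ (hqS k))
    (le_of_tendsto' hlim fun k => hall' _)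
  rw [hc0] at hall' hcS
  refine ⟨fun z => ?_, fun z hz => ?_⟩
  · have := hall' z
    simp only [hG] at this
    linarith
  · have h3 := hall' z
    have h4 := hcS z hz
    simp only [hG] at h3 h4
    linarith

end Sign

section Symmetry

open scoped ComplexConjugate

lemma measurable_conj : Measurable (starRingEnd ℂ : ℂ → ℂ) := continuous_conj.measurable

lemma norm_conj_sub (z w : ℂ) : ‖conj z - w‖ = ‖z - conj w‖ := by
  rw [← Complex.norm_conj, map_sub, Complex.conj_conj]

lemma pot_map_conj (μ : Measure ℂ) (z : ℂ) : pot (μ.map (starRingEnd ℂ)) z = pot μ (conj z) := by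
  have hm : Measurable fun w => -Real.log ‖z - w‖ := (measurable_const.sub measurable_id).norm.log.neg
  rw [pot, integral_map measurable_conj.aemeasurable hm.aestronglyMeasurable, pot]
  simp only [norm_conj_sub]

lemma pot_conj (him : μ {z : ℂ | z.im ≠ 0} = 0) (z : ℂ) : pot μ (conj z) = pot μ z := by
  rw [pot, pot]
  apply integral_congr_ae
  have him' : ∀ᵐ w ∂μ, w.im = 0 := ae_iff.2 him
  filter_upwards [him'] with w hw
  rw [norm_conj_sub, Complex.conj_eq_iff_im.2 hw]

lemma LogMoment.map_conj (hμ : LogMoment μ) : LogMoment (μ.map (starRingEnd ℂ)) := by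
  have := hμ.finite
  refine ⟨inferInstance, ?_⟩
  rw [lintegral_map (by fun_prop) measurable_conj]
  simpa using hμ.moment

lemma sigmaMeasure_map_conj (a : ℝ) : (sigmaMeasure a).map (starRingEnd ℂ) = sigmaMeasure a := by
  rw [sigmaMeasure, Measure.map_smul, Measure.map_map measurable_conj (by fun_prop)]
  congr 1
  have e : (starRingEnd ℂ : ℂ → ℂ) ∘ (fun y : ℝ => (y : ℂ) * I) =
      (fun y : ℝ => (y : ℂ) * I) ∘ (fun y : ℝ => -y) := by
    ext y
    simp
  rw [e, ← Measure.map_map (by fun_prop) (by fun_prop)]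
  congr 1
  exact Measure.map_neg_eq_self volume

lemma mem_support_map_conj {z : ℂ} :
    z ∈ (μ.map (starRingEnd ℂ)).support ↔ conj z ∈ μ.support := by
  rw [Metric.nhds_basis_ball.mem_measureSupport, Metric.nhds_basis_ball.mem_measureSupport]
  refine forall₂_congr fun r _ => ?_
  rw [Measure.map_apply measurable_conj Metric.isOpen_ball.measurableSet]
  have : (starRingEnd ℂ : ℂ → ℂ) ⁻¹' Metric.ball z r = Metric.ball (conj z) r := by
    ext w
    rw [Set.mem_preimage, Metric.mem_ball, Metric.mem_ball, dist_eq_norm, dist_eq_norm,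
      norm_conj_sub]
  rw [this]

/-- The potential of the second component of the minimizer is symmetric. -/
lemma IsMinimizer.pot_conj_eq (hmin : IsMinimizer V a μ₁ μ₂) (ha : 0 < a)
    (hi : Integrable (fun z : ℂ => V z.re - a * |z.re|) μ₁)
    (hfin : ∀ z, ∫⁻ w, posKer z w ∂μ₁ ≠ ⊤) (z : ℂ) : pot μ₂ (conj z) = pot μ₂ z := by
  have hA := hmin.1
  have := hA.isFiniteMeasure
  obtain ⟨hle, heq⟩ := hmin.two_mul_pot_le ha hi hfin
  set η := sigmaMeasure a - μ₂ with hη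
  have hsum : η.map (starRingEnd ℂ) + μ₂.map (starRingEnd ℂ) = sigmaMeasure a := by
    rw [← Measure.map_add _ _ measurable_conj, hη, hA.sub_add_cancel, sigmaMeasure_map_conj]
  set η' := η.map (starRingEnd ℂ) with hη'
  set μ' := μ₂.map (starRingEnd ℂ) with hμ'
  have l' : LogMoment μ' := hA.logMoment₂.map_conj
  have hμσ : μ' ≤ sigmaMeasure a := by
    rw [← hsum]; exact Measure.le_add_left le_rfl
  have hησ : η' ≤ sigmaMeasure a := by
    rw [← hsum]; exact Measure.le_add_right le_rfl
  obtain ⟨q, hqS, -⟩ := hA.exists_mem_support_im_gt ha 0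
  have hq : conj q ∈ η'.support := by
    rw [hη', mem_support_map_conj, Complex.conj_conj]
    exact hqS
  have hkey : ∀ z, pot μ₂ z ≤ pot μ' z + 0 := by
    -- Compare `μ₂` with its reflection `μ'` on the support of the reflected slack. Off that set
    -- `μ'` equals `σ`, which dominates `μ₂`. The auxiliary measure must be finite, hence the
    -- restriction to a ball.
    refine pot_le_pot_add_of_le_on (ρ₃ := η'.restrict (Metric.ball (conj q) 1)) (A := η'.support)
      hA.logMoment₂ hA.unifPos l'
      ((unifPos_sigma a).mono hμσ).lintegral_posKer_ne_top ?_ Measure.isClosed_support ?_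
      (logMoment_restrict_ball hησ _ _)
      ((unifPos_sigma a).mono (Measure.restrict_le_self.trans hησ)) ?_ ?_ ?_
    · rw [hμ', Measure.map_apply measurable_conj MeasurableSet.univ, Set.preimage_univ]
    · calc μ₂.restrict η'.supportᶜ ≤ (sigmaMeasure a).restrict η'.supportᶜ :=
            Measure.restrict_mono subset_rfl hA.le_sigma
        _ = μ'.restrict η'.supportᶜ := by
          rw [← hsum, Measure.restrict_add,
            Measure.restrict_eq_zero.2 Measure.measure_compl_support, zero_add]
        _ ≤ _ := le_rfl
    · exact le_antisymm ((Measure.restrict_le_self _).trans Measure.measure_compl_support.le)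
        zero_le
    · rw [Ne, Measure.restrict_eq_zero]
      exact ((Measure.mem_support_iff_forall _).1 hq _ (Metric.ball_mem_nhds _ one_pos)).ne'
    -- On the reflected support, `2 U^{μ₂}(z) ≤ U^{μ₁}(z) = U^{μ₁}(conj z) = 2 U^{μ₂}(conj z)`, and
    -- the last value is twice the potential of `μ'` at `z`.
    · intro z hz
      rw [hη', mem_support_map_conj] at hz
      have h1 := heq _ hz
      have h2 := hle z
      rw [pot_conj hA.on_real] at h1
      rw [hμ', pot_map_conj]
      linarith
  have h1 := hkey z
  have h2 := hkey (conj z)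
  rw [hμ', pot_map_conj] at h1 h2
  rw [Complex.conj_conj] at h2
  linarith

/-- The region where the constraint is active is symmetric. -/
lemma IsMinimizer.conj_notMem_support (hmin : IsMinimizer V a μ₁ μ₂) (ha : 0 < a)
    (hi : Integrable (fun z : ℂ => V z.re - a * |z.re|) μ₁)
    (hfin : ∀ z, ∫⁻ w, posKer z w ∂μ₁ ≠ ⊤) {q : ℂ}
    (hq : q ∉ (sigmaMeasure a - μ₂).support) : conj q ∉ (sigmaMeasure a - μ₂).support := by
  have hA := hmin.1
  have := hA.isFiniteMeasure
  set η := sigmaMeasure a - μ₂ with hη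
  have hsum : η.map (starRingEnd ℂ) + μ₂.map (starRingEnd ℂ) = sigmaMeasure a := by
    rw [← Measure.map_add _ _ measurable_conj, hη, hA.sub_add_cancel, sigmaMeasure_map_conj]
  rw [← mem_support_map_conj]
  set η' := η.map (starRingEnd ℂ) with hη'
  set μ' := μ₂.map (starRingEnd ℂ) with hμ'
  have l' : LogMoment μ' := hA.logMoment₂.map_conj
  obtain ⟨r, hr, hr0⟩ := Metric.nhds_basis_ball.notMem_measureSupport.1 hq
  -- Integrating `f` gives the difference of the circle means of the potential at radii `r / 2` and
  -- `r`. Since `f` is positive on the ball and zero outside, equal potentials yield information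
  -- about local mass.
  set f : ℂ → ℝ := fun w => (Real.log r + log⁺ (r⁻¹ * ‖q - w‖))
    - (Real.log (r / 2) + log⁺ ((r / 2)⁻¹ * ‖q - w‖)) with hf
  have hfm : Continuous f := by
    have := continuous_posLog
    fun_prop
  have hpair : ∀ w, q ≠ w → f w = log⁺ (r⁻¹ * ‖q - w‖)⁻¹ - log⁺ ((r / 2)⁻¹ * ‖q - w‖)⁻¹ := by
    intro w hw
    rw [← log_add_posLog_sub_log hw hr, ← log_add_posLog_sub_log hw (half_pos hr)]
    simp only [hf]
    ring
  have hpos : ∀ w ∈ Metric.ball q r, 0 < f w := by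
    intro w hw
    rw [Metric.mem_ball, dist_comm, dist_eq_norm] at hw
    have h1 : log⁺ (r⁻¹ * ‖q - w‖) = 0 := by
      rw [posLog_eq_zero_iff, abs_of_nonneg (by positivity), inv_mul_eq_div, div_le_one hr]
      exact hw.le
    have h2 : log⁺ ((r / 2)⁻¹ * ‖q - w‖) < Real.log 2 := by
      rw [posLog_apply, max_lt_iff]
      refine ⟨Real.log_pos one_lt_two, ?_⟩
      rcases (norm_nonneg (q - w)).eq_or_lt with h | h
      · rw [← h]; simpa using Real.log_pos one_lt_two
      · apply Real.log_lt_log (by positivity)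
        rw [inv_mul_eq_div, div_lt_iff₀ (half_pos hr)]
        linarith
    simp only [hf]
    rw [h1, Real.log_div hr.ne' two_ne_zero]
    linarith
  have hzero : ∀ w ∉ Metric.ball q r, f w = 0 := by
    intro w hw
    rw [Metric.mem_ball, dist_comm, dist_eq_norm, not_lt] at hw
    rw [hpair w (by rintro rfl; simp at hw; linarith), posLog_inv_eq_zero hr hw,
      posLog_inv_eq_zero (half_pos hr) (by linarith), sub_zero]
  have hnn : ∀ w, 0 ≤ f w := by
    intro w
    by_cases hw : w ∈ Metric.ball q r
    · exact (hpos w hw).le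
    · exact (hzero w hw).ge
  have hball : f.support ⊆ Metric.ball q r := fun w hw => by
    by_contra h; exact hw (hzero w h)
  have hfi : Integrable f (sigmaMeasure a) := by
    rw [← integrableOn_iff_integrable_of_support_subset hball]
    obtain ⟨C, hC⟩ := (isCompact_closedBall q r).exists_bound_of_continuousOn hfm.continuousOn
    refine Measure.integrableOn_of_bounded (M := C) (sigmaMeasure_ball_lt_top a q r).ne
      hfm.aestronglyMeasurable ?_
    filter_upwards [ae_restrict_mem Metric.isOpen_ball.measurableSet] with w hw
    exact hC w (Metric.ball_subset_closedBall hw)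
  have hη0 : ∫ w, f w ∂η = 0 := by
    rw [← setIntegral_eq_integral_of_forall_compl_eq_zero hzero,
      Measure.restrict_eq_zero.2 hr0, integral_zero_measure]
  have hcirc : ∀ {ρ : Measure ℂ}, LogMoment ρ → ∫ w, f w ∂ρ =
      circleAverage (pot ρ) q (r / 2) - circleAverage (pot ρ) q r := by
    intro ρ hρ
    rw [hρ.circleAverage_pot q hr, hρ.circleAverage_pot q (half_pos hr),
      integral_sub (hρ.integrable_log_add_posLog q hr)
        (hρ.integrable_log_add_posLog q (half_pos hr))]
    ring
  have hpp : pot μ' = pot μ₂ := by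
    ext z
    rw [hμ', pot_map_conj, hmin.pot_conj_eq ha hi hfin]
  have hee : ∫ w, f w ∂μ' = ∫ w, f w ∂μ₂ := by
    rw [hcirc l', hcirc hA.logMoment₂, hpp]
  have i1 : Integrable f η := hfi.mono_measure Measure.sub_le
  have i2 : Integrable f μ₂ := hfi.mono_measure hA.le_sigma
  have i3 : Integrable f η' := hfi.mono_measure (by
    rw [← hsum]; exact Measure.le_add_right le_rfl)
  have i4 : Integrable f μ' := hfi.mono_measure (by
    rw [← hsum]; exact Measure.le_add_left le_rfl)
  have e1 : ∫ w, f w ∂sigmaMeasure a = ∫ w, f w ∂η + ∫ w, f w ∂μ₂ := by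
    rw [← integral_add_measure i1 i2, hη, hA.sub_add_cancel]
  have e2 : ∫ w, f w ∂sigmaMeasure a = ∫ w, f w ∂η' + ∫ w, f w ∂μ' := by
    rw [← integral_add_measure i3 i4, hsum]
  -- Both decompositions of `σ` have the same total and, by equality of potentials, the same
  -- `μ₂`-part. Their slack parts therefore agree.
  have h0 : ∫ w, f w ∂η' = 0 := by linarith
  have hae := (integral_eq_zero_iff_of_nonneg hnn i3).1 h0
  refine Metric.nhds_basis_ball.notMem_measureSupport.2 ⟨r, hr, ?_⟩
  refine measure_mono_null (fun w hw => ?_) (ae_iff.1 hae)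
  exact (hpos w hw).ne'

end Symmetry

end ExternalSource

/-! ### Strict inequality by concavity in the squared coordinate. -/

namespace ExternalSource

open Filter Topology

variable {μ ν μ₁ μ₂ : Measure ℂ} {V : ℝ → ℝ} {a : ℝ}

section LogSquare

lemma log_norm_sq_add {y : ℝ} {w : ℂ} (h1 : (y : ℂ) * I ≠ w) (h2 : -((y : ℂ) * I) ≠ w) :
    Real.log ‖w ^ 2 + ((y ^ 2 : ℝ) : ℂ)‖ =
      Real.log ‖(y : ℂ) * I - w‖ + Real.log ‖-((y : ℂ) * I) - w‖ := by
  rw [← Real.log_mul (norm_ne_zero_iff.2 (sub_ne_zero.2 h1))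
    (norm_ne_zero_iff.2 (sub_ne_zero.2 h2)), ← norm_mul]
  congr 2
  push_cast
  linear_combination (y : ℂ) ^ 2 * I_sq

lemma LogMoment.integrable_log_sq (hμ : LogMoment μ) (hfin : ∀ z, ∫⁻ w, posKer z w ∂μ ≠ ⊤)
    (y : ℝ) : Integrable (fun w => Real.log ‖w ^ 2 + ((y ^ 2 : ℝ) : ℂ)‖) μ := by
  refine ((hμ.integrable_log (hfin (y * I))).add (hμ.integrable_log (hfin (-(y * I))))).congr ?_
  filter_upwards [ae_ne_of_lintegral_posKer (hfin (y * I)),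
    ae_ne_of_lintegral_posKer (hfin (-(y * I)))] with w h1 h2
  exact (log_norm_sq_add h1 h2).symm

/-- Factor `w² + y² = (w - iy)(w + iy)`: the symmetrised potential depends on `y²` only, which is
the variable in which concavity is used. -/
lemma LogMoment.pot_add_pot_neg (hμ : LogMoment μ) (hfin : ∀ z, ∫⁻ w, posKer z w ∂μ ≠ ⊤)
    (y : ℝ) : pot μ (y * I) + pot μ (-(y * I)) =
      -∫ w, Real.log ‖w ^ 2 + ((y ^ 2 : ℝ) : ℂ)‖ ∂μ := by
  rw [pot, pot, integral_neg, integral_neg, ← neg_add,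
    ← integral_add (hμ.integrable_log (hfin (y * I))) (hμ.integrable_log (hfin (-(y * I))))]
  congr 1
  apply integral_congr_ae
  filter_upwards [ae_ne_of_lintegral_posKer (hfin (y * I)),
    ae_ne_of_lintegral_posKer (hfin (-(y * I)))] with w h1 h2
  exact (log_norm_sq_add h1 h2).symm

lemma log_sq_sub_eq (y : ℝ) : (fun s : ℝ => Real.log (y ^ 2 - s ^ 2)) =ᵐ[volume]
    fun s => Real.log (y - s) + Real.log (y + s) := by
  filter_upwards [measure_eq_zero_iff_ae_notMem.1 (Real.volume_singleton (a := y)),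
    measure_eq_zero_iff_ae_notMem.1 (Real.volume_singleton (a := -y))] with s h1 h2
  simp only [Set.mem_singleton_iff] at h1 h2
  rw [← Real.log_mul (sub_ne_zero.2 (Ne.symm h1)) (fun h => h2 (by linarith))]
  congr 1
  ring

lemma intervalIntegrable_log_sq_sub (y R : ℝ) :
    IntervalIntegrable (fun s : ℝ => Real.log (y ^ 2 - s ^ 2)) volume (-R) R := by
  have h1 : IntervalIntegrable (fun s : ℝ => Real.log (y - s)) volume (-R) R := by
    have := (intervalIntegral.intervalIntegrable_log' (a := y + R) (b := y - R)).comp_sub_left y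
    simpa using this
  have h2 : IntervalIntegrable (fun s : ℝ => Real.log (y + s)) volume (-R) R := by
    have := (intervalIntegral.intervalIntegrable_log' (a := y - R) (b := y + R)).comp_add_left y
    simpa using this
  exact (h1.add h2).congr_ae (ae_restrict_of_ae (log_sq_sub_eq y).symm)

/-- No order between `y` and `R` is needed, since `Real.log` is even. -/
lemma integral_log_sq_sub (y R : ℝ) : ∫ s in (-R)..R, Real.log (y ^ 2 - s ^ 2) =
    2 * ((R + y) * Real.log (R + y) + (R - y) * Real.log (R - y) - 2 * R) := by
  have h1 : IntervalIntegrable (fun s : ℝ => Real.log (y - s)) volume (-R) R := by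
    have := (intervalIntegral.intervalIntegrable_log' (a := y + R) (b := y - R)).comp_sub_left y
    simpa using this
  have h2 : IntervalIntegrable (fun s : ℝ => Real.log (y + s)) volume (-R) R := by
    have := (intervalIntegral.intervalIntegrable_log' (a := y - R) (b := y + R)).comp_add_left y
    simpa using this
  rw [intervalIntegral.integral_congr_ae ((log_sq_sub_eq y).mono fun s hs _ => hs),
    intervalIntegral.integral_add h1 h2, intervalIntegral.integral_comp_sub_left Real.log,
    intervalIntegral.integral_comp_add_left Real.log, integral_log, integral_log,
    show y - R = -(R - y) by ring, show y - -R = R + y by ring, show y + -R = -(R - y) by ring,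
    show y + R = R + y by ring, Real.log_neg_eq_log]
  ring

/-- Since `1 - 1/x ≤ log x ≤ x - 1`, the quantity lies between `0` and `2y²/n`. Up to a divergent
term independent of `y`, the integral of `log |y² - s²|` over `[-n, n]` thus has a limit independent
of `y`. -/
lemma tendsto_log_entropy {y : ℝ} (hy : 0 ≤ y) :
    Tendsto (fun n : ℕ => ((n : ℝ) + y) * Real.log (n + y) + (n - y) * Real.log (n - y)
      - 2 * n * Real.log n) atTop (𝓝 0) := by
  have hlim : Tendsto (fun n : ℕ => 2 * y ^ 2 / (n : ℝ)) atTop (𝓝 0) :=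
    tendsto_const_div_atTop_nhds_zero_nat _
  refine tendsto_of_tendsto_of_tendsto_of_le_of_le' tendsto_const_nhds hlim ?_ ?_
  all_goals
    obtain ⟨N, hN⟩ := exists_nat_gt y
    filter_upwards [eventually_ge_atTop N] with n hn
    have hny : y < n := hN.trans_le (by exact_mod_cast hn)
    have hn0 : (0 : ℝ) < n := lt_of_le_of_lt hy hny
    have h1 : (0 : ℝ) < n + y := by linarith
    have h2 : (0 : ℝ) < n - y := by linarith
    have e1 : Real.log (n + y) = Real.log n + Real.log ((n + y) / n) := by
      rw [Real.log_div h1.ne' hn0.ne']; ring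
    have e2 : Real.log (n - y) = Real.log n + Real.log ((n - y) / n) := by
      rw [Real.log_div h2.ne' hn0.ne']; ring
    have e : ((n : ℝ) + y) * Real.log (n + y) + (n - y) * Real.log (n - y) - 2 * n * Real.log n =
        (n + y) * Real.log ((n + y) / n) + (n - y) * Real.log ((n - y) / n) := by
      rw [e1, e2]; ring
    rw [e]
  · have b1 := mul_le_mul_of_nonneg_left
      (Real.one_sub_inv_le_log_of_pos (div_pos h1 hn0)) h1.le
    have b2 := mul_le_mul_of_nonneg_left
      (Real.one_sub_inv_le_log_of_pos (div_pos h2 hn0)) h2.le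
    have c1 : ((n : ℝ) + y) * (1 - ((n + y) / n)⁻¹) = y := by field_simp; ring
    have c2 : ((n : ℝ) - y) * (1 - ((n - y) / n)⁻¹) = -y := by field_simp; ring
    linarith
  · have b1 := mul_le_mul_of_nonneg_left (Real.log_le_sub_one_of_pos (div_pos h1 hn0)) h1.le
    have b2 := mul_le_mul_of_nonneg_left (Real.log_le_sub_one_of_pos (div_pos h2 hn0)) h2.le
    have c : ((n : ℝ) + y) * ((n + y) / n - 1) + (n - y) * ((n - y) / n - 1) = 2 * y ^ 2 / n := by
      field_simp; ring
    linarith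

lemma norm_mul_I_sq_add (s t : ℝ) : Real.log ‖((s : ℂ) * I) ^ 2 + (t : ℂ)‖ = Real.log (t - s ^ 2) := by
  have : ((s : ℂ) * I) ^ 2 + (t : ℂ) = ((t - s ^ 2 : ℝ) : ℂ) := by
    push_cast
    linear_combination (s : ℂ) ^ 2 * I_sq
  rw [this, Complex.norm_real, Real.norm_eq_abs, Real.log_abs]

lemma measurableSet_strip (R : ℝ) : MeasurableSet {w : ℂ | w.im ∈ Set.Ioc (-R) R} :=
  measurable_im measurableSet_Ioc

lemma measurable_log_sq (y : ℝ) : Measurable fun w : ℂ => Real.log ‖w ^ 2 + ((y ^ 2 : ℝ) : ℂ)‖ :=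
  ((measurable_id.pow_const 2).add measurable_const).norm.log

lemma sigmaMeasure_restrict_strip (a R : ℝ) :
    (sigmaMeasure a).restrict {w : ℂ | w.im ∈ Set.Ioc (-R) R} =
      ENNReal.ofReal (a / Real.pi) •
        (volume.restrict (Set.Ioc (-R) R)).map (fun y : ℝ => (y : ℂ) * I) := by
  rw [sigmaMeasure, Measure.restrict_smul, Measure.restrict_map (by fun_prop)
    (measurableSet_strip R)]
  congr 3
  ext y
  simp

lemma integrableOn_sigma_log_sq (a y : ℝ) {R : ℝ} (hR : 0 ≤ R) :
    IntegrableOn (fun w : ℂ => Real.log ‖w ^ 2 + ((y ^ 2 : ℝ) : ℂ)‖)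
      {w : ℂ | w.im ∈ Set.Ioc (-R) R} (sigmaMeasure a) := by
  rw [IntegrableOn, sigmaMeasure_restrict_strip]
  refine Integrable.smul_measure ?_ ENNReal.ofReal_ne_top
  rw [integrable_map_measure (measurable_log_sq y).aestronglyMeasurable (by fun_prop)]
  have h := (intervalIntegrable_iff_integrableOn_Ioc_of_le (by linarith : -R ≤ R)).1
    (intervalIntegrable_log_sq_sub y R)
  refine h.congr (ae_of_all _ fun s => ?_)
  exact (norm_mul_I_sq_add s (y ^ 2)).symm

lemma setIntegral_sigma_log_sq {a : ℝ} (ha : 0 < a) (y : ℝ) {R : ℝ} (hR : 0 ≤ R) :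
    ∫ w in {w : ℂ | w.im ∈ Set.Ioc (-R) R}, Real.log ‖w ^ 2 + ((y ^ 2 : ℝ) : ℂ)‖ ∂sigmaMeasure a =
      a / Real.pi * (2 * ((R + y) * Real.log (R + y) + (R - y) * Real.log (R - y) - 2 * R)) := by
  rw [sigmaMeasure_restrict_strip, integral_smul_measure,
    integral_map (by fun_prop) (measurable_log_sq y).aestronglyMeasurable,
    ENNReal.toReal_ofReal (div_pos ha Real.pi_pos).le, smul_eq_mul, ← integral_log_sq_sub,
    intervalIntegral.integral_of_le (by linarith : -R ≤ R)]
  simp only [norm_mul_I_sq_add]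

end LogSquare

section Strict

lemma log_add_log_le_two_mul_log {x y z : ℝ} (hx : x ≠ 0) (hy : y ≠ 0)
    (h : |x| * |y| ≤ z ^ 2) : Real.log x + Real.log y ≤ 2 * Real.log z := by
  have hx' := abs_pos.2 hx
  have hy' := abs_pos.2 hy
  rw [← Real.log_abs x, ← Real.log_abs y, ← Real.log_mul hx'.ne' hy'.ne',
    show 2 * Real.log z = Real.log (z ^ 2) by rw [Real.log_pow]; norm_num]
  exact Real.log_le_log (by positivity) h

/-- If the effective potential vanished at a point where the constraint is active, concavity in
the square of the coordinate would force it to be positive further out. -/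
lemma IsMinimizer.two_mul_pot_lt_of_nonneg (hmin : IsMinimizer V a μ₁ μ₂) (ha : 0 < a)
    (hi : Integrable (fun z : ℂ => V z.re - a * |z.re|) μ₁)
    (hfin : ∀ z, ∫⁻ w, posKer z w ∂μ₁ ≠ ⊤) {y : ℝ} (hy : 0 ≤ y)
    (hyS : (y : ℂ) * I ∉ (sigmaMeasure a - μ₂).support) :
    2 * pot μ₂ (y * I) < pot μ₁ (y * I) := by
  have hA := hmin.1
  have := hA.isProbabilityMeasure
  have := hA.isFiniteMeasure
  obtain ⟨hle, heq⟩ := hmin.two_mul_pot_le ha hi hfin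
  refine lt_of_le_of_ne (hle _) fun h0 => ?_
  have hsymm : ∀ w, w ∉ (sigmaMeasure a - μ₂).support →
      starRingEnd ℂ w ∉ (sigmaMeasure a - μ₂).support :=
    fun w => hmin.conj_notMem_support ha hi hfin
  set η := sigmaMeasure a - μ₂ with hη
  have hησ : η ≤ sigmaMeasure a := Measure.sub_le
  -- the next point at which the constraint is not active
  set T : Set ℝ := {s | y ≤ s ∧ (s : ℂ) * I ∈ η.support} with hT
  have hTc : IsClosed T := isClosed_Ici.inter
    (Measure.isClosed_support.preimage (by fun_prop : Continuous fun s : ℝ => (s : ℂ) * I))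
  have hTn : T.Nonempty := by
    obtain ⟨z, hz, hzy⟩ := hA.exists_mem_support_im_gt ha y
    have hre : z.re = 0 := Admissible.support_sub_subset a μ₂ hz
    refine ⟨z.im, hzy.le, ?_⟩
    convert hz using 1
    apply Complex.ext <;> simp [hre]
  have hTb : BddBelow T := ⟨y, fun s hs => hs.1⟩
  obtain ⟨hyb, hbS⟩ := hTc.csInf_mem hTn hTb
  set b := sInf T with hb
  have hyb' : y < b := lt_of_le_of_ne hyb fun h => hyS (h ▸ hbS)
  -- By symmetry the slack has no support point at height `|s|` in `[y, b)`, on either half-axis.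
  have hgap : ∀ s : ℝ, (s : ℂ) * I ∈ η.support → |s| < y ∨ b ≤ |s| := by
    intro s hs
    by_contra! hcon
    have hs' : ((|s| : ℝ) : ℂ) * I ∈ η.support := by
      rcases abs_cases s with ⟨h, -⟩ | ⟨h, -⟩
      · rwa [h]
      · by_contra hns
        refine hsymm _ hns ?_
        rw [h]
        simpa using hs
    exact absurd (csInf_le hTb ⟨hcon.1, hs'⟩) (not_le.2 hcon.2)
  -- The midpoint of `y` and `b` in the squared coordinate.
  set c := Real.sqrt ((y ^ 2 + b ^ 2) / 2) with hc
  have hc0 : 0 ≤ c := Real.sqrt_nonneg _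
  have hcsq : c ^ 2 = (y ^ 2 + b ^ 2) / 2 := Real.sq_sqrt (by positivity)
  have hyb2 : y ^ 2 < b ^ 2 := by nlinarith
  have l1 := hA.logMoment₁
  have l2 := hA.logMoment₂
  have f2 := hA.unifPos.lintegral_posKer_ne_top
  set ℓ : ℝ → ℂ → ℝ := fun t w => Real.log ‖w ^ 2 + ((t ^ 2 : ℝ) : ℂ)‖ with hℓ
  have hconj : ∀ s : ℝ, starRingEnd ℂ ((s : ℂ) * I) = -((s : ℂ) * I) := by
    intro s; simp
  have e1 : ∀ s : ℝ, 2 * pot μ₁ (s * I) = -∫ w, ℓ s w ∂μ₁ := by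
    intro s
    rw [← l1.pot_add_pot_neg hfin s, ← hconj, pot_conj hA.on_real]
    ring
  have e2 : ∀ s : ℝ, 2 * pot μ₂ (s * I) = -∫ w, ℓ s w ∂μ₂ := by
    intro s
    rw [← l2.pot_add_pot_neg f2 s, ← hconj, hmin.pot_conj_eq ha hi hfin]
    ring
  have i1 : ∀ s, Integrable (ℓ s) μ₁ := fun s => l1.integrable_log_sq hfin s
  have i2 : ∀ s, Integrable (ℓ s) μ₂ := fun s => l2.integrable_log_sq f2 s
  set D : ℂ → ℝ := fun w => ℓ y w + ℓ b w - 2 * ℓ c w with hD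
  have hDint : ∀ {ρ : Measure ℂ}, (∀ s, Integrable (ℓ s) ρ) → Integrable D ρ ∧
      ∫ w, D w ∂ρ = ∫ w, ℓ y w ∂ρ + ∫ w, ℓ b w ∂ρ - 2 * ∫ w, ℓ c w ∂ρ := by
    intro ρ hρ
    refine ⟨((hρ y).add (hρ b)).sub ((hρ c).const_mul 2), ?_⟩
    rw [hD, integral_sub (f := fun w => ℓ y w + ℓ b w) ((hρ y).add (hρ b)) ((hρ c).const_mul 2),
      integral_add (hρ y) (hρ b), integral_const_mul]
  -- strict concavity for the first measure
  have hD1 : ∫ w, D w ∂μ₁ < 0 := by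
    have him : ∀ᵐ w ∂μ₁, w.im = 0 := ae_iff.2 hA.on_real
    have hneg : ∀ᵐ w ∂μ₁, D w < 0 := by
      filter_upwards [him, ae_ne_of_lintegral_posKer (hfin 0)] with w hw hw0
      obtain ⟨x, rfl⟩ : ∃ x : ℝ, w = x := ⟨w.re, by apply Complex.ext <;> simp [hw]⟩
      have hx : x ≠ 0 := by rintro rfl; simp at hw0
      have hx2 : 0 < x ^ 2 := by positivity
      have hℓx : ∀ s : ℝ, ℓ s x = Real.log (x ^ 2 + s ^ 2) := by
        intro s
        simp only [hℓ]
        rw [← Complex.ofReal_pow, ← Complex.ofReal_add, Complex.norm_real, Real.norm_eq_abs,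
          Real.log_abs]
      simp only [hD, hℓx]
      have h3 : Real.log ((x ^ 2 + y ^ 2) * (x ^ 2 + b ^ 2)) < Real.log ((x ^ 2 + c ^ 2) ^ 2) := by
        apply Real.log_lt_log (by positivity)
        rw [hcsq]
        nlinarith [sq_pos_of_pos (sub_pos.2 hyb2)]
      rw [Real.log_mul (by positivity) (by positivity), Real.log_pow] at h3
      push_cast at h3
      linarith
    have hpos := (integral_pos_iff_support_of_nonneg_ae (f := fun w => -D w)
      (hneg.mono fun w hw => by simpa using hw.le) (hDint i1).1.neg).2 ?_
    · rw [integral_neg] at hpos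
      linarith
    · have : (Function.support fun w => -D w) =ᵐ[μ₁] Set.univ := by
        filter_upwards [hneg] with w hw
        exact propext ⟨fun _ => trivial, fun _ => (neg_pos.2 hw).ne'⟩
      rw [measure_congr this]
      simp
  -- concavity for the second measure
  have hD2 : 0 ≤ ∫ w, D w ∂μ₂ := by
    set K : ℕ → Set ℂ := fun n => {w : ℂ | w.im ∈ Set.Ioc (-(n : ℝ)) n} with hK
    have hKm : ∀ n, MeasurableSet (K n) := fun n => measurableSet_strip _
    have hmono : Monotone K := by
      intro m n hmn w hw
      have : (m : ℝ) ≤ n := by exact_mod_cast hmn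
      exact ⟨by linarith [hw.1], by linarith [hw.2]⟩
    have hUn : ⋃ n, K n = Set.univ := by
      rw [Set.eq_univ_iff_forall]
      intro w
      obtain ⟨n, hn⟩ := exists_nat_gt |w.im|
      rw [abs_lt] at hn
      exact Set.mem_iUnion.2 ⟨n, hn.1, hn.2.le⟩
    have hlim := tendsto_setIntegral_of_monotone hKm hmono (f := D) (μ := μ₂)
      (hDint i2).1.integrableOn
    rw [hUn, Measure.restrict_univ] at hlim
    -- The divergent terms do not depend on the evaluation point, so they cancel in the second
    -- difference.
    have hs0 : Tendsto (fun n => ∫ w in K n, D w ∂sigmaMeasure a) atTop (𝓝 0) := by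
      have h := ((tendsto_log_entropy hy).add (tendsto_log_entropy (hy.trans hyb))).sub
        ((tendsto_log_entropy hc0).const_mul 2) |>.const_mul (a / Real.pi * 2)
      simp only [add_zero, mul_zero, sub_zero] at h
      refine h.congr fun n => ?_
      rw [(hDint fun s => integrableOn_sigma_log_sq a s n.cast_nonneg).2,
        setIntegral_sigma_log_sq ha _ n.cast_nonneg, setIntegral_sigma_log_sq ha _ n.cast_nonneg,
        setIntegral_sigma_log_sq ha _ n.cast_nonneg]
      ring
    refine le_of_tendsto_of_tendsto' hs0 hlim fun n => ?_
    have hσi : ∀ s, IntegrableOn (ℓ s) (K n) (sigmaMeasure a) :=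
      fun s => integrableOn_sigma_log_sq a s n.cast_nonneg
    have hDσ := (hDint hσi).1
    have hDη : IntegrableOn D (K n) η := hDσ.mono_measure (Measure.restrict_mono subset_rfl hησ)
    have hDμ : IntegrableOn D (K n) μ₂ := (hDint i2).1.integrableOn
    have hsum : ∫ w in K n, D w ∂sigmaMeasure a = ∫ w in K n, D w ∂η + ∫ w in K n, D w ∂μ₂ := by
      rw [← integral_add_measure hDη hDμ, ← Measure.restrict_add, hη, hA.sub_add_cancel]
    -- On the slack support `y² - s²` and `b² - s²` have the same sign almost everywhere, so the
    -- arithmetic-geometric mean inequality applies. The almost-everywhere exclusions avoid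
    -- `Real.log 0 = 0`.
    have hηneg : ∫ w in K n, D w ∂η ≤ 0 := by
      refine integral_nonpos_of_ae (ae_restrict_of_ae ?_)
      have fη := ((unifPos_sigma a).mono hησ).lintegral_posKer_ne_top
      filter_upwards [Measure.support_mem_ae (μ := η), ae_ne_of_lintegral_posKer (fη (y * I)),
        ae_ne_of_lintegral_posKer (fη (-(y * I))), ae_ne_of_lintegral_posKer (fη (b * I)),
        ae_ne_of_lintegral_posKer (fη (-(b * I)))] with w hw n1 n2 n3 n4
      have hre : w.re = 0 := Admissible.support_sub_subset a μ₂ hw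
      obtain ⟨s, rfl⟩ : ∃ s : ℝ, w = s * I := ⟨w.im, by apply Complex.ext <;> simp [hre]⟩
      have hℓs : ∀ t : ℝ, ℓ t (s * I) = Real.log (t ^ 2 - s ^ 2) := fun t =>
        norm_mul_I_sq_add s (t ^ 2)
      have hne : ∀ t : ℝ, (t : ℂ) * I ≠ s * I → -((t : ℂ) * I) ≠ s * I → t ^ 2 - s ^ 2 ≠ 0 := by
        intro t ht ht' h
        rcases sq_eq_sq_iff_eq_or_eq_neg.1 (sub_eq_zero.1 h) with h | h
        · exact ht (by rw [h])
        · exact ht' (by rw [h]; push_cast; ring)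
      have hy0 := hne y n1 n2
      have hb0 := hne b n3 n4
      have hlog := log_add_log_le_two_mul_log (z := c ^ 2 - s ^ 2) hy0 hb0 ?_
      · simp only [hD, hℓs, Pi.zero_apply]
        linarith
      · have hprod : 0 < (y ^ 2 - s ^ 2) * (b ^ 2 - s ^ 2) := by
          rcases hgap s hw with h | h
          · have : s ^ 2 < y ^ 2 := by
              rw [← sq_abs s]
              nlinarith [abs_nonneg s]
            exact mul_pos (by linarith) (by linarith)
          · have h5 : b ^ 2 ≤ s ^ 2 := by
              rw [← sq_abs s]
              nlinarith [abs_nonneg s]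
            have h6 : b ^ 2 - s ^ 2 < 0 := lt_of_le_of_ne (by linarith) hb0
            exact mul_pos_of_neg_of_neg (by linarith) h6
        rw [← abs_mul, abs_of_pos hprod, hcsq]
        nlinarith [sq_nonneg (b ^ 2 - y ^ 2)]
    linarith
  -- Here `2 (G(iy) + G(ib) - 2 G(ic)) = ∫ D dμ₁ - 2 ∫ D dμ₂ < 0`. As `G(iy) = G(ib) = 0`, this
  -- contradicts `G(ic) ≤ 0`.
  have hb := heq _ hbS
  have hcle := hle (c * I)
  have k1 := (hDint i1).2
  have k2 := (hDint i2).2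
  have a1 := e1 y
  have a2 := e1 b
  have a3 := e1 c
  have a4 := e2 y
  have a5 := e2 b
  have a6 := e2 c
  linarith

lemma IsMinimizer.two_mul_pot_lt (hmin : IsMinimizer V a μ₁ μ₂) (ha : 0 < a)
    (hi : Integrable (fun z : ℂ => V z.re - a * |z.re|) μ₁)
    (hfin : ∀ z, ∫⁻ w, posKer z w ∂μ₁ ≠ ⊤) {z : ℂ} (hre : z.re = 0)
    (hz : z ∉ (sigmaMeasure a - μ₂).support) : 2 * pot μ₂ z < pot μ₁ z := by
  have e : z = (z.im : ℂ) * I := by apply Complex.ext <;> simp [hre]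
  rcases le_total 0 z.im with h | h
  · rw [e] at hz ⊢
    exact hmin.two_mul_pot_lt_of_nonneg ha hi hfin h hz
  · have e' : starRingEnd ℂ z = ((-z.im : ℝ) : ℂ) * I := by apply Complex.ext <;> simp [hre]
    have hz' := hmin.conj_notMem_support ha hi hfin hz
    rw [e'] at hz'
    have := hmin.two_mul_pot_lt_of_nonneg ha hi hfin (by linarith) hz'
    rwa [← e', hmin.pot_conj_eq ha hi hfin, pot_conj hmin.1.on_real] at this

end Strict

end ExternalSource

/-! ### Assembly in the extended reals. -/

namespace ExternalSource

lemma two_mul_coe (x : ℝ) : (2 : EReal) * (x : EReal) = ((2 * x : ℝ) : EReal) := by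
  rw [EReal.coe_mul]; rfl

end ExternalSource

theorem mainTheorem3 (d : ℕ) (hd : 1 ≤ d) (v : ℕ → ℝ) (hv : 0 < v d) (a : ℝ) (ha : 0 < a)
    (μ₁ μ₂ : Measure ℂ)
    (hmin : ExternalSource.IsMinimizer (ExternalSource.evenPoly d v) a μ₁ μ₂) :
    -- the two potentials are finite at every point of the real and imaginary axes
    (∀ z : ℂ, z.im = 0 ∨ z.re = 0 →
      (ExternalSource.logPotential μ₁ z ≠ ⊥ ∧ ExternalSource.logPotential μ₁ z ≠ ⊤) ∧
      (ExternalSource.logPotential μ₂ z ≠ ⊥ ∧ ExternalSource.logPotential μ₂ z ≠ ⊤)) ∧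
    (∃ l : ℝ,
      (∀ x : ℝ, (x : ℂ) ∈ μ₁.support →
        2 * ExternalSource.logPotential μ₁ (x : ℂ) =
          ExternalSource.logPotential μ₂ (x : ℂ) - ((ExternalSource.evenPoly d v x : ℝ) : EReal)
            + ((a * |x| : ℝ) : EReal) - (l : EReal)) ∧
      (∀ x : ℝ, (x : ℂ) ∉ μ₁.support →
        2 * ExternalSource.logPotential μ₁ (x : ℂ) ≥
          ExternalSource.logPotential μ₂ (x : ℂ) - ((ExternalSource.evenPoly d v x : ℝ) : EReal)
            + ((a * |x| : ℝ) : EReal) - (l : EReal))) ∧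
    (∀ z : ℂ, z ∈ (ExternalSource.sigmaMeasure a - μ₂).support →
      2 * ExternalSource.logPotential μ₂ z = ExternalSource.logPotential μ₁ z) ∧
    (∀ z : ℂ, z.re = 0 → z ∉ (ExternalSource.sigmaMeasure a - μ₂).support →
      2 * ExternalSource.logPotential μ₂ z < ExternalSource.logPotential μ₁ z) := by
  have hV := ExternalSource.continuous_evenPoly d v
  obtain ⟨B, hB⟩ := ExternalSource.exists_le_evenPoly_sub hd hv a
  have hi := hmin.integrable_field hV hB
  have hfin := hmin.lintegral_posKer_ne_top hV hB
  have hA := hmin.1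
  have h₁ (z : ℂ) := hA.logMoment₁.logPotential_eq (hfin z)
  have h₂ (z : ℂ) := hA.logMoment₂.logPotential_eq (hA.unifPos.lintegral_posKer_ne_top z)
  have hμ₂ := hmin.two_mul_pot_le ha hi hfin
  simp only [h₁, h₂, ExternalSource.two_mul_coe]
  norm_cast
  simp only [EReal.coe_ne_bot, EReal.coe_ne_top, not_false_eq_true, and_self,
    implies_true, true_and]
  have hle (x : ℝ) := hmin.le_field_add_pot hV hB (hfin (x : ℂ))
  -- The constant `l` is `-L`, with `L` the Euler-Lagrange constant on the real axis.
  refine ⟨⟨-(2 * ExternalSource.realEnergy μ₁ μ₁ - ExternalSource.realEnergy μ₁ μ₂ +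
    ∫ z, (ExternalSource.evenPoly d v z.re - a * |z.re|) ∂μ₁), fun x hx => ?_, fun x _ => ?_⟩,
    hμ₂.2, fun z hre hz => hmin.two_mul_pot_lt ha hi hfin hre hz⟩
  · have h := (hmin.le_on_support hV hB hx).2
    rw [ofReal_re] at h
    linarith [hle x]
  · linarith [hle x]
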